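/- Let $k$ be a field of characteristic zero and let $R=\bigoplus_{i\ge 0}R_i$ be a commutative Noetherian $\mathbb N$-graded Cohen--Macaulay ring with $R_0=k$; put $\mathfrak m=\bigoplus_{i>0}R_i$ and $d=\dim R$. Graded modules are $\mathbb Z$-graded, their morphisms are the $R$-linear maps that preserve degrees, and $[X,M]$ denotes the (finite) $k$-dimension of the space of these morphisms from $X$ to $M$, for finitely generated graded $R$-modules $X$ and $M$. A finitely generated graded $R$-module $M$ is called graded Cohen--Macaulay if $\mathrm{Ext}^i_R(R/\mathfrak m,M)=0$ for all $i<d$. Let $V=k[[t]]$ and $K=V_t=k((t))$, both placed in degree $0$. For finitely generated graded $R$-modules $M$ and $N$, we say that $M$ gradually degenerates to $N$ if there is a finitely generated graded $R\otimes_k V$-module $Q$ such that $Q$ is flat over $V$, $Q\otimes_V V/tV\cong N$ as graded $R$-modules, and $Q\otimes_V K\cong M\otimes_k K$ as graded $R\otimes_k K$-modules. **Lemma 3.9 (Cancellation property).** Let $M$, $N$ and $X$ be finitely generated graded $R$-modules. (1) Assume that $[X,M]=[X,N]$. If $M\oplus X$ gradually degenerates to $N\oplus X$, then $M$ gradually degenerates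 to $N$. (2) Assume that $R$ is Gorenstein and that $M$ and $N$ are graded Cohen--Macaulay. Let $F$ be a finitely generated graded free $R$-module, and suppose that $M$ gradually degenerates to $N\oplus F$. Then $F$ is isomorphic to a graded direct summand of $M$, and for every split injective morphism of graded modules $F\to M$ the quotient $M/F$ gradually degenerates to $N$. -/

import Mathlib

open scoped TensorProduct PowerSeries

universe u

namespace GradedDegeneration

/-- `ℳ` is a `ℤ`-grading on the module `M` over the `ℕ`-graded ring `(A, 𝒜)`: the module `M` is the
internal direct sum of the pieces `ℳ n`, and `𝒜 i • ℳ n ⊆ ℳ (i + n)`. The pieces are taken to be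
submodules over a base ring `S` that lies in degree zero of `A`. -/
structure IsGradedModule {S A M : Type*} [CommRing S] [CommRing A] [Algebra S A]
    [AddCommGroup M] [Module S M] [Module A M]
    (𝒜 : ℕ → Submodule S A) (ℳ : ℤ → Submodule S M) : Prop where
  isInternal : DirectSum.IsInternal ℳ
  smul_mem : ∀ ⦃i : ℕ⦄ ⦃n : ℤ⦄ ⦃a : A⦄ ⦃m : M⦄, a ∈ 𝒜 i → m ∈ ℳ n → a • m ∈ ℳ ((i : ℤ) + n)

/-- The localization `K = V_t` of `V = k[[t]]` at `t`, i.e. the field `k((t))`. -/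
abbrev Loc (k : Type u) [Field k] : Type u := Localization.Away (PowerSeries.X : k⟦X⟧)

section

variable {k R : Type u} [Field k] [CommRing R] [Algebra k R]

/-- The grading of `M ⊕ N`. -/
def prodGrading {M N : Type*} [AddCommGroup M] [Module k M] [AddCommGroup N] [Module k N]
    (ℳ : ℤ → Submodule k M) (𝒩 : ℤ → Submodule k N) : ℤ → Submodule k (M × N) :=
  fun n => (ℳ n).prod (𝒩 n)

/-- The grading induced on the quotient of `M` by an `R`-submodule `P`
(used for homogeneous `P`). -/
def quotientGrading {M : Type*} [AddCommGroup M] [Module k M] [Module R M] [IsScalarTower k R M]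
    (ℳ : ℤ → Submodule k M) (P : Submodule R M) : ℤ → Submodule k (M ⧸ P) :=
  fun n => (ℳ n).map (P.mkQ.restrictScalars k)

/-- An `R`-linear map is a morphism of graded modules if it preserves degrees. -/
def IsHomogeneousMap {M N : Type*} [AddCommGroup M] [Module k M] [Module R M]
    [AddCommGroup N] [Module k N] [Module R N]
    (ℳ : ℤ → Submodule k M) (𝒩 : ℤ → Submodule k N) (f : M →ₗ[R] N) : Prop :=
  ∀ n, ∀ m ∈ ℳ n, f m ∈ 𝒩 n

/-- The `k`-vector space of morphisms of graded `R`-modules (of degree zero) from `M` to `N`. -/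
def gradedHom {M N : Type*} [AddCommGroup M] [Module k M] [Module R M] [IsScalarTower k R M]
    [AddCommGroup N] [Module k N] [Module R N] [IsScalarTower k R N]
    (ℳ : ℤ → Submodule k M) (𝒩 : ℤ → Submodule k N) : Submodule k (M →ₗ[R] N) where
  carrier := {f | IsHomogeneousMap ℳ 𝒩 f}
  zero_mem' := fun n _ _ => (𝒩 n).zero_mem
  add_mem' := fun hf hg n m hm => (𝒩 n).add_mem (hf n m hm) (hg n m hm)
  smul_mem' := fun c _ hf n m hm => (𝒩 n).smul_mem c (hf n m hm)

variable (R) in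
/-- `[M, N]`, the dimension over `k` of the space of morphisms of graded `R`-modules from `M` to
`N`. -/
noncomputable def homDim {M N : Type*}
    [AddCommGroup M] [Module k M] [Module R M] [IsScalarTower k R M]
    [AddCommGroup N] [Module k N] [Module R N] [IsScalarTower k R N]
    (ℳ : ℤ → Submodule k M) (𝒩 : ℤ → Submodule k N) : ℕ :=
  Module.finrank k (gradedHom (R := R) ℳ 𝒩)

variable (R) in
/-- A graded free module: one that has a basis of homogeneous elements, i.e. a direct sum of
shifts `R(a)`. -/
def IsGradedFree {F : Type u} [AddCommGroup F] [Module k F] [Module R F]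
    (ℱ : ℤ → Submodule k F) : Prop :=
  ∃ (ι : Type u) (b : Module.Basis ι R F) (d : ι → ℤ), ∀ i, b i ∈ ℱ (d i)

/-- `M` gradually degenerates to `N`. Let `V = k[[t]]`, `K = V_t = k((t))`, both in degree zero.
There is a finitely generated graded module `Q` over `V ⊗ R`, where `V ⊗ R` carries the grading
with pieces `V ⊗ 𝒜 i`, such that
* `Q` is flat over `V`;
* there is an isomorphism `e` of graded `R`-modules from `V/tV ⊗_V Q` to `N`;
* there is an isomorphism `e` of graded `K ⊗ R`-modules from `K ⊗_V Q` to `K ⊗_k M`, that is, one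
  which is `K`-linear, compatible with the action of `R`, and respects the degrees.

In both tensor products `R` acts through the right-hand factor (on `Q` through `R → V ⊗ R`,
`r ↦ 1 ⊗ r`), and the piece of degree `n` is the base change of the piece of degree `n`. -/
def Degenerates (𝒜 : ℕ → Submodule k R) {M N : Type u}
    [AddCommGroup M] [Module k M] [Module R M] [IsScalarTower k R M]
    [AddCommGroup N] [Module k N] [Module R N]
    (ℳ : ℤ → Submodule k M) (𝒩 : ℤ → Submodule k N) : Prop :=
  ∃ (Q : Type u) (_ : AddCommGroup Q) (_ : Module k⟦X⟧ Q) (_ : Module (k⟦X⟧ ⊗[k] R) Q)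
    (_ : IsScalarTower k⟦X⟧ (k⟦X⟧ ⊗[k] R) Q) (𝒬 : ℤ → Submodule k⟦X⟧ Q),
    IsGradedModule (fun i => (𝒜 i).baseChange k⟦X⟧) 𝒬 ∧
    Module.Finite (k⟦X⟧ ⊗[k] R) Q ∧
    Module.Flat k⟦X⟧ Q ∧
    (∃ e : ((k⟦X⟧ ⧸ Ideal.span {(PowerSeries.X : k⟦X⟧)}) ⊗[k⟦X⟧] Q) ≃ₗ[k] N,
      (∀ (r : R) (x : (k⟦X⟧ ⧸ Ideal.span {(PowerSeries.X : k⟦X⟧)}) ⊗[k⟦X⟧] Q),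
        e ((Algebra.lsmul k⟦X⟧ k⟦X⟧ Q ((1 : k⟦X⟧) ⊗ₜ[k] r)).baseChange _ x) = r • e x) ∧
      (∀ (n : ℤ) (x : (k⟦X⟧ ⧸ Ideal.span {(PowerSeries.X : k⟦X⟧)}) ⊗[k⟦X⟧] Q),
        e x ∈ 𝒩 n ↔ x ∈ (𝒬 n).baseChange (k⟦X⟧ ⧸ Ideal.span {(PowerSeries.X : k⟦X⟧)}))) ∧
    (∃ e : (Loc k ⊗[k⟦X⟧] Q) ≃ₗ[Loc k] (Loc k ⊗[k] M),
      (∀ (r : R) (x : Loc k ⊗[k⟦X⟧] Q),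
        e ((Algebra.lsmul k⟦X⟧ k⟦X⟧ Q ((1 : k⟦X⟧) ⊗ₜ[k] r)).baseChange (Loc k) x) =
          (Algebra.lsmul k k M r).baseChange (Loc k) (e x)) ∧
      (∀ (n : ℤ) (x : Loc k ⊗[k⟦X⟧] Q),
        e x ∈ (ℳ n).baseChange (Loc k) ↔ x ∈ (𝒬 n).baseChange (Loc k)))

/-- A graded module `M` over `R` is graded Cohen-Macaulay if `Ext^i_R(R/𝔪, M) = 0` for all
`i < dim R`, where `𝔪` is the ideal of elements of positive degree. As `R/𝔪` is finitely generated
(and `R` is Noetherian), the graded `Ext` module has the usual `Ext` as its underlying module. -/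
def IsGradedCM (𝒜 : ℕ → Submodule k R) [GradedAlgebra 𝒜] (M : Type u)
    [AddCommGroup M] [Module R M] : Prop :=
  ∀ i : ℕ, (i : WithBot ℕ∞) < ringKrullDim R →
    Subsingleton (CategoryTheory.Abelian.Ext
      (ModuleCat.of R (R ⧸ (HomogeneousIdeal.irrelevant 𝒜).toIdeal)) (ModuleCat.of R M) i)

/-- A (Noetherian) ring is Gorenstein if its localization at each prime ideal has finite injective
dimension as a module over itself. -/
def IsGorenstein (A : Type u) [CommRing A] : Prop :=
  ∀ (p : Ideal A) [p.IsPrime], ∃ n : ℕ, CategoryTheory.HasInjectiveDimensionLE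
    (ModuleCat.of (Localization.AtPrime p) (Localization.AtPrime p)) n

end

end GradedDegeneration

set_option linter.unusedSectionVars false

/-! A degeneration is handled as a lattice: a family `Q` over `V = k⟦X⟧` with a reduction map `π`
onto the special fibre and an embedding `ι` into the generic fibre `K ⊗ M`. To cancel a summand `X`
of the special fibre `N ⊕ X`, lift its inclusion to `f : X → Q` and divide `Q` by the `V`-span of
the image of `f`. The span is saturated because `f` is injective modulo the uniformizer `t`, so the
quotient is torsion-free, hence flat, and its special fibre is `N`. Its generic fibre is the
complement cut out by a given splitting `i`, `p` of the generic fibre as soon as `p ∘ f` is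
bijective over `K`. That can be arranged: adding `s t g` to `f`, where `g` is `t ^ n i` made
integral, does not change `f` modulo `t` and replaces the composite `A` by `A + s t ^ (n + 1)`,
which is invertible for some `s` in the infinite field `k`. This is `IsDegeneration.cancel`, and it
leaves a lifting problem in each part.

In (1), the graded maps `X → Q` form a free `V`-module of finite rank. The rank is at least the
dimension of the maps to the generic fibre, and the reduction modulo `t` embeds into the maps to the
special fibre. Equality of dimensions makes every map to the special fibre lift
(`IsDegeneration.exists_lift`).

In (2), the inclusion of `F` lifts because `F` is free, but a splitting of `M` has to be produced,
and this uses a lift of the projection `N ⊕ F → F`. The obstruction to lifting functionals lies in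
`Ext¹(Q, V ⊗ R)`. Near the irrelevant ideal it vanishes: `Ext¹(N, R)` does so there for `N`
Cohen-Macaulay and `R` Gorenstein, and Nakayama's lemma carries this over to the family
(`exists_functional_lift`). The degree zero part of the local lift is a graded lift. The composite
`F → Q → V ⊗ F` is the identity modulo `t`, hence injective over `K`. Its two factors are finite
combinations, with coefficients in `K`, of graded maps defined over `k`; a determinant that is
nonzero for these coefficients is nonzero for some coefficients in `k`, and this splits `F` off `M`
(`exists_graded_splitting`). -/

namespace GradedDegeneration

/-! ### Homogeneous components in internal gradings. -/

section Projections

variable {S M T : Type*} [CommRing S] [AddCommGroup M] [Module S M] [AddCommGroup T] [Module S T]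
  {ℳ : ℤ → Submodule S M} {𝒯 : ℤ → Submodule S T}

/-- The projection onto the piece of degree `n` of an internal grading. -/
noncomputable def proj (h : DirectSum.IsInternal ℳ) (n : ℤ) : M →ₗ[S] M :=
  (ℳ n).subtype ∘ₗ DirectSum.component S ℤ (fun i => ℳ i) n ∘ₗ
    (LinearEquiv.ofBijective (DirectSum.coeLinearMap ℳ) h).symm.toLinearMap

theorem proj_mem (h : DirectSum.IsInternal ℳ) (n : ℤ) (m : M) : proj h n m ∈ ℳ n :=
  Submodule.coe_mem _

theorem proj_of_mem (h : DirectSum.IsInternal ℳ) {n : ℤ} {m : M} (hm : m ∈ ℳ n) :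
    proj h n m = m :=
  congrArg Subtype.val (h.ofBijective_coeLinearMap_of_mem hm)

theorem proj_of_mem_ne (h : DirectSum.IsInternal ℳ) {n i : ℤ} (hi : i ≠ n) {m : M}
    (hm : m ∈ ℳ i) : proj h n m = 0 :=
  congrArg Subtype.val (h.ofBijective_coeLinearMap_of_mem_ne hi hm)

/-- Induction on sums of homogeneous elements. -/
theorem homogeneous_induction (h : iSup ℳ = ⊤) {P : M → Prop}
    (mem : ∀ n, ∀ m ∈ ℳ n, P m) (zero : P 0) (add : ∀ x y, P x → P y → P (x + y)) (m : M) : P m :=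
  Submodule.iSup_induction ℳ (motive := P) (h ▸ Submodule.mem_top) mem zero add

/-- Independence holds because `p n` fixes the piece of degree `n` and kills the sum of all others.
-/
theorem isInternal_of_proj (h : iSup ℳ = ⊤) (p : ℤ → M →ₗ[S] M)
    (hp : ∀ n, ∀ m ∈ ℳ n, p n m = m) (hp' : ∀ n i, i ≠ n → ∀ m ∈ ℳ i, p n m = 0) :
    DirectSum.IsInternal ℳ := by
  refine DirectSum.isInternal_submodule_of_iSupIndep_of_iSup_eq_top (fun n => ?_) h
  rw [Submodule.disjoint_def]
  intro x hx hx'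
  have : (⨆ j, ⨆ _ : j ≠ n, ℳ j) ≤ LinearMap.ker (p n) :=
    iSup₂_le fun j hj m hm => hp' n j hj m hm
  rw [← hp n x hx]
  exact this hx'

/-- The degree zero part of a linear map between graded modules. -/
noncomputable def degreeZeroPart (hℳ : DirectSum.IsInternal ℳ) (h𝒯 : DirectSum.IsInternal 𝒯)
    (f : M →ₗ[S] T) : M →ₗ[S] T :=
  DirectSum.toModule S ℤ T (fun n => proj h𝒯 n ∘ₗ f ∘ₗ (ℳ n).subtype) ∘ₗ
    (LinearEquiv.ofBijective (DirectSum.coeLinearMap ℳ) hℳ).symm.toLinearMap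

theorem degreeZeroPart_apply (hℳ : DirectSum.IsInternal ℳ) (h𝒯 : DirectSum.IsInternal 𝒯)
    (f : M →ₗ[S] T) {n : ℤ} {m : M} (hm : m ∈ ℳ n) :
    degreeZeroPart hℳ h𝒯 f m = proj h𝒯 n (f m) := by
  have : (LinearEquiv.ofBijective (DirectSum.coeLinearMap ℳ) hℳ).symm m =
      DirectSum.lof S ℤ (fun i => ℳ i) n ⟨m, hm⟩ :=
    (LinearEquiv.symm_apply_eq _).2 (DirectSum.coeLinearMap_lof ℳ n ⟨m, hm⟩).symm
  rw [degreeZeroPart, LinearMap.comp_apply, LinearEquiv.coe_coe, this, DirectSum.toModule_lof]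
  rfl

/-- The map is only additive and the base rings may differ, so that this applies to `π` and
`reduction`, which go from `V`-modules to `k`-modules. -/
theorem proj_comp_of_graded {S' T : Type*} [CommRing S'] [AddCommGroup T] [Module S' T]
    {𝒯 : ℤ → Submodule S' T} (hℳ : DirectSum.IsInternal ℳ) (h𝒯 : DirectSum.IsInternal 𝒯)
    {f : M →+ T} (hf : ∀ n, ∀ m ∈ ℳ n, f m ∈ 𝒯 n) (n : ℤ) (m : M) :
    proj h𝒯 n (f m) = f (proj hℳ n m) := by
  refine homogeneous_induction (P := fun m => proj h𝒯 n (f m) = f (proj hℳ n m))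
    hℳ.submodule_iSup_eq_top (fun i x hx => ?_) (by simp)
    (fun x y hx hy => by simp only [map_add, hx, hy]) m
  by_cases hi : i = n
  · subst hi
    rw [proj_of_mem _ hx, proj_of_mem _ (hf _ _ hx)]
  · rw [proj_of_mem_ne _ hi hx, proj_of_mem_ne _ hi (hf _ _ hx), map_zero]

theorem prodGrading_isInternal {k M N : Type*} [Field k] [AddCommGroup M] [Module k M]
    [AddCommGroup N] [Module k N]
    {ℳ : ℤ → Submodule k M} {𝒩 : ℤ → Submodule k N} (hℳ : DirectSum.IsInternal ℳ)
    (h𝒩 : DirectSum.IsInternal 𝒩) : DirectSum.IsInternal (prodGrading ℳ 𝒩) := by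
  refine isInternal_of_proj ?_ (fun n => (proj hℳ n).prodMap (proj h𝒩 n)) ?_ ?_
  · rw [eq_top_iff]
    rintro ⟨m, n⟩ -
    have h1 : ((m, 0) : M × N) ∈ iSup (prodGrading ℳ 𝒩) :=
      homogeneous_induction hℳ.submodule_iSup_eq_top
        (P := fun m => ((m, 0) : M × N) ∈ iSup (prodGrading ℳ 𝒩))
        (fun i x hx => Submodule.mem_iSup_of_mem i ⟨hx, zero_mem _⟩) (zero_mem _)
        (fun x y hx hy => by simpa using add_mem hx hy) m
    have h2 : ((0, n) : M × N) ∈ iSup (prodGrading ℳ 𝒩) :=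
      homogeneous_induction h𝒩.submodule_iSup_eq_top
        (P := fun n => ((0, n) : M × N) ∈ iSup (prodGrading ℳ 𝒩))
        (fun i x hx => Submodule.mem_iSup_of_mem i ⟨zero_mem _, hx⟩) (zero_mem _)
        (fun x y hx hy => by simpa using add_mem hx hy) n
    simpa using add_mem h1 h2
  · rintro n ⟨x, y⟩ ⟨hx, hy⟩
    simp only [LinearMap.prodMap_apply, proj_of_mem hℳ hx, proj_of_mem h𝒩 hy]
  · rintro n i hi ⟨x, y⟩ ⟨hx, hy⟩
    simp only [LinearMap.prodMap_apply, proj_of_mem_ne hℳ hi hx, proj_of_mem_ne h𝒩 hi hy]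
    rfl

end Projections

/-- An injective map that respects two gradings reflects degrees. -/
theorem mem_iff_of_injective {S S' M T F : Type*} [CommRing S] [CommRing S'] [AddCommGroup M]
    [Module S M] [AddCommGroup T] [Module S' T] {ℳ : ℤ → Submodule S M} {𝒯 : ℤ → Submodule S' T}
    [FunLike F M T] [AddMonoidHomClass F M T] (f : F)
    (hf : Function.Injective f)
    (hℳ : iSup ℳ = ⊤) (h𝒯 : DirectSum.IsInternal 𝒯)
    (hfg : ∀ n, ∀ m ∈ ℳ n, f m ∈ 𝒯 n) (n : ℤ) (m : M) : f m ∈ 𝒯 n ↔ m ∈ ℳ n := by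
  refine ⟨fun h => ?_, hfg n m⟩
  -- Stated for arbitrary `m`, so that induction over sums of homogeneous elements is possible.
  have key : ∃ m' ∈ ℳ n, proj h𝒯 n (f m) = f m' := by
    refine homogeneous_induction hℳ (P := fun m => ∃ m' ∈ ℳ n, proj h𝒯 n (f m) = f m')
      (fun i x hx => ?_) ⟨0, zero_mem _, by simp⟩ ?_ m
    · by_cases hi : i = n
      · subst hi
        exact ⟨x, hx, proj_of_mem _ (hfg _ _ hx)⟩
      · exact ⟨0, zero_mem _, by rw [proj_of_mem_ne _ hi (hfg _ _ hx), map_zero]⟩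
    · rintro x y ⟨x', hx', hx⟩ ⟨y', hy', hy⟩
      exact ⟨x' + y', add_mem hx' hy', by rw [map_add, map_add, map_add, hx, hy]⟩
  obtain ⟨m', hm', e⟩ := key
  rw [proj_of_mem _ h] at e
  rwa [hf e]

/-! ### Finiteness of graded modules and of their pieces. -/

section GradedModules

variable {S A M : Type*} [CommRing S] [CommRing A] [Algebra S A]
    [AddCommGroup M] [Module S M] [Module A M]
    {𝒜 : ℕ → Submodule S A} {ℳ : ℤ → Submodule S M}

/-- A finitely generated graded module is generated by finitely many homogeneous elements. -/
theorem IsGradedModule.exists_homogeneous_generators [Module.Finite A M]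
    (h : IsGradedModule 𝒜 ℳ) : ∃ (n : ℕ) (x : Fin n → M) (d : Fin n → ℤ),
      (∀ j, x j ∈ ℳ (d j)) ∧ Submodule.span A (Set.range x) = ⊤ := by
  have h1 : Submodule.span A (⋃ n, (ℳ n : Set M)) = ⊤ := by
    rw [eq_top_iff]
    rintro m -
    exact homogeneous_induction (P := fun m => m ∈ Submodule.span A (⋃ n, (ℳ n : Set M)))
      h.isInternal.submodule_iSup_eq_top
      (fun n x hx => Submodule.subset_span (Set.mem_iUnion.2 ⟨n, hx⟩)) (zero_mem _)
      (fun x y hx hy => add_mem hx hy) m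
  obtain ⟨t, ht, ht'⟩ := (Submodule.fg_span_iff_fg_span_finset_subset _).1
    (h1 ▸ Module.Finite.fg_top : (Submodule.span A (⋃ n, (ℳ n : Set M))).FG)
  have h2 : ∀ x : t, ∃ n, (x : M) ∈ ℳ n := fun x => Set.mem_iUnion.1 (ht x.2)
  choose d hd using h2
  refine ⟨t.card, fun j => t.equivFin.symm j, fun j => d (t.equivFin.symm j), fun j => hd _, ?_⟩
  rw [← h1, ht']
  congr 1
  ext x
  constructor
  · rintro ⟨j, rfl⟩
    exact (t.equivFin.symm j).2
  · intro hx
    exact ⟨t.equivFin ⟨x, hx⟩, by simp⟩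

variable [IsScalarTower S A M]

/-- The pieces of a finitely generated graded module over a Noetherian ring are Noetherian over
the degree zero part. -/
theorem IsGradedModule.isNoetherian_piece [GradedAlgebra 𝒜] [IsNoetherian A M]
    (h₀ : ∀ a ∈ 𝒜 0, ∃ s : S, algebraMap S A s = a)
    (h : IsGradedModule 𝒜 ℳ) (n : ℤ) : IsNoetherian S (ℳ n) := by
  -- `W ↦ A • W` is strictly monotone, since `W` is recovered as the degree `n` part of `A • W`:
  -- only scalars of degree zero contribute there. The chain condition descends from `M`.
  let F : Submodule S (ℳ n) → Submodule A M :=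
    fun W => Submodule.span A ((W.map (ℳ n).subtype : Submodule S M) : Set M)
  have hproj : ∀ (a : A) (w : M), w ∈ ℳ n →
      ∃ s : S, proj h.isInternal n (a • w) = s • w := by
    intro a w hw
    induction a using DirectSum.Decomposition.inductionOn 𝒜 with
    | zero => exact ⟨0, by simp⟩
    | @homogeneous i a =>
      by_cases hi : i = 0
      · subst hi
        obtain ⟨s, hs⟩ := h₀ a a.2
        refine ⟨s, ?_⟩
        rw [← hs, algebraMap_smul, map_smul, proj_of_mem _ hw]
      · refine ⟨0, ?_⟩
        rw [zero_smul]
        exact proj_of_mem_ne _ (by omega) (h.smul_mem a.2 hw)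
    | add a b ha hb =>
      obtain ⟨s, hs⟩ := ha
      obtain ⟨t, ht⟩ := hb
      exact ⟨s + t, by rw [add_smul, map_add, hs, ht, add_smul]⟩
  have hF : ∀ W, ∀ x : ℳ n, (x : M) ∈ F W → x ∈ W := by
    intro W x hx
    have : ∀ a : A, proj h.isInternal n (a • (x : M)) ∈ W.map (ℳ n).subtype := by
      refine Submodule.span_induction
        (p := fun y _ => ∀ a : A, proj h.isInternal n (a • y) ∈ W.map (ℳ n).subtype)
        ?_ ?_ ?_ ?_ hx
      · rintro y ⟨w, hw, rfl⟩ a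
        obtain ⟨s, hs⟩ := hproj a w w.2
        rw [Submodule.subtype_apply, hs]
        exact Submodule.smul_mem _ _ ⟨w, hw, rfl⟩
      · intro a
        simp
      · intro y z _ _ hy hz a
        rw [smul_add, map_add]
        exact add_mem (hy a) (hz a)
      · intro b y _ hy a
        rw [smul_smul]
        exact hy _
    have h1 := this 1
    rw [one_smul, proj_of_mem _ x.2] at h1
    obtain ⟨w, hw, e⟩ := h1
    rwa [← Subtype.ext e]
  have hmono : ∀ W W', F W ≤ F W' ↔ W ≤ W' := by
    intro W W'
    refine ⟨fun hW x hx => hF W' x (hW (Submodule.subset_span ⟨x, hx, rfl⟩)), fun hW => ?_⟩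
    exact Submodule.span_mono (Submodule.map_mono hW)
  have hs : StrictMono F := fun W W' hW =>
    lt_of_le_not_ge ((hmono _ _).2 hW.le) fun hc => not_le_of_gt hW ((hmono _ _).1 hc)
  rw [← monotone_stabilizes_iff_noetherian, ← wellFoundedGT_iff_monotone_chain_condition]
  exact hs.wellFoundedGT

end GradedModules

/-! ### Degenerations as families with a reduction map and a generic embedding. -/

section DegenerationData

variable {k R : Type u} [Field k] [CommRing R] [Algebra k R]

/-- The action of `r : R` on `K ⊗ M` through the right-hand factor. -/
noncomputable abbrev locAct (M : Type u) [AddCommGroup M]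
    [Module k M] [Module R M] [IsScalarTower k R M] (r : R) :
    (Loc k ⊗[k] M) →ₗ[Loc k] (Loc k ⊗[k] M) :=
  (Algebra.lsmul k k M r).baseChange (Loc k)

variable (R) in
/-- A family `Q` over `V = k⟦X⟧` with special fibre `N` (through `π`) and generic fibre `K ⊗ M`
(through the localization map `ι`). -/
structure IsDegeneration {M N Q : Type u}
    [AddCommGroup M] [Module k M] [Module R M] [IsScalarTower k R M]
    [AddCommGroup N] [Module k N] [Module R N]
    [AddCommGroup Q] [Module k⟦X⟧ Q] [Module (k⟦X⟧ ⊗[k] R) Q]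
    (ℳ : ℤ → Submodule k M) (𝒩 : ℤ → Submodule k N) (𝒬 : ℤ → Submodule k⟦X⟧ Q)
    (π : Q →+ N) (ι : Q →ₗ[k⟦X⟧] (Loc k ⊗[k] M)) : Prop where
  special_smul : ∀ (v : k⟦X⟧) (q : Q), π (v • q) = PowerSeries.constantCoeff v • π q
  special_act : ∀ (r : R) (q : Q), π (((1 : k⟦X⟧) ⊗ₜ[k] r) • q) = r • π q
  special_surjective : Function.Surjective π
  special_ker : ∀ q, π q = 0 → ∃ q', q = (PowerSeries.X : k⟦X⟧) • q'
  special_graded : ∀ n, ∀ q ∈ 𝒬 n, π q ∈ 𝒩 n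
  generic_injective : Function.Injective ι
  generic_act : ∀ (r : R) (q : Q), ι (((1 : k⟦X⟧) ⊗ₜ[k] r) • q) = locAct M r (ι q)
  generic_surj : ∀ z, ∃ (n : ℕ) (q : Q), ι q = (PowerSeries.X : k⟦X⟧) ^ n • z
  generic_graded : ∀ n, ∀ q ∈ 𝒬 n, ι q ∈ (ℳ n).baseChange (Loc k)

theorem isUnit_algebraMap_X :
    IsUnit (algebraMap k⟦X⟧ (Loc k) PowerSeries.X) :=
  IsLocalization.Away.algebraMap_isUnit _

theorem X_pow_smul_injective {T : Type*} [AddCommGroup T] [Module k⟦X⟧ T] [Module (Loc k) T]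
    [IsScalarTower k⟦X⟧ (Loc k) T] (n : ℕ) :
    Function.Injective fun z : T => (PowerSeries.X : k⟦X⟧) ^ n • z := by
  intro z w h
  simp only [← algebraMap_smul (Loc k) ((PowerSeries.X : k⟦X⟧) ^ n), map_pow] at h
  exact ((isUnit_algebraMap_X (k := k)).pow n).smul_left_cancel.1 h

theorem X_smul_injective_of_injective {T Q : Type*} [AddCommGroup T] [Module k⟦X⟧ T]
    [Module (Loc k) T] [IsScalarTower k⟦X⟧ (Loc k) T] [AddCommGroup Q] [Module k⟦X⟧ Q]
    {ι : Q →ₗ[k⟦X⟧] T} (hι : Function.Injective ι) (n : ℕ) :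
    Function.Injective fun q : Q => (PowerSeries.X : k⟦X⟧) ^ n • q := by
  intro z w h
  apply hι
  apply X_pow_smul_injective (k := k) n
  simpa using congrArg ι h

/-- Powers of the uniformizer already act invertibly on `T`, so a submodule that exhausts `T` after
division by them has `T` as its localization. -/
theorem isLocalizedModule_of_injective {T Q : Type*} [AddCommGroup T] [Module k⟦X⟧ T]
    [Module (Loc k) T] [IsScalarTower k⟦X⟧ (Loc k) T] [AddCommGroup Q] [Module k⟦X⟧ Q]
    {ι : Q →ₗ[k⟦X⟧] T} (hι : Function.Injective ι)
    (hs : ∀ z, ∃ (n : ℕ) (q : Q), ι q = (PowerSeries.X : k⟦X⟧) ^ n • z) :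
    IsLocalizedModule (Submonoid.powers (PowerSeries.X : k⟦X⟧)) ι := by
  rw [isLocalizedModule_iff]
  refine ⟨?_, fun z => ?_, fun h => ⟨1, by rw [hι h]⟩⟩
  · rintro ⟨_, n, rfl⟩
    have h1 : IsUnit (algebraMap k⟦X⟧ (Loc k) (PowerSeries.X ^ n)) := by
      rw [map_pow]
      exact isUnit_algebraMap_X.pow n
    have h2 := h1.map (algebraMap (Loc k) (Module.End (Loc k) T))
    rw [Module.End.isUnit_iff] at h2 ⊢
    convert h2 using 1
    ext z
    exact (algebraMap_smul (Loc k) ((PowerSeries.X : k⟦X⟧) ^ n) z).symm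
  · obtain ⟨n, q, h⟩ := hs z
    exact ⟨(q, ⟨_, n, rfl⟩), h.symm⟩

section

variable {M N Q : Type u}
    [AddCommGroup M] [Module k M] [Module R M] [IsScalarTower k R M]
    [AddCommGroup N] [Module k N] [Module R N]
    [AddCommGroup Q] [Module k⟦X⟧ Q] [Module (k⟦X⟧ ⊗[k] R) Q]
    [IsScalarTower k⟦X⟧ (k⟦X⟧ ⊗[k] R) Q]
    {𝒜 : ℕ → Submodule k R}
    {ℳ : ℤ → Submodule k M} {𝒩 : ℤ → Submodule k N} {𝒬 : ℤ → Submodule k⟦X⟧ Q}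
    {π : Q →+ N} {ι : Q →ₗ[k⟦X⟧] (Loc k ⊗[k] M)}

/-- The isomorphism of `V/XV ⊗ Q` with the target of a surjection with kernel `XQ`. -/
noncomputable def specialFibreEquiv (hsmul : ∀ (v : k⟦X⟧) q, π (v • q) = PowerSeries.constantCoeff v • π q)
    (hsurj : Function.Surjective π)
    (hker : ∀ q, π q = 0 → ∃ q', q = (PowerSeries.X : k⟦X⟧) • q') :
    ((k⟦X⟧ ⧸ Ideal.span {(PowerSeries.X : k⟦X⟧)}) ⊗[k⟦X⟧] Q) ≃ₗ[k] N :=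
  letI : Module k⟦X⟧ N := Module.compHom N (PowerSeries.constantCoeff (R := k))
  haveI : IsScalarTower k k⟦X⟧ N := ⟨fun c v x => by
    change PowerSeries.constantCoeff (c • v) • x = c • PowerSeries.constantCoeff v • x
    rw [PowerSeries.smul_eq_C_mul, map_mul, PowerSeries.constantCoeff_C, mul_smul]⟩
  let π' : Q →ₗ[k⟦X⟧] N := { π with map_smul' := hsmul }
  have hk : Ideal.span {(PowerSeries.X : k⟦X⟧)} • (⊤ : Submodule k⟦X⟧ Q) = LinearMap.ker π' := by
    rw [Submodule.ideal_span_singleton_smul]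
    ext q
    rw [Submodule.mem_smul_pointwise_iff_exists]
    constructor
    · rintro ⟨q, -, rfl⟩
      change π (_ • q) = 0
      rw [hsmul, PowerSeries.constantCoeff_X, zero_smul]
    · intro hq
      obtain ⟨q', rfl⟩ := hker q hq
      exact ⟨q', trivial, rfl⟩
  ((TensorProduct.quotTensorEquivQuotSMul Q (Ideal.span {(PowerSeries.X : k⟦X⟧)})).trans
    ((Submodule.quotEquivOfEq _ _ hk).trans
      (π'.quotKerEquivOfSurjective hsurj))).restrictScalars k

theorem specialFibreEquiv_tmul
    (hsmul : ∀ (v : k⟦X⟧) q, π (v • q) = PowerSeries.constantCoeff v • π q)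
    (hsurj : Function.Surjective π)
    (hker : ∀ q, π q = 0 → ∃ q', q = (PowerSeries.X : k⟦X⟧) • q') (q : Q) :
    specialFibreEquiv hsmul hsurj hker (1 ⊗ₜ q) = π q := by
  have := TensorProduct.quotTensorEquivQuotSMul_mk_tmul (M := Q)
    (Ideal.span {(PowerSeries.X : k⟦X⟧)}) 1 q
  rw [map_one, one_smul] at this
  rw [specialFibreEquiv, LinearEquiv.restrictScalars_apply, LinearEquiv.trans_apply, this]
  rfl

theorem one_tmul_surjective (x : (k⟦X⟧ ⧸ Ideal.span {(PowerSeries.X : k⟦X⟧)}) ⊗[k⟦X⟧] Q) :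
    ∃ q : Q, x = 1 ⊗ₜ q := by
  induction x with
  | zero => exact ⟨0, by simp⟩
  | add x y hx hy =>
    obtain ⟨a, rfl⟩ := hx
    obtain ⟨b, rfl⟩ := hy
    exact ⟨a + b, by rw [TensorProduct.tmul_add]⟩
  | tmul v q =>
    obtain ⟨v, rfl⟩ := Ideal.Quotient.mk_surjective v
    refine ⟨v • q, ?_⟩
    rw [← TensorProduct.smul_tmul, ← algebraMap_smul
      (k⟦X⟧ ⧸ Ideal.span {(PowerSeries.X : k⟦X⟧)}) v, smul_eq_mul, mul_one]
    rfl

/-- Flatness need not be part of the data: `Q` embeds into a `K`-module, so it is torsion-free,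
hence flat over the discrete valuation ring `k⟦X⟧`. -/
theorem IsDegeneration.degenerates (h𝒬 : IsGradedModule (fun i => (𝒜 i).baseChange k⟦X⟧) 𝒬)
    (hℳ : DirectSum.IsInternal ℳ) (h𝒩 : DirectSum.IsInternal 𝒩)
    [Module.Finite (k⟦X⟧ ⊗[k] R) Q] (h : IsDegeneration R ℳ 𝒩 𝒬 π ι) :
    Degenerates 𝒜 ℳ 𝒩 := by
  refine ⟨Q, _, _, _, inferInstance, 𝒬, h𝒬, inferInstance, ?_, ?_, ?_⟩
  · have : Module.IsTorsionFree k⟦X⟧ Q :=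
      h.generic_injective.moduleIsTorsionFree ι (fun v q => map_smul ι v q)
    infer_instance
  · have e1 := specialFibreEquiv_tmul h.special_smul h.special_surjective h.special_ker
    set e := specialFibreEquiv h.special_smul h.special_surjective h.special_ker
    refine ⟨e, fun r x => ?_, fun n x => ?_⟩
    · obtain ⟨q, rfl⟩ := one_tmul_surjective x
      rw [LinearMap.baseChange_tmul, e1, e1]
      exact h.special_act r q
    -- Between internal gradings an injective map that preserves degrees also reflects them, so only
    -- one inclusion is checked.
    · refine mem_iff_of_injective e e.injective (h𝒬.isInternal.baseChange).submodule_iSup_eq_top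
        h𝒩 (fun i y hy => ?_) n x
      rw [Submodule.baseChange_eq_span] at hy
      have hy' : ∃ q ∈ 𝒬 i, y = 1 ⊗ₜ q := by
        refine Submodule.span_induction ?_ ⟨0, zero_mem _, by simp⟩ ?_ ?_ hy
        · rintro _ ⟨q, hq, rfl⟩
          exact ⟨q, hq, rfl⟩
        · rintro _ _ _ _ ⟨a, ha, rfl⟩ ⟨b, hb, rfl⟩
          exact ⟨a + b, add_mem ha hb, by rw [TensorProduct.tmul_add]⟩
        · rintro v _ _ ⟨a, ha, rfl⟩
          obtain ⟨v, rfl⟩ := Ideal.Quotient.mk_surjective v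
          refine ⟨v • a, Submodule.smul_mem _ _ ha, ?_⟩
          rw [TensorProduct.tmul_smul, ← algebraMap_smul
            (k⟦X⟧ ⧸ Ideal.span {(PowerSeries.X : k⟦X⟧)}) v]
          rfl
      obtain ⟨q, hq, rfl⟩ := hy'
      rw [e1]
      exact h.special_graded i q hq
  · have hl := isLocalizedModule_of_injective h.generic_injective h.generic_surj
    let e₀ := IsLocalizedModule.linearEquiv (Submonoid.powers (PowerSeries.X : k⟦X⟧))
      (TensorProduct.mk k⟦X⟧ (Loc k) Q 1) ι
    let e := e₀.extendScalarsOfIsLocalization (Submonoid.powers (PowerSeries.X : k⟦X⟧)) (Loc k)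
    have e1 : ∀ q : Q, e (1 ⊗ₜ q) = ι q := fun q =>
      IsLocalizedModule.linearEquiv_apply (Submonoid.powers (PowerSeries.X : k⟦X⟧))
        (TensorProduct.mk k⟦X⟧ (Loc k) Q 1) ι q
    have e2 : ∀ (c : Loc k) (q : Q), e (c ⊗ₜ q) = c • ι q := fun c q => by
      rw [← e1, ← map_smul, TensorProduct.smul_tmul', smul_eq_mul, mul_one]
    refine ⟨e, fun r x => ?_, fun n x => ?_⟩
    · induction x with
      | zero => simp
      | add x y hx hy => simp only [map_add, hx, hy]
      | tmul c q =>
        rw [LinearMap.baseChange_tmul, e2, e2, map_smul]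
        congr 1
        exact h.generic_act r q
    · refine mem_iff_of_injective e e.injective (h𝒬.isInternal.baseChange).submodule_iSup_eq_top
        hℳ.baseChange (fun i y hy => ?_) n x
      rw [Submodule.baseChange_eq_span] at hy
      refine Submodule.span_induction ?_ (by simp) ?_ ?_ hy
      · rintro _ ⟨q, hq, rfl⟩
        rw [TensorProduct.mk_apply, e1]
        exact h.generic_graded i q hq
      · intro a b _ _ ha hb
        rw [map_add]
        exact add_mem ha hb
      · intro c a _ ha
        rw [map_smul]
        exact Submodule.smul_mem _ _ ha

end

/-- The two tensor products are replaced by the maps induced by `q ↦ 1 ⊗ q`; everything afterwards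
is done with elements of `Q`. -/
theorem Degenerates.exists_isDegeneration {M N : Type u}
    [AddCommGroup M] [Module k M] [Module R M] [IsScalarTower k R M]
    [AddCommGroup N] [Module k N] [Module R N]
    {𝒜 : ℕ → Submodule k R}
    {ℳ : ℤ → Submodule k M} {𝒩 : ℤ → Submodule k N} (h : Degenerates 𝒜 ℳ 𝒩) :
    ∃ (Q : Type u) (_ : AddCommGroup Q) (_ : Module k⟦X⟧ Q) (_ : Module (k⟦X⟧ ⊗[k] R) Q)
      (_ : IsScalarTower k⟦X⟧ (k⟦X⟧ ⊗[k] R) Q) (𝒬 : ℤ → Submodule k⟦X⟧ Q)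
      (π : Q →+ N) (ι : Q →ₗ[k⟦X⟧] (Loc k ⊗[k] M)),
      IsGradedModule (fun i => (𝒜 i).baseChange k⟦X⟧) 𝒬 ∧ Module.Finite (k⟦X⟧ ⊗[k] R) Q ∧
      IsDegeneration R ℳ 𝒩 𝒬 π ι := by
  obtain ⟨Q, _, _, _, _, 𝒬, h𝒬, _, _, ⟨e, he, he'⟩, ⟨e₁, he₁, he₁'⟩⟩ := h
  let I := Ideal.span {(PowerSeries.X : k⟦X⟧)}
  let π : Q →+ N := e.toLinearMap.toAddMonoidHom.comp
    (TensorProduct.mk k⟦X⟧ (k⟦X⟧ ⧸ I) Q 1).toAddMonoidHom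
  let ι : Q →ₗ[k⟦X⟧] (Loc k ⊗[k] M) :=
    (e₁.toLinearMap.restrictScalars k⟦X⟧) ∘ₗ TensorProduct.mk k⟦X⟧ (Loc k) Q 1
  have hπ : ∀ q, π q = e (1 ⊗ₜ q) := fun q => rfl
  have hι : ∀ q, ι q = e₁ (1 ⊗ₜ q) := fun q => rfl
  have hX : ∀ v : k⟦X⟧, Ideal.Quotient.mk I v =
      algebraMap k (k⟦X⟧ ⧸ I) (PowerSeries.constantCoeff v) := by
    intro v
    rw [IsScalarTower.algebraMap_apply k k⟦X⟧ (k⟦X⟧ ⧸ I), Ideal.Quotient.algebraMap_eq,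
      Ideal.Quotient.eq, Ideal.mem_span_singleton, PowerSeries.X_dvd_iff]
    simp
  have h1 : ∀ (v : k⟦X⟧) q, π (v • q) = PowerSeries.constantCoeff v • π q := by
    intro v q
    rw [hπ, hπ, ← map_smul, TensorProduct.tmul_smul, ← algebraMap_smul (k⟦X⟧ ⧸ I) v,
      Ideal.Quotient.algebraMap_eq, hX, algebraMap_smul]
  refine ⟨Q, _, _, _, inferInstance, 𝒬, π, ι, h𝒬, inferInstance, ?_⟩
  refine ⟨h1, fun r q => ?_, fun n => ?_, fun q hq => ?_, fun n q hq => ?_, ?_, fun r q => ?_,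
    fun z => ?_, fun n q hq => ?_⟩
  · rw [hπ, hπ, ← he]
    rfl
  · obtain ⟨q, hq⟩ := one_tmul_surjective (e.symm n)
    exact ⟨q, by rw [hπ, ← hq, LinearEquiv.apply_symm_apply]⟩
  · rw [hπ, map_eq_zero_iff _ e.injective] at hq
    have h2 := congrArg (TensorProduct.quotTensorEquivQuotSMul Q I) hq
    have h3 := TensorProduct.quotTensorEquivQuotSMul_mk_tmul (M := Q) I 1 q
    rw [map_one, one_smul] at h3
    rw [h3, map_zero, Submodule.Quotient.mk_eq_zero, Submodule.ideal_span_singleton_smul,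
      Submodule.mem_smul_pointwise_iff_exists] at h2
    obtain ⟨q', -, rfl⟩ := h2
    exact ⟨q', rfl⟩
  · rw [hπ, he']
    exact Submodule.tmul_mem_baseChange_of_mem _ hq
  · refine e₁.injective.comp ?_
    intro q q' hqq'
    obtain ⟨⟨_, n, rfl⟩, hc⟩ := (IsLocalizedModule.eq_iff_exists
      (Submonoid.powers (PowerSeries.X : k⟦X⟧)) (TensorProduct.mk k⟦X⟧ (Loc k) Q 1)).1 hqq'
    -- Flatness enters here: it makes `Q → K ⊗ Q` injective.
    have hreg : IsSMulRegular Q ((PowerSeries.X : k⟦X⟧) ^ n) :=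
      Module.Flat.isSMulRegular_of_nonZeroDivisors
        (mem_nonZeroDivisors_of_ne_zero (pow_ne_zero _ PowerSeries.X_ne_zero))
    exact hreg hc
  · rw [hι, hι, ← he₁]
    rfl
  · obtain ⟨⟨q, ⟨_, n, rfl⟩⟩, hq⟩ := IsLocalizedModule.surj
      (Submonoid.powers (PowerSeries.X : k⟦X⟧)) (TensorProduct.mk k⟦X⟧ (Loc k) Q 1) (e₁.symm z)
    refine ⟨n, q, ?_⟩
    have := congrArg e₁ hq
    rw [TensorProduct.mk_apply] at this
    rw [hι, ← this, Submonoid.smul_def, ← algebraMap_smul (Loc k), map_smul,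
      LinearEquiv.apply_symm_apply, algebraMap_smul]
  · rw [hι, he₁']
    exact Submodule.tmul_mem_baseChange_of_mem _ hq

end DegenerationData

/-! ### Invertible members of a pencil of endomorphisms. -/

theorem exists_isUnit_add_algebraMap {k L E : Type*} [Field k] [Infinite k] [CommRing L]
    [IsDomain L] (hL : ∀ a : L, a ≠ 0 → IsUnit a) [Algebra k L] [Ring E] [Algebra L E]
    {A : E} {q : Polynomial L} (hq : q.Monic) (hA : Polynomial.aeval A q = 0) {c : L}
    (hc : c ≠ 0) : ∃ s : k, IsUnit (A + algebraMap L E (algebraMap k L s * c)) := by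
  classical
  have hinj : Function.Injective fun s : k => -(algebraMap k L s * c) := by
    intro s s' h
    exact (algebraMap k L).injective (mul_right_cancel₀ hc (neg_injective h))
  obtain ⟨s, hs⟩ : ∃ s : k, ¬ q.IsRoot (-(algebraMap k L s * c)) := by
    by_contra hcon
    push Not at hcon
    refine (Set.infinite_range_of_injective hinj) ((q.roots.toFinset.finite_toSet).subset ?_)
    rintro _ ⟨s, rfl⟩
    simpa [hq.ne_zero] using hcon s
  refine ⟨s, ?_⟩
  set μ := -(algebraMap k L s * c) with hμ
  obtain ⟨g, hg⟩ := Polynomial.X_sub_C_dvd_sub_C_eval (a := μ) (p := q)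
  -- Evaluated at `A`, where `q` vanishes, this exhibits `A - μ` as a factor of the unit `q(μ)`.
  have h1 : (Polynomial.X - Polynomial.C μ) * (-g) + q = Polynomial.C (q.eval μ) := by
    linear_combination hg
  have h2 : IsUnit (Polynomial.aeval A (Polynomial.C (q.eval μ))) := by
    rw [Polynomial.aeval_C]
    exact (hL _ hs).map _
  rw [← h1, map_add, hA, add_zero, map_mul] at h2
  have h3 := ((Commute.isUnit_mul_iff
    ((Commute.all (Polynomial.X - Polynomial.C μ) (-g)).map (Polynomial.aeval A))).1 h2).1
  rwa [map_sub, Polynomial.aeval_X, Polynomial.aeval_C, hμ, map_neg, sub_neg_eq_add] at h3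

/-- Cayley-Hamilton on `W` gives a monic `q` with `q(A) = 0` on `W`. The kernel of `q(A)` is stable
under `Λ`, whose members commute with `A`, and `W` generates `Y` under `Λ`; so `q(A) = 0` on all of
`Y`. -/
theorem exists_bijective_add_smul_of_fg {k L Y : Type*} [Field k] [Infinite k] [CommRing L]
    [IsDomain L] (hL : ∀ a : L, a ≠ 0 → IsUnit a) [Algebra k L] [AddCommGroup Y] [Module L Y]
    (A : Module.End L Y) (W : Submodule L Y) (hW : W.FG) (hAW : ∀ w ∈ W, A w ∈ W)
    (Λ : Set (Module.End L Y)) (hΛ : ∀ ρ ∈ Λ, Commute A ρ)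
    (hgen : ∀ P : Submodule L Y, W ≤ P → (∀ ρ ∈ Λ, ∀ z ∈ P, ρ z ∈ P) → P = ⊤) {c : L}
    (hc : c ≠ 0) :
    ∃ s : k, Function.Bijective fun z => A z + (algebraMap k L s * c) • z := by
  have := Module.Finite.iff_fg.2 hW
  obtain ⟨q, hq, hq'⟩ := LinearMap.exists_monic_and_aeval_eq_zero L (M := W) (A.restrict hAW)
  have h1 : ∀ (p : Polynomial L) (w : W),
      ((Polynomial.aeval (A.restrict hAW : Module.End L W) p w : W) : Y) =
        Polynomial.aeval A p w := by
    intro p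
    induction p using Polynomial.induction_on with
    | C a => intro w; simp
    | add p q hp hq => intro w; simp [hp, hq]
    | monomial n a h =>
      intro w
      rw [pow_succ, ← mul_assoc, map_mul, Module.End.mul_apply, h,
        map_mul (Polynomial.aeval A) (Polynomial.C a * Polynomial.X ^ n), Module.End.mul_apply]
      simp
  have h2 : Polynomial.aeval A q = 0 := by
    rw [← LinearMap.ker_eq_top]
    refine hgen _ (fun w hw => ?_) fun ρ hρ z hz => ?_
    · have := h1 q ⟨w, hw⟩
      rw [hq'] at this
      exact this.symm
    · have h3 : ∀ p : Polynomial L, Commute (Polynomial.aeval A p) ρ := by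
        intro p
        induction p using Polynomial.induction_on' with
        | add p q hp hq => rw [map_add]; exact hp.add_left hq
        | monomial n a =>
          rw [Polynomial.aeval_monomial]
          exact Commute.mul_left (Algebra.commutes a _) ((hΛ ρ hρ).pow_left n)
      rw [LinearMap.mem_ker] at hz ⊢
      have := LinearMap.congr_fun (h3 q) z
      rw [Module.End.mul_apply, Module.End.mul_apply, hz, map_zero] at this
      exact this
  obtain ⟨s, hu⟩ := exists_isUnit_add_algebraMap (k := k) hL hq h2 hc
  refine ⟨s, ?_⟩
  rw [Module.End.isUnit_iff] at hu
  exact hu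

/-! ### The localization `K` as a field. -/

section LocField

variable (k : Type u) [Field k]

theorem isField_loc : IsField (Loc k) := by
  have : IsLocalization (Submonoid.powers (PowerSeries.X : k⟦X⟧)) (LaurentSeries k) :=
    LaurentSeries.of_powerSeries_localization
  have e : Loc k ≃ₐ[k⟦X⟧] LaurentSeries k :=
    IsLocalization.algEquiv (Submonoid.powers (PowerSeries.X : k⟦X⟧)) _ _
  exact MulEquiv.isField (Field.toIsField (LaurentSeries k)) e.toMulEquiv

instance : IsDomain (Loc k) := (isField_loc k).isDomain

instance : Nontrivial (Loc k) := (isField_loc k).nontrivial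

variable {k}

theorem isUnit_of_loc_ne_zero {a : Loc k} (ha : a ≠ 0) : IsUnit a := by
  obtain ⟨b, hb⟩ := (isField_loc k).mul_inv_cancel ha
  exact IsUnit.of_mul_eq_one b hb

theorem exists_X_pow_smul_loc (a : Loc k) :
    ∃ (n : ℕ) (v : k⟦X⟧), (PowerSeries.X : k⟦X⟧) ^ n • a = algebraMap k⟦X⟧ (Loc k) v := by
  obtain ⟨⟨v, ⟨_, n, rfl⟩⟩, h⟩ :=
    IsLocalization.surj (Submonoid.powers (PowerSeries.X : k⟦X⟧)) a
  exact ⟨n, v, by rw [Algebra.smul_def, mul_comm]; exact h⟩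

end LocField

/-! ### The pencil argument for graded endomorphisms of `K ⊗ X`. -/

section Generic

variable {k R : Type u} [Field k] [CommRing R] [Algebra k R]
  {X : Type u} [AddCommGroup X] [Module k X] [Module R X] [IsScalarTower k R X]
  {𝒜 : ℕ → Submodule k R} {𝒳 : ℤ → Submodule k X}

/-- All but finitely many members of a pencil `A + s c`, `s ∈ k`, are bijective. -/
theorem exists_bijective_add_smul [Infinite k] [Module.Finite R X] (h𝒳 : IsGradedModule 𝒜 𝒳)
    (hfin : ∀ n, Module.Finite k (𝒳 n)) (A : Module.End (Loc k) (Loc k ⊗[k] X))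
    (hA : ∀ (r : R) z, A (locAct X r z) = locAct X r (A z))
    (hA' : ∀ n, ∀ z ∈ (𝒳 n).baseChange (Loc k), A z ∈ (𝒳 n).baseChange (Loc k))
    {c : Loc k} (hc : c ≠ 0) :
    ∃ s : k, Function.Bijective fun z => A z + (algebraMap k (Loc k) s * c) • z := by
  obtain ⟨m, x, d, hx, hspan⟩ := h𝒳.exists_homogeneous_generators
  -- The finite-dimensional space is the sum of the pieces in the degrees of a finite set of
  -- generators: it is stable because `A` is graded, and it generates `K ⊗ X` under `R`.
  refine exists_bijective_add_smul_of_fg (fun a ha => isUnit_of_loc_ne_zero ha) A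
    (⨆ j, (𝒳 (d j)).baseChange (Loc k)) (Submodule.fg_iSup _ fun j => ?_) ?_
    (Set.range (locAct X (R := R))) ?_ ?_ hc
  · exact Module.Finite.iff_fg.1 (Module.Finite.of_surjective _
      ((𝒳 (d j)).toBaseChange_surjective (Loc k)))
  · have : (⨆ j, (𝒳 (d j)).baseChange (Loc k)) ≤
        (⨆ j, (𝒳 (d j)).baseChange (Loc k)).comap A :=
      iSup_le fun j z hz => Submodule.mem_iSup_of_mem j (hA' _ z hz)
    exact this
  · rintro _ ⟨r, rfl⟩
    exact LinearMap.ext (hA r)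
  · intro P hP hP'
    have h2 : ∀ (y : X) (a : Loc k), a ⊗ₜ y ∈ P := by
      intro y
      have hy : y ∈ Submodule.span R (Set.range x) := hspan ▸ Submodule.mem_top
      induction hy using Submodule.span_induction with
      | mem y hy =>
        obtain ⟨j, rfl⟩ := hy
        exact fun a => hP (Submodule.mem_iSup_of_mem j
          (Submodule.tmul_mem_baseChange_of_mem _ (hx j)))
      | zero => intro a; simp
      | add y z _ _ hy hz => intro a; rw [TensorProduct.tmul_add]; exact add_mem (hy a) (hz a)
      | smul r y _ hy => exact fun a => hP' _ ⟨r, rfl⟩ _ (hy a)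
    rw [eq_top_iff]
    rintro z -
    induction z with
    | zero => exact zero_mem _
    | add x y hx hy => exact add_mem hx hy
    | tmul a y => exact h2 y a

end Generic

/-! ### Graded maps from a module to a family. -/

section Homs

variable {k R : Type u} [Field k] [CommRing R] [Algebra k R]
  {X Q : Type u} [AddCommGroup X] [Module k X] [Module R X] [IsScalarTower k R X]
  [AddCommGroup Q] [Module k⟦X⟧ Q] [Module (k⟦X⟧ ⊗[k] R) Q]
  [IsScalarTower k⟦X⟧ (k⟦X⟧ ⊗[k] R) Q]

variable (R) in
/-- The `V`-module of `R`-linear degree-preserving maps from an `R`-module to a `V ⊗ R`-module. -/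
def familyHom (𝒳 : ℤ → Submodule k X) (𝒬 : ℤ → Submodule k⟦X⟧ Q) : Submodule k⟦X⟧ (X →+ Q) where
  carrier := {f | (∀ (r : R) x, f (r • x) = ((1 : k⟦X⟧) ⊗ₜ[k] r) • f x) ∧
    ∀ n, ∀ x ∈ 𝒳 n, f x ∈ 𝒬 n}
  zero_mem' := ⟨fun r x => by simp, fun n x _ => zero_mem _⟩
  add_mem' := fun {f g} hf hg => ⟨fun r x => by
    simp only [AddMonoidHom.add_apply, hf.1, hg.1, smul_add],
    fun n x hx => add_mem (hf.2 n x hx) (hg.2 n x hx)⟩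
  smul_mem' := fun v f hf => ⟨fun r x => by
    rw [AddMonoidHom.smul_apply, AddMonoidHom.smul_apply, hf.1]
    exact (smul_comm _ _ _),
    fun n x hx => Submodule.smul_mem _ v (hf.2 n x hx)⟩

theorem tmul_smul_eq (v : k⟦X⟧) (r : R) (q : Q) :
    (v ⊗ₜ[k] r) • q = v • ((1 : k⟦X⟧) ⊗ₜ[k] r) • q := by
  rw [← smul_assoc, TensorProduct.smul_tmul', smul_eq_mul, mul_one]

variable {𝒳 : ℤ → Submodule k X} {𝒬 : ℤ → Submodule k⟦X⟧ Q}

/-- Scalars of `k` act through `R`, so `R`-linearity already implies compatibility with them. -/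
theorem familyHom_map_smul {f : X →+ Q} (hf : f ∈ familyHom R 𝒳 𝒬) (c : k) (x : X) :
    f (c • x) = (PowerSeries.C c : k⟦X⟧) • f x := by
  rw [← algebraMap_smul R c x, hf.1, Algebra.algebraMap_eq_smul_one, TensorProduct.tmul_smul,
    TensorProduct.smul_tmul', tmul_smul_eq, show ((1 : k⟦X⟧) ⊗ₜ[k] (1 : R)) = 1 from rfl, one_smul,
    PowerSeries.smul_eq_C_mul, mul_one]

variable {M : Type u} [AddCommGroup M] [Module k M] [Module R M] [IsScalarTower k R M]

/-- A member of `familyHom` followed by the localization map. -/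
noncomputable def familyHom.toGeneric (ι : Q →ₗ[k⟦X⟧] (Loc k ⊗[k] M)) {f : X →+ Q}
    (hf : f ∈ familyHom R 𝒳 𝒬) : X →ₗ[k] (Loc k ⊗[k] M) where
  toFun x := ι (f x)
  map_add' x y := by simp
  map_smul' c x := by
    rw [familyHom_map_smul hf, map_smul, RingHom.id_apply]
    exact algebraMap_smul k⟦X⟧ c (ι (f x))

variable {𝒜 : ℕ → Submodule k R}
  {N : Type u} [AddCommGroup N] [Module k N] [Module R N]
  {ℳ : ℤ → Submodule k M} {𝒩 : ℤ → Submodule k N}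
  {π : Q →+ N} {ι : Q →ₗ[k⟦X⟧] (Loc k ⊗[k] M)}

omit [IsScalarTower k R X] in
/-- After multiplication by a power of the uniformizer, a map to the generic fibre lands in the
family. -/
theorem IsDegeneration.exists_familyHom [Module.Finite R X]
    (h : IsDegeneration R ℳ 𝒩 𝒬 π ι) (h𝒬 : DirectSum.IsInternal 𝒬) (hℳ : DirectSum.IsInternal ℳ)
    (φ : X →+ (Loc k ⊗[k] M)) (hφ : ∀ (r : R) x, φ (r • x) = locAct M r (φ x))
    (hφ' : ∀ n, ∀ x ∈ 𝒳 n, φ x ∈ (ℳ n).baseChange (Loc k)) :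
    ∃ (n : ℕ) (g : X →+ Q), g ∈ familyHom R 𝒳 𝒬 ∧
      ∀ x, ι (g x) = (PowerSeries.X : k⟦X⟧) ^ n • φ x := by
  have hcomm : ∀ (r : R) (v : k⟦X⟧) (z : Loc k ⊗[k] M),
      locAct M r (v • z) = v • locAct M r z := by
    intro r v z
    rw [← algebraMap_smul (Loc k) v, map_smul, algebraMap_smul]
  -- `L n` consists of the elements that need at most the denominator `X ^ n`. These submodules
  -- increase and exhaust the finitely generated module, so one of them is everything.
  let L : ℕ → Submodule R X := fun n =>
    { carrier := {x | ∃ q, ι q = (PowerSeries.X : k⟦X⟧) ^ n • φ x}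
      zero_mem' := ⟨0, by simp⟩
      add_mem' := by
        rintro x y ⟨a, ha⟩ ⟨b, hb⟩
        exact ⟨a + b, by rw [map_add, map_add, ha, hb, smul_add]⟩
      smul_mem' := by
        rintro r x ⟨a, ha⟩
        exact ⟨((1 : k⟦X⟧) ⊗ₜ[k] r) • a, by rw [h.generic_act, ha, hφ, hcomm]⟩ }
  have hL : Monotone L := by
    refine monotone_nat_of_le_succ fun n => ?_
    rintro x ⟨q, hq⟩
    exact ⟨(PowerSeries.X : k⟦X⟧) • q, by rw [map_smul, hq, smul_smul, pow_succ']⟩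
  obtain ⟨t, ht⟩ := (Module.Finite.fg_top : (⊤ : Submodule R X).FG)
  have h1 : ∀ x : X, ∃ n, x ∈ L n := fun x => by
    obtain ⟨n, q, hq⟩ := h.generic_surj (φ x)
    exact ⟨n, q, hq⟩
  choose N hN using h1
  have h2 : ⊤ ≤ L (t.sup N) := by
    rw [← ht, Submodule.span_le]
    intro x hx
    exact hL (Finset.le_sup hx) (hN x)
  have h3 : ∀ x : X, ∃ q, ι q = (PowerSeries.X : k⟦X⟧) ^ (t.sup N) • φ x := fun x =>
    h2 (Submodule.mem_top (x := x))
  choose g hg using h3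
  refine ⟨t.sup N, AddMonoidHom.mk' g fun x y => h.generic_injective ?_, ⟨fun r x => ?_,
    fun n x hx => ?_⟩, hg⟩
  · rw [map_add, hg, hg, hg, map_add, smul_add]
  · apply h.generic_injective
    change ι (g (r • x)) = ι (((1 : k⟦X⟧) ⊗ₜ[k] r) • g x)
    rw [h.generic_act, hg, hg, hφ, hcomm]
  · refine (mem_iff_of_injective ι h.generic_injective h𝒬.submodule_iSup_eq_top
      (hℳ.baseChange (S := Loc k)) h.generic_graded n _).1 ?_
    rw [AddMonoidHom.mk'_apply, hg, ← algebraMap_smul (Loc k)]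
    exact Submodule.smul_mem _ _ (hφ' n x hx)

end Homs

/-- Independence of the pieces may be tested after an embedding into a graded module. This provides
the gradings on quotients, which are embedded as complements or as lattices. -/
theorem isInternal_of_injective {S S' M T F : Type*} [CommRing S] [CommRing S'] [AddCommGroup M]
    [Module S M] [AddCommGroup T] [Module S' T] {ℳ : ℤ → Submodule S M} {𝒯 : ℤ → Submodule S' T}
    [FunLike F M T] [AddMonoidHomClass F M T] (f : F)
    (hf : Function.Injective f) (hℳ : iSup ℳ = ⊤) (h𝒯 : DirectSum.IsInternal 𝒯)
    (hfg : ∀ n, ∀ m ∈ ℳ n, f m ∈ 𝒯 n) : DirectSum.IsInternal ℳ := by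
  refine DirectSum.isInternal_submodule_of_iSupIndep_of_iSup_eq_top (fun n => ?_) hℳ
  rw [Submodule.disjoint_def]
  intro x hx hx'
  have h1 : proj h𝒯 n (f x) = 0 := by
    refine Submodule.iSup_induction _ (motive := fun x => proj h𝒯 n (f x) = 0) hx' ?_ (by simp) ?_
    · intro j y hy
      by_cases hj : j = n
      · have : y ∈ (⊥ : Submodule S M) := by simpa [hj] using hy
        rw [(Submodule.mem_bot S).1 this, map_zero, map_zero]
      · have : y ∈ ℳ j := by simpa [hj] using hy
        exact proj_of_mem_ne _ hj (hfg _ _ this)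
    · intro y z hy hz
      rw [map_add, map_add, hy, hz, add_zero]
  rw [proj_of_mem h𝒯 (hfg n x hx)] at h1
  exact (map_eq_zero_iff f hf).1 h1

/-! ### Base change to `K` preserves degrees and the action of `R`. -/

section BaseChangeMaps

variable {k R : Type u} [Field k] [CommRing R] [Algebra k R]
  {M : Type u} [AddCommGroup M] [Module k M] [Module R M] [IsScalarTower k R M]
  {C : Type u} [AddCommGroup C] [Module k C] [Module R C] [IsScalarTower k R C]
  {ℳ : ℤ → Submodule k M} {𝒞 : ℤ → Submodule k C}

/-- The base change to `K` of an `R`-linear map. -/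
noncomputable abbrev locMap (f : M →ₗ[R] C) : (Loc k ⊗[k] M) →ₗ[Loc k] (Loc k ⊗[k] C) :=
  (f.restrictScalars k).baseChange (Loc k)

theorem locMap_locAct (f : M →ₗ[R] C) (r : R) (z : Loc k ⊗[k] M) :
    locMap f (locAct M r z) = locAct C r (locMap f z) := by
  rw [← LinearMap.comp_apply, ← LinearMap.comp_apply, ← LinearMap.baseChange_comp,
    ← LinearMap.baseChange_comp]
  congr 2
  ext x
  simp

theorem baseChange_graded {f : M →ₗ[k] C} (hf : ∀ n, ∀ x ∈ ℳ n, f x ∈ 𝒞 n) (n : ℤ)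
    (z : Loc k ⊗[k] M) (hz : z ∈ (ℳ n).baseChange (Loc k)) :
    f.baseChange (Loc k) z ∈ (𝒞 n).baseChange (Loc k) := by
  rw [Submodule.baseChange_eq_span] at hz
  refine Submodule.span_induction ?_ (by simp) ?_ ?_ hz
  · rintro _ ⟨q, hq, rfl⟩
    rw [TensorProduct.mk_apply, LinearMap.baseChange_tmul]
    exact Submodule.tmul_mem_baseChange_of_mem _ (hf n q hq)
  · intro a b _ _ ha hb
    rw [map_add]
    exact add_mem ha hb
  · intro c a _ ha
    rw [map_smul]
    exact Submodule.smul_mem _ _ ha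

theorem liftBaseChange_graded {φ : M →ₗ[k] (Loc k ⊗[k] C)}
    (hφ : ∀ n, ∀ x ∈ ℳ n, φ x ∈ (𝒞 n).baseChange (Loc k)) (n : ℤ)
    (z : Loc k ⊗[k] M) (hz : z ∈ (ℳ n).baseChange (Loc k)) :
    φ.liftBaseChange (Loc k) z ∈ (𝒞 n).baseChange (Loc k) := by
  rw [Submodule.baseChange_eq_span] at hz
  refine Submodule.span_induction ?_ (by simp) ?_ ?_ hz
  · rintro _ ⟨q, hq, rfl⟩
    rw [TensorProduct.mk_apply, LinearMap.liftBaseChange_tmul, one_smul]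
    exact hφ n q hq
  · intro a b _ _ ha hb
    rw [map_add]
    exact add_mem ha hb
  · intro c a _ ha
    rw [map_smul]
    exact Submodule.smul_mem _ _ ha

theorem liftBaseChange_locAct {φ : M →ₗ[k] (Loc k ⊗[k] C)} {r : R}
    (hφ : ∀ x, φ (r • x) = locAct C r (φ x)) (z : Loc k ⊗[k] M) :
    φ.liftBaseChange (Loc k) (locAct M r z) = locAct C r (φ.liftBaseChange (Loc k) z) := by
  induction z with
  | zero => simp
  | add x y hx hy => simp only [map_add, hx, hy]
  | tmul a x =>
    rw [LinearMap.baseChange_tmul, LinearMap.liftBaseChange_tmul, LinearMap.liftBaseChange_tmul,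
      map_smul]
    congr 1
    exact hφ x

end BaseChangeMaps

/-! ### The `V`-span of a lifted map and its saturation. -/

section Span

variable {k R : Type u} [Field k] [CommRing R] [Algebra k R]
  {X Q : Type u} [AddCommGroup X] [Module k X] [Module R X] [IsScalarTower k R X]
  [AddCommGroup Q] [Module k⟦X⟧ Q] [Module (k⟦X⟧ ⊗[k] R) Q]
  [IsScalarTower k⟦X⟧ (k⟦X⟧ ⊗[k] R) Q]
  {M : Type u} [AddCommGroup M] [Module k M] [Module R M] [IsScalarTower k R M]
  {N : Type u} [AddCommGroup N] [Module k N] [Module R N]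
  {𝒳 : ℤ → Submodule k X} {𝒬 : ℤ → Submodule k⟦X⟧ Q}
  {ℳ : ℤ → Submodule k M} {𝒩 : ℤ → Submodule k N}
  {ι : Q →ₗ[k⟦X⟧] (Loc k ⊗[k] M)}

/-- Elements of the `V`-span of the image of `f` are congruent modulo the uniformizer to elements
of the image. -/
theorem familyHom_span_decomp {f : X →+ Q} (hf : f ∈ familyHom R 𝒳 𝒬) {q : Q}
    (hq : q ∈ Submodule.span k⟦X⟧ (Set.range f)) :
    ∃ x, ∃ q' ∈ Submodule.span k⟦X⟧ (Set.range f), q = f x + (PowerSeries.X : k⟦X⟧) • q' := by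
  refine Submodule.span_induction ?_ ⟨0, 0, zero_mem _, by simp⟩ ?_ ?_ hq
  · rintro _ ⟨x, rfl⟩
    exact ⟨x, 0, zero_mem _, by simp⟩
  · rintro _ _ _ _ ⟨x, a, ha, rfl⟩ ⟨y, b, hb, rfl⟩
    exact ⟨x + y, a + b, add_mem ha hb, by rw [map_add, smul_add]; abel⟩
  · rintro v _ _ ⟨x, a, ha, rfl⟩
    -- The constant term of `v` can be moved into the argument of `f`; the rest of `v` is divisible
    -- by the uniformizer.
    obtain ⟨w, hw⟩ : (PowerSeries.X : k⟦X⟧) ∣ v - PowerSeries.C (PowerSeries.constantCoeff v) := by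
      rw [PowerSeries.X_dvd_iff]
      simp
    refine ⟨PowerSeries.constantCoeff v • x, w • f x + v • a,
      add_mem (Submodule.smul_mem _ _ (Submodule.subset_span ⟨x, rfl⟩))
        (Submodule.smul_mem _ _ ha), ?_⟩
    rw [familyHom_map_smul hf, smul_add, smul_add, smul_smul, smul_smul, smul_smul,
      mul_comm v PowerSeries.X, ← add_assoc, ← add_smul, ← hw]
    congr 2
    ring

/-- Denominators are cleared: a tensor in `K ⊗ X` involves only finitely many, all powers of the
uniformizer. -/
theorem exists_span_of_liftBaseChange {f : X →+ Q} (hf : f ∈ familyHom R 𝒳 𝒬)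
    (w : Loc k ⊗[k] X) :
    ∃ (n : ℕ), ∃ q ∈ Submodule.span k⟦X⟧ (Set.range f),
      ι q = (PowerSeries.X : k⟦X⟧) ^ n • (familyHom.toGeneric ι hf).liftBaseChange (Loc k) w := by
  induction w with
  | zero => exact ⟨0, 0, zero_mem _, by simp⟩
  | add x y hx hy =>
    obtain ⟨n, a, ha, hn⟩ := hx
    obtain ⟨m, b, hb, hm⟩ := hy
    refine ⟨n + m, (PowerSeries.X : k⟦X⟧) ^ m • a + (PowerSeries.X : k⟦X⟧) ^ n • b,
      add_mem (Submodule.smul_mem _ _ ha) (Submodule.smul_mem _ _ hb), ?_⟩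
    rw [map_add, map_smul, map_smul, hn, hm, map_add, smul_add, smul_smul, smul_smul, ← pow_add,
      ← pow_add, add_comm m n]
  | tmul a x =>
    obtain ⟨n, v, hv⟩ := exists_X_pow_smul_loc a
    refine ⟨n, v • f x, Submodule.smul_mem _ _ (Submodule.subset_span ⟨x, rfl⟩), ?_⟩
    rw [map_smul, LinearMap.liftBaseChange_tmul, ← smul_assoc, hv, algebraMap_smul]
    rfl

/-- If the special fibre of `f` is injective, the `V`-span of its image is saturated. -/
theorem mem_span_of_X_pow_smul_mem {π : Q →+ N}
    (hπ : ∀ (v : k⟦X⟧) (q : Q), π (v • q) = PowerSeries.constantCoeff v • π q)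
    (hX : ∀ q q' : Q, (PowerSeries.X : k⟦X⟧) • q = (PowerSeries.X : k⟦X⟧) • q' → q = q')
    {f : X →+ Q} (hf : f ∈ familyHom R 𝒳 𝒬) (hinj : ∀ x, π (f x) = 0 → x = 0) (n : ℕ) {q : Q}
    (hq : (PowerSeries.X : k⟦X⟧) ^ n • q ∈ Submodule.span k⟦X⟧ (Set.range f)) :
    q ∈ Submodule.span k⟦X⟧ (Set.range f) := by
  induction n with
  | zero => simpa using hq
  | succ n ih =>
    obtain ⟨x, q', hq', e⟩ := familyHom_span_decomp hf hq
    -- The left side has a factor `X`, so `π` kills it and `x = 0`; then one factor `X` cancels from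
    -- `e`.
    have h1 := congrArg π e
    rw [hπ, map_add, hπ] at h1
    simp only [map_pow, PowerSeries.constantCoeff_X, zero_smul, add_zero, ne_eq,
      Nat.succ_ne_zero, not_false_eq_true, zero_pow] at h1
    rw [hinj x h1.symm, map_zero, zero_add, pow_succ', mul_smul] at e
    exact ih (hX _ _ e ▸ hq')

end Span

/-! ### Cancellation of a summand whose inclusion lifts. -/

section Cancel

variable {k R : Type u} [Field k] [CommRing R] [Algebra k R]
  {M N X C Q : Type u}
  [AddCommGroup M] [Module k M] [Module R M] [IsScalarTower k R M]
  [AddCommGroup N] [Module k N] [Module R N]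
  [AddCommGroup X] [Module k X] [Module R X] [IsScalarTower k R X]
  [AddCommGroup C] [Module k C] [Module R C] [IsScalarTower k R C]
  [AddCommGroup Q] [Module k⟦X⟧ Q] [Module (k⟦X⟧ ⊗[k] R) Q]
  [IsScalarTower k⟦X⟧ (k⟦X⟧ ⊗[k] R) Q]
  {𝒜 : ℕ → Submodule k R}
  {ℳ : ℤ → Submodule k M} {𝒩 : ℤ → Submodule k N} {𝒳 : ℤ → Submodule k X}
  {𝒞 : ℤ → Submodule k C} {𝒬 : ℤ → Submodule k⟦X⟧ Q}
  {π : Q →+ N × X} {ι : Q →ₗ[k⟦X⟧] (Loc k ⊗[k] M)}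

/-- A lift of the inclusion of the summand `X` of the special fibre can be chosen so that its
composite with a given map from the generic fibre to `K ⊗ X` is bijective. -/
theorem IsDegeneration.exists_lift_bijective [Infinite k] [Module.Finite R X]
    (h : IsDegeneration R ℳ (prodGrading 𝒩 𝒳) 𝒬 π ι) (h𝒬 : DirectSum.IsInternal 𝒬)
    (hℳ : DirectSum.IsInternal ℳ) (h𝒳 : IsGradedModule 𝒜 𝒳)
    (hfin : ∀ n, Module.Finite k (𝒳 n))
    {i : X →ₗ[R] M} {p : M →ₗ[R] X} (hi : IsHomogeneousMap 𝒳 ℳ i) (hp : IsHomogeneousMap ℳ 𝒳 p)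
    (hpi : p ∘ₗ i = LinearMap.id)
    {f₀ : X →+ Q} (hf₀ : f₀ ∈ familyHom R 𝒳 𝒬) (hf₀' : ∀ x, π (f₀ x) = (0, x)) :
    ∃ (f : X →+ Q) (hf : f ∈ familyHom R 𝒳 𝒬), (∀ x, π (f x) = (0, x)) ∧
      Function.Bijective
        (locMap p ∘ₗ (familyHom.toGeneric ι hf).liftBaseChange (Loc k)) := by
  -- `g` is the generic inclusion `i`, scaled by `X ^ n` to land in the family.
  obtain ⟨n, g, hg, hgi⟩ := h.exists_familyHom (X := X) (𝒳 := 𝒳) h𝒬 hℳ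
    ((TensorProduct.mk k (Loc k) M 1).toAddMonoidHom.comp i.toAddMonoidHom)
    (fun r x => by simp) (fun d x hx => Submodule.tmul_mem_baseChange_of_mem _ (hi d x hx))
  replace hgi : ∀ x, ι (g x) = (PowerSeries.X : k⟦X⟧) ^ n • ((1 : Loc k) ⊗ₜ[k] i x) := hgi
  let A : Module.End (Loc k) (Loc k ⊗[k] X) :=
    locMap p ∘ₗ (familyHom.toGeneric ι hf₀).liftBaseChange (Loc k)
  have hA : ∀ (r : R) z, A (locAct X r z) = locAct X r (A z) := by
    intro r z
    change locMap p _ = locAct X r (locMap p _)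
    rw [liftBaseChange_locAct, locMap_locAct]
    intro x
    change ι (f₀ (r • x)) = locAct M r (ι (f₀ x))
    rw [hf₀.1, h.generic_act]
  have hA' : ∀ d, ∀ z ∈ (𝒳 d).baseChange (Loc k), A z ∈ (𝒳 d).baseChange (Loc k) := by
    intro d z hz
    exact baseChange_graded (fun n x hx => hp n x hx) d _
      (liftBaseChange_graded (fun n x hx => h.generic_graded n _ (hf₀.2 n x hx)) d z hz)
  -- The exponent is `n + 1` because `g` is multiplied by one more `X`, which makes the correction
  -- invisible on the special fibre.
  have hc : algebraMap k⟦X⟧ (Loc k) (PowerSeries.X ^ (n + 1)) ≠ 0 := by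
    rw [map_pow]
    exact pow_ne_zero _ isUnit_algebraMap_X.ne_zero
  obtain ⟨s, hs⟩ := exists_bijective_add_smul h𝒳 hfin A hA hA' hc
  have hf : f₀ + ((PowerSeries.C s : k⟦X⟧) * PowerSeries.X) • g ∈ familyHom R 𝒳 𝒬 :=
    add_mem hf₀ (Submodule.smul_mem _ _ hg)
  refine ⟨f₀ + ((PowerSeries.C s : k⟦X⟧) * PowerSeries.X) • g, hf, fun x => ?_, ?_⟩
  · rw [AddMonoidHom.add_apply, map_add, hf₀', AddMonoidHom.smul_apply, h.special_smul]
    simp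
  · convert hs using 1
    ext z
    rw [LinearMap.comp_apply]
    induction z with
    | zero => simp
    | add x y hx hy => simp only [map_add, hx, hy, smul_add]; abel
    | tmul a x =>
      have e1 : locMap p ((1 : Loc k) ⊗ₜ[k] i x) = 1 ⊗ₜ x := by
        rw [LinearMap.baseChange_tmul]
        congr 1
        exact LinearMap.congr_fun hpi x
      have e2 : ((PowerSeries.C s : k⟦X⟧) * PowerSeries.X) • ι (g x) =
          (algebraMap k (Loc k) s * algebraMap k⟦X⟧ (Loc k) (PowerSeries.X ^ (n + 1))) •
            ((1 : Loc k) ⊗ₜ[k] i x) := by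
        rw [hgi, smul_smul, mul_assoc, ← pow_succ', ← algebraMap_smul (Loc k), map_mul]
        rfl
      have e3 : (familyHom.toGeneric ι hf).liftBaseChange (Loc k) (a ⊗ₜ x) =
          (familyHom.toGeneric ι hf₀).liftBaseChange (Loc k) (a ⊗ₜ x) +
          (a * (algebraMap k (Loc k) s * algebraMap k⟦X⟧ (Loc k) (PowerSeries.X ^ (n + 1)))) •
            ((1 : Loc k) ⊗ₜ[k] i x) := by
        have e4 : familyHom.toGeneric ι hf x = familyHom.toGeneric ι hf₀ x +
            (algebraMap k (Loc k) s * algebraMap k⟦X⟧ (Loc k) (PowerSeries.X ^ (n + 1))) •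
              ((1 : Loc k) ⊗ₜ[k] i x) := by
          change ι ((f₀ + ((PowerSeries.C s : k⟦X⟧) * PowerSeries.X) • g) x) = ι (f₀ x) + _
          rw [← e2, AddMonoidHom.add_apply, map_add, AddMonoidHom.smul_apply, map_smul]
        rw [LinearMap.liftBaseChange_tmul, LinearMap.liftBaseChange_tmul, e4, smul_add,
          mul_smul a]
      rw [e3, map_add, map_smul, e1, mul_comm a, mul_smul, TensorProduct.smul_tmul' a, smul_eq_mul,
        mul_one]
      rfl

/-- The quotient of a family along an equivariant degree-preserving `K`-linear map `ψ` from its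
generic fibre. -/
theorem IsDegeneration.quotient
    (h : IsDegeneration R ℳ (prodGrading 𝒩 𝒳) 𝒬 π ι)
    (h𝒬 : IsGradedModule (fun i => (𝒜 i).baseChange k⟦X⟧) 𝒬) [Module.Finite (k⟦X⟧ ⊗[k] R) Q]
    (h𝒩 : DirectSum.IsInternal 𝒩) (h𝒞 : DirectSum.IsInternal 𝒞)
    (ψ : (Loc k ⊗[k] M) →ₗ[Loc k] (Loc k ⊗[k] C))
    (hψ : ∀ (r : R) z, ψ (locAct M r z) = locAct C r (ψ z))
    (hψ' : ∀ n, ∀ z ∈ (ℳ n).baseChange (Loc k), ψ z ∈ (𝒞 n).baseChange (Loc k))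
    (hsurj : Function.Surjective ψ)
    (hker : ∀ q, ψ (ι q) = 0 → (π q).1 = 0)
    (hX : ∀ x, ∃ q, ψ (ι q) = 0 ∧ π q = (0, x)) :
    Degenerates 𝒜 𝒞 𝒩 := by
  let ψι : Q →ₗ[k⟦X⟧] (Loc k ⊗[k] C) := ψ.restrictScalars k⟦X⟧ ∘ₗ ι
  -- Dividing by the full kernel makes `Q ⧸ P` a lattice in `K ⊗ C`, hence torsion-free, with its
  -- grading inherited from there.
  let P : Submodule (k⟦X⟧ ⊗[k] R) Q :=
    { carrier := {q | ψι q = 0}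
      zero_mem' := map_zero _
      add_mem' := fun {a b} ha hb => by
        change ψι (a + b) = 0
        rw [map_add, ha, hb, add_zero]
      smul_mem' := by
        intro s q hq
        change ψι (s • q) = 0
        induction s with
        | zero => exact (congrArg ψι (zero_smul (k⟦X⟧ ⊗[k] R) q)).trans (map_zero ψι)
        | add x y hx hy => rw [add_smul, map_add, hx, hy, add_zero]
        | tmul v r =>
          rw [tmul_smul_eq, map_smul]
          have : ψι (((1 : k⟦X⟧) ⊗ₜ[k] r) • q) = 0 := by
            change ψ (ι _) = 0
            rw [h.generic_act, hψ]
            have hq' : ψ (ι q) = 0 := hq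
            rw [hq', map_zero]
          rw [this, smul_zero] }
  let 𝒬' : ℤ → Submodule k⟦X⟧ (Q ⧸ P) := fun n => (𝒬 n).map (P.mkQ.restrictScalars k⟦X⟧)
  let ι' : (Q ⧸ P) →ₗ[k⟦X⟧] (Loc k ⊗[k] C) :=
    ((P.restrictScalars k⟦X⟧).liftQ ψι fun q hq => hq) ∘ₗ
      (Submodule.Quotient.restrictScalarsEquiv k⟦X⟧ P).symm.toLinearMap
  have hι' : ∀ q, ι' (P.mkQ q) = ψ (ι q) := fun q => rfl
  let π' : (Q ⧸ P) →+ N := QuotientAddGroup.lift P.toAddSubgroup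
    ((AddMonoidHom.fst N X).comp π) fun q hq => hker q hq
  have hπ' : ∀ q, π' (P.mkQ q) = (π q).1 := fun q => rfl
  have hinj : Function.Injective ι' := by
    rw [injective_iff_map_eq_zero]
    intro x hx
    obtain ⟨q, rfl⟩ := P.mkQ_surjective x
    exact (Submodule.Quotient.mk_eq_zero P).2 hx
  have hgr : ∀ n, ∀ q ∈ 𝒬' n, ι' q ∈ (𝒞 n).baseChange (Loc k) := by
    rintro n _ ⟨q, hq, rfl⟩
    exact hψ' n _ (h.generic_graded n q hq)
  have hsup : iSup 𝒬' = ⊤ := by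
    rw [← Submodule.map_iSup, h𝒬.isInternal.submodule_iSup_eq_top, Submodule.map_top,
      LinearMap.range_eq_top]
    exact P.mkQ_surjective
  have h𝒬' : IsGradedModule (fun i => (𝒜 i).baseChange k⟦X⟧) 𝒬' := by
    refine ⟨isInternal_of_injective ι' hinj hsup (h𝒞.baseChange (S := Loc k)) hgr, ?_⟩
    rintro i n a _ ha ⟨q, hq, rfl⟩
    exact ⟨a • q, h𝒬.smul_mem ha hq, rfl⟩
  have hmk : ∀ (v : k⟦X⟧) (q : Q), v • P.mkQ q = P.mkQ (v • q) := fun v q => rfl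
  refine IsDegeneration.degenerates (π := π') (ι := ι') h𝒬' h𝒞 h𝒩
    ⟨?_, ?_, ?_, ?_, ?_, hinj, ?_, ?_, hgr⟩
  · intro v x
    obtain ⟨q, rfl⟩ := P.mkQ_surjective x
    rw [hmk, hπ', hπ', h.special_smul, Prod.smul_fst]
  · intro r x
    obtain ⟨q, rfl⟩ := P.mkQ_surjective x
    rw [← map_smul, hπ', hπ', h.special_act, Prod.smul_fst]
  · intro y
    obtain ⟨q, hq⟩ := h.special_surjective (y, 0)
    exact ⟨P.mkQ q, by rw [hπ', hq]⟩
  · intro x hx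
    obtain ⟨q, rfl⟩ := P.mkQ_surjective x
    rw [hπ'] at hx
    obtain ⟨q₁, h1, h2⟩ := hX (π q).2
    -- The element `q₁` of `P` has the same reduction as `q`, so `q` is divisible by the uniformizer
    -- modulo `P`.
    obtain ⟨q', hq'⟩ := h.special_ker (q - q₁) (by rw [map_sub, h2]; ext <;> simp [hx])
    refine ⟨P.mkQ q', ?_⟩
    rw [hmk, ← hq', map_sub]
    have : P.mkQ q₁ = 0 := (Submodule.Quotient.mk_eq_zero P).2 h1
    rw [this, sub_zero]
  · rintro n _ ⟨q, hq, rfl⟩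
    exact (h.special_graded n q hq).1
  · intro r x
    obtain ⟨q, rfl⟩ := P.mkQ_surjective x
    rw [← map_smul, hι', hι', h.generic_act, hψ]
  · intro z
    obtain ⟨y, rfl⟩ := hsurj z
    obtain ⟨n, q, hq⟩ := h.generic_surj y
    refine ⟨n, P.mkQ q, ?_⟩
    rw [hι', hq]
    exact (ψ.restrictScalars k⟦X⟧).map_smul _ _

/-- **Cancellation**: if `X` is a graded direct summand of `M` with cokernel `C`, `M` degenerates
to `N ⊕ X`, and the inclusion of `X` lifts to the family, then `C` degenerates to `N`. -/
theorem IsDegeneration.cancel [Infinite k] [Module.Finite R X]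
    (h : IsDegeneration R ℳ (prodGrading 𝒩 𝒳) 𝒬 π ι)
    (h𝒬 : IsGradedModule (fun i => (𝒜 i).baseChange k⟦X⟧) 𝒬) [Module.Finite (k⟦X⟧ ⊗[k] R) Q]
    (hℳ : DirectSum.IsInternal ℳ) (h𝒩 : DirectSum.IsInternal 𝒩) (h𝒳 : IsGradedModule 𝒜 𝒳)
    (h𝒞 : DirectSum.IsInternal 𝒞) (hfin : ∀ n, Module.Finite k (𝒳 n))
    {i : X →ₗ[R] M} {p : M →ₗ[R] X} {c : M →ₗ[R] C} (hi : IsHomogeneousMap 𝒳 ℳ i)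
    (hp : IsHomogeneousMap ℳ 𝒳 p) (hc : IsHomogeneousMap ℳ 𝒞 c)
    (hpi : p ∘ₗ i = LinearMap.id) (hcs : Function.Surjective c) (hic : Function.Exact i c)
    {f₀ : X →+ Q} (hf₀ : f₀ ∈ familyHom R 𝒳 𝒬) (hf₀' : ∀ x, π (f₀ x) = (0, x)) :
    Degenerates 𝒜 𝒞 𝒩 := by
  obtain ⟨f, hf, hf', hbij⟩ := h.exists_lift_bijective h𝒬.isInternal hℳ h𝒳 hfin hi hp hpi hf₀ hf₀'
  set F := (familyHom.toGeneric ι hf).liftBaseChange (Loc k) with hF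
  let E : (Loc k ⊗[k] X) ≃ₗ[Loc k] (Loc k ⊗[k] X) := LinearEquiv.ofBijective (locMap p ∘ₗ F) hbij
  have hE : ∀ z, E z = locMap p (F z) := fun z => rfl
  have hFact : ∀ (r : R) z, F (locAct X r z) = locAct M r (F z) := by
    intro r z
    refine liftBaseChange_locAct (fun x => ?_) z
    change ι (f (r • x)) = locAct M r (ι (f x))
    rw [hf.1, h.generic_act]
  have hFgr : ∀ n, ∀ z ∈ (𝒳 n).baseChange (Loc k), F z ∈ (ℳ n).baseChange (Loc k) :=
    liftBaseChange_graded (fun n x hx => h.generic_graded n _ (hf.2 n x hx))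
  have hEact : ∀ (r : R) z, E.symm (locAct X r z) = locAct X r (E.symm z) := by
    intro r z
    rw [LinearEquiv.symm_apply_eq, hE, hFact, locMap_locAct, ← hE, LinearEquiv.apply_symm_apply]
  have h𝒳K := h𝒳.isInternal.baseChange (S := Loc k)
  have hEgr : ∀ n, ∀ z ∈ (𝒳 n).baseChange (Loc k), E.symm z ∈ (𝒳 n).baseChange (Loc k) := by
    intro n z hz
    refine (mem_iff_of_injective E E.injective h𝒳K.submodule_iSup_eq_top h𝒳K (fun m w hw => ?_)
      n _).1 (by rwa [LinearEquiv.apply_symm_apply])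
    exact baseChange_graded (fun n x hx => hp n x hx) m _ (hFgr m w hw)
  have hpi' : ∀ z : Loc k ⊗[k] X, locMap p (locMap i z) = z := by
    intro z
    rw [← LinearMap.comp_apply, ← LinearMap.baseChange_comp, ← LinearMap.restrictScalars_comp, hpi]
    exact LinearMap.congr_fun LinearMap.baseChange_id z
  have hexact : Function.Exact (locMap i) (locMap c) :=
    lTensor_exact (Loc k) (f := i.restrictScalars k) (g := c.restrictScalars k) hic hcs
  -- The map in parentheses is the projector onto the kernel of `p` along the image of `F`; on the
  -- kernel of `p`, the map `c` is an isomorphism onto `K ⊗ C`.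
  let ψ : (Loc k ⊗[k] M) →ₗ[Loc k] (Loc k ⊗[k] C) :=
    locMap c ∘ₗ (LinearMap.id - F ∘ₗ E.symm.toLinearMap ∘ₗ locMap p)
  have hψ : ∀ z, ψ z = locMap c (z - F (E.symm (locMap p z))) := fun z => rfl
  have hψF : ∀ w, ψ (F w) = 0 := by
    intro w
    rw [hψ, ← hE, LinearEquiv.symm_apply_apply, sub_self, map_zero]
  refine h.quotient h𝒬 h𝒩 h𝒞 ψ ?_ ?_ ?_ ?_ ?_
  · intro r z
    rw [hψ, hψ, locMap_locAct, hEact, hFact, ← map_sub, locMap_locAct]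
  · intro n z hz
    rw [hψ]
    refine baseChange_graded (fun n x hx => hc n x hx) n _ (sub_mem hz (hFgr _ _ (hEgr _ _ ?_)))
    exact baseChange_graded (fun n x hx => hp n x hx) n _ hz
  · intro z
    obtain ⟨y, rfl⟩ := LinearMap.lTensor_surjective (Loc k) (g := c.restrictScalars k) hcs z
    refine ⟨y - locMap i (locMap p y), ?_⟩
    rw [hψ, map_sub (locMap p), hpi', sub_self, map_zero, map_zero, sub_zero, map_sub,
      hexact.apply_apply_eq_zero, sub_zero]
    rfl
  · intro q hq
    rw [hψ] at hq
    obtain ⟨y, hy⟩ := (hexact _).1 hq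
    -- The projected vector lies both in the image of `i` and in the kernel of `p`, so it vanishes
    -- and `ι q` lies in the image of `F`.
    have h1 : y = 0 := by
      rw [← hpi' y, hy, map_sub, ← hE, LinearEquiv.apply_symm_apply, sub_self]
    rw [h1, map_zero] at hy
    obtain ⟨n, q', hq', e⟩ := exists_span_of_liftBaseChange (ι := ι) hf
      (E.symm (locMap p (ι q)))
    rw [← hF, ← sub_eq_zero.1 hy.symm, ← map_smul] at e
    -- A multiple `X ^ n • q` lies in the span of the image of `f`, and by saturation so does `q`;
    -- there the first component of `π` is zero.
    have h2 := mem_span_of_X_pow_smul_mem h.special_smul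
      (fun a b hab => X_smul_injective_of_injective h.generic_injective 1 (by simpa using hab))
      hf (fun x hx => by rw [hf'] at hx; exact congrArg Prod.snd hx) n
      (h.generic_injective e ▸ hq')
    refine Submodule.span_induction (p := fun q _ => (π q).1 = 0) ?_ (by simp) ?_ ?_ h2
    · rintro _ ⟨x, rfl⟩
      rw [hf']
    · intro a b _ _ ha hb
      rw [map_add, Prod.fst_add, ha, hb, add_zero]
    · intro v a _ ha
      rw [h.special_smul, Prod.smul_fst, ha, smul_zero]
  · intro x
    refine ⟨f x, ?_, hf' x⟩
    have : ι (f x) = F (1 ⊗ₜ x) := by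
      rw [hF, LinearMap.liftBaseChange_tmul, one_smul]
      rfl
    rw [this, hψF]

end Cancel

/-! ### Noetherianity of `V ⊗ R`. -/

section FiniteType

variable {k R : Type*} [Field k] [CommRing R] [Algebra k R] [IsNoetherianRing R]
  (𝒜 : ℕ → Submodule k R) [GradedAlgebra 𝒜]

/-- A Noetherian `ℕ`-graded ring with degree zero part `k` is a finitely generated `k`-algebra. -/
theorem finiteType_of_isNoetherianRing (h₀ : ∀ a ∈ 𝒜 0, ∃ c : k, algebraMap k R c = a) :
    Algebra.FiniteType k R := by
  obtain ⟨t, ht, hspan⟩ := (Submodule.fg_span_iff_fg_span_finset_subset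
    (R := R) (⋃ n : ℕ, ⋃ _ : 0 < n, (𝒜 n : Set R))).1 (IsNoetherian.noetherian _)
  have hB : ∀ n, ∀ m ∈ 𝒜 n, m ∈ Algebra.adjoin k (t : Set R) := by
    intro n
    induction n using Nat.strong_induction_on with
    | _ n ih =>
      intro m hm
      rcases Nat.eq_zero_or_pos n with rfl | hn
      · obtain ⟨c, rfl⟩ := h₀ m hm
        exact Subalgebra.algebraMap_mem _ c
      have hmem : m ∈ Submodule.span R (t : Set R) := by
        rw [← hspan]
        exact Submodule.subset_span (Set.mem_iUnion₂.2 ⟨n, hn, hm⟩)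
      -- The generators have positive degree, so their coefficients in degree `n` have smaller
      -- degree and lie in the subalgebra by induction.
      have key : ∀ a : R, (DirectSum.decompose 𝒜 (a • m) n : R) ∈
          Algebra.adjoin k (t : Set R) := by
        refine Submodule.span_induction (p := fun y _ => ∀ a : R,
          (DirectSum.decompose 𝒜 (a • y) n : R) ∈ Algebra.adjoin k (t : Set R)) ?_ ?_ ?_ ?_ hmem
        · intro x hx a
          obtain ⟨d, hd, hxd⟩ := Set.mem_iUnion₂.1 (ht hx)
          rw [smul_eq_mul]
          by_cases hdn : d ≤ n
          · rw [DirectSum.coe_decompose_mul_of_right_mem_of_le 𝒜 hxd hdn]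
            exact mul_mem (ih _ (by omega) _ (SetLike.coe_mem _)) (Algebra.subset_adjoin hx)
          · rw [DirectSum.coe_decompose_mul_of_right_mem_of_not_le 𝒜 hxd hdn]
            exact zero_mem _
        · intro a
          simp
        · intro y z _ _ hy hz a
          rw [smul_add, DirectSum.decompose_add, DirectSum.add_apply, Submodule.coe_add]
          exact add_mem (hy a) (hz a)
        · intro b y _ hy a
          rw [smul_smul]
          exact hy _
      have := key 1
      rwa [one_smul, DirectSum.decompose_of_mem_same 𝒜 hm] at this
  refine ⟨t, ?_⟩
  rw [eq_top_iff]
  rintro r -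
  classical
  rw [← DirectSum.sum_support_decompose 𝒜 r]
  exact sum_mem fun n _ => hB n _ (SetLike.coe_mem _)

/-- The tensor product is a finitely generated algebra over the Noetherian ring `k⟦X⟧`, so Hilbert's
basis theorem applies. -/
theorem isNoetherianRing_powerSeries_tensor
    (h₀ : ∀ a ∈ 𝒜 0, ∃ c : k, algebraMap k R c = a) : IsNoetherianRing (k⟦X⟧ ⊗[k] R) := by
  have := finiteType_of_isNoetherianRing 𝒜 h₀
  exact Algebra.FiniteType.isNoetherianRing k⟦X⟧ _

omit [IsNoetherianRing R] in
omit [GradedAlgebra 𝒜] in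
theorem exists_algebraMap_of_mem_baseChange (h₀ : ∀ a ∈ 𝒜 0, ∃ c : k, algebraMap k R c = a) :
    ∀ a ∈ (𝒜 0).baseChange k⟦X⟧, ∃ v : k⟦X⟧, algebraMap k⟦X⟧ (k⟦X⟧ ⊗[k] R) v = a := by
  intro a ha
  rw [Submodule.baseChange_eq_span] at ha
  have : Submodule.span k⟦X⟧ ((𝒜 0).map (TensorProduct.mk k k⟦X⟧ R 1) : Set (k⟦X⟧ ⊗[k] R)) ≤
      LinearMap.range (Algebra.linearMap k⟦X⟧ (k⟦X⟧ ⊗[k] R)) := by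
    rw [Submodule.span_le]
    rintro _ ⟨r, hr, rfl⟩
    obtain ⟨c, rfl⟩ := h₀ r hr
    refine ⟨algebraMap k k⟦X⟧ c, ?_⟩
    rw [Algebra.linearMap_apply, ← IsScalarTower.algebraMap_apply]
    exact Algebra.TensorProduct.tmul_one_eq_one_tmul (A := k⟦X⟧) (B := R) c
  exact this ha

end FiniteType

/-! ### Lifting morphisms when dimensions do not jump; part (1). -/

section HomDimension

variable {k R : Type u} [Field k] [CommRing R] [Algebra k R]
  {X M N : Type u} [AddCommGroup X] [Module k X] [Module R X] [IsScalarTower k R X]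
  [AddCommGroup M] [Module k M] [Module R M] [IsScalarTower k R M]
  [AddCommGroup N] [Module k N] [Module R N] [IsScalarTower k R N]
  {𝒜 : ℕ → Submodule k R}
  {𝒳 : ℤ → Submodule k X} {ℳ : ℤ → Submodule k M} {𝒩 : ℤ → Submodule k N}

/-- A morphism is determined by its values on finitely many homogeneous generators, and these values
lie in finite-dimensional pieces. -/
theorem finite_gradedHom [Module.Finite R X] (h𝒳 : IsGradedModule 𝒜 𝒳)
    (hfin : ∀ n, Module.Finite k (ℳ n)) : Module.Finite k (gradedHom (R := R) 𝒳 ℳ) := by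
  obtain ⟨m, x, d, hx, hspan⟩ := h𝒳.exists_homogeneous_generators
  let ev : gradedHom (R := R) 𝒳 ℳ →ₗ[k] (∀ j, ℳ (d j)) :=
    { toFun := fun f j => ⟨(f : X →ₗ[R] M) (x j), f.2 _ _ (hx j)⟩
      map_add' := fun f g => rfl
      map_smul' := fun c f => rfl }
  refine Module.Finite.of_injective ev fun f g hfg => Subtype.ext ?_
  refine LinearMap.ext_on_range (v := x) hspan fun j => ?_
  exact congrArg Subtype.val (congrFun hfg j)

/-- Finite-dimensionality of both summands matters, since `Module.finrank` is `0` on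
infinite-dimensional spaces. -/
theorem homDim_prod [Module.Finite R X] (h𝒳 : IsGradedModule 𝒜 𝒳)
    (hℳ : ∀ n, Module.Finite k (ℳ n)) (h𝒩 : ∀ n, Module.Finite k (𝒩 n)) :
    homDim R 𝒳 (prodGrading ℳ 𝒩) = homDim R 𝒳 ℳ + homDim R 𝒳 𝒩 := by
  have := finite_gradedHom (M := M) h𝒳 hℳ
  have := finite_gradedHom (M := N) h𝒳 h𝒩
  let e : gradedHom (R := R) 𝒳 (prodGrading ℳ 𝒩) ≃ₗ[k]
      (gradedHom (R := R) 𝒳 ℳ × gradedHom (R := R) 𝒳 𝒩) :=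
    { toFun := fun f => (⟨LinearMap.fst R M N ∘ₗ f, fun n x hx => (f.2 n x hx).1⟩,
        ⟨LinearMap.snd R M N ∘ₗ f, fun n x hx => (f.2 n x hx).2⟩)
      map_add' := fun f g => rfl
      map_smul' := fun c f => rfl
      invFun := fun p => ⟨(p.1 : X →ₗ[R] M).prod (p.2 : X →ₗ[R] N),
        fun n x hx => ⟨p.1.2 n x hx, p.2.2 n x hx⟩⟩
      left_inv := fun f => rfl
      right_inv := fun p => rfl }
  rw [homDim, e.finrank_eq, Module.finrank_prod]
  rfl

variable {Q : Type u} [AddCommGroup Q] [Module k⟦X⟧ Q] [Module (k⟦X⟧ ⊗[k] R) Q]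
  [IsScalarTower k⟦X⟧ (k⟦X⟧ ⊗[k] R) Q] {𝒬 : ℤ → Submodule k⟦X⟧ Q}
  {π : Q →+ N} {ι : Q →ₗ[k⟦X⟧] (Loc k ⊗[k] M)}

omit [IsScalarTower k R X] in
theorem finite_familyHom [Module.Finite R X] (h𝒳 : IsGradedModule 𝒜 𝒳)
    (h𝒬 : ∀ n, IsNoetherian k⟦X⟧ (𝒬 n)) : Module.Finite k⟦X⟧ (familyHom R 𝒳 𝒬) := by
  obtain ⟨m, x, d, hx, hspan⟩ := h𝒳.exists_homogeneous_generators
  let ev : familyHom R 𝒳 𝒬 →ₗ[k⟦X⟧] (∀ j, 𝒬 (d j)) :=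
    { toFun := fun f j => ⟨(f : X →+ Q) (x j), f.2.2 _ _ (hx j)⟩
      map_add' := fun f g => rfl
      map_smul' := fun c f => rfl }
  refine Module.Finite.of_injective ev fun f g hfg => Subtype.ext (AddMonoidHom.ext fun y => ?_)
  have hy : y ∈ Submodule.span R (Set.range x) := hspan ▸ Submodule.mem_top
  induction hy using Submodule.span_induction with
  | mem y hy =>
    obtain ⟨j, rfl⟩ := hy
    exact congrArg Subtype.val (congrFun hfg j)
  | zero => simp
  | add y z _ _ hy hz => rw [map_add, map_add, hy, hz]
  | smul r y _ hy => rw [f.2.1, g.2.1, hy]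

/-- Members of `familyHom` that vanish on the special fibre are divisible by the uniformizer. -/
theorem IsDegeneration.exists_eq_X_smul (h : IsDegeneration R ℳ 𝒩 𝒬 π ι)
    (h𝒬 : DirectSum.IsInternal 𝒬) {f : X →+ Q} (hf : f ∈ familyHom R 𝒳 𝒬)
    (hπ : ∀ x, π (f x) = 0) : ∃ g ∈ familyHom R 𝒳 𝒬, f = (PowerSeries.X : k⟦X⟧) • g := by
  have hX : ∀ q q' : Q, (PowerSeries.X : k⟦X⟧) • q = (PowerSeries.X : k⟦X⟧) • q' → q = q' :=
    fun a b hab => X_smul_injective_of_injective h.generic_injective 1 (by simpa using hab)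
  choose g hg using fun x => h.special_ker _ (hπ x)
  refine ⟨AddMonoidHom.mk' g fun x y => hX _ _ ?_, ⟨fun r x => hX _ _ ?_, fun n x hx => ?_⟩, ?_⟩
  · rw [← hg, smul_add, ← hg, ← hg, map_add]
  · change (PowerSeries.X : k⟦X⟧) • g (r • x) = (PowerSeries.X : k⟦X⟧) • ((1 : k⟦X⟧) ⊗ₜ[k] r) • g x
    rw [← hg, hf.1, hg x, smul_comm]
  · refine (mem_iff_of_injective (LinearMap.lsmul k⟦X⟧ Q (PowerSeries.X : k⟦X⟧)) (hX · ·)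
      h𝒬.submodule_iSup_eq_top h𝒬 (fun n q hq => Submodule.smul_mem _ _ hq) n _).1 ?_
    change (PowerSeries.X : k⟦X⟧) • g x ∈ _
    rw [← hg]
    exact hf.2 n x hx
  · ext x
    exact hg x

/-- A `k`-basis of the morphisms to `M`, scaled by powers of the uniformizer to land in `Q`, stays
independent over `k⟦X⟧`. -/
theorem IsDegeneration.homDim_le_finrank [Module.Finite R X]
    (h : IsDegeneration R ℳ 𝒩 𝒬 π ι) (h𝒬 : DirectSum.IsInternal 𝒬) (hℳ : DirectSum.IsInternal ℳ)
    [Module.Finite k⟦X⟧ (familyHom R 𝒳 𝒬)] [Module.Finite k (gradedHom (R := R) 𝒳 ℳ)] :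
    homDim R 𝒳 ℳ ≤ Module.finrank k⟦X⟧ (familyHom R 𝒳 𝒬) := by
  let b := Module.finBasis k (gradedHom (R := R) 𝒳 ℳ)
  have hl : ∀ j, ∃ (n : ℕ) (g : X →+ Q), g ∈ familyHom R 𝒳 𝒬 ∧
      ∀ x, ι (g x) = (PowerSeries.X : k⟦X⟧) ^ n • ((1 : Loc k) ⊗ₜ[k] (b j : X →ₗ[R] M) x) :=
    fun j => h.exists_familyHom h𝒬 hℳ ((TensorProduct.mk k (Loc k) M 1).toAddMonoidHom.comp
      (b j : X →ₗ[R] M).toAddMonoidHom) (fun r x => by simp)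
      (fun d x hx => Submodule.tmul_mem_baseChange_of_mem _ ((b j).2 d x hx))
  choose n g hg hgi using hl
  have hli : LinearIndependent k⟦X⟧ (fun j => (⟨g j, hg j⟩ : familyHom R 𝒳 𝒬)) := by
    rw [Fintype.linearIndependent_iff]
    intro v hv
    have hsum : ∀ x, ∑ j, (algebraMap k⟦X⟧ (Loc k) (v j * PowerSeries.X ^ n j)) ⊗ₜ[k]
        (b j : X →ₗ[R] M) x = 0 := by
      intro x
      have h1 := congrArg (fun f : familyHom R 𝒳 𝒬 => ι ((f : X →+ Q) x)) hv
      simp only [Submodule.coe_sum, AddMonoidHom.finsetSum_apply, map_sum, Submodule.coe_smul,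
        AddMonoidHom.smul_apply, map_smul, hgi, smul_smul, Submodule.coe_zero,
        AddMonoidHom.zero_apply, map_zero] at h1
      rw [← h1]
      refine Finset.sum_congr rfl fun j _ => ?_
      rw [TensorProduct.smul_tmul', Algebra.smul_def, mul_one]
    have hz : ∀ j, algebraMap k⟦X⟧ (Loc k) (v j * PowerSeries.X ^ n j) = 0 := by
      intro j
      -- A `k`-linear functional on `K` turns the relation over `K` into one over `k` between the
      -- basis elements.
      rw [← Module.forall_dual_apply_eq_zero_iff k]
      intro lam
      have h2 : ∑ j, lam (algebraMap k⟦X⟧ (Loc k) (v j * PowerSeries.X ^ n j)) • b j = 0 := by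
        refine Subtype.ext (LinearMap.ext fun x => ?_)
        have h3 := congrArg ((TensorProduct.lid k M).toLinearMap ∘ₗ lam.rTensor M) (hsum x)
        simpa using h3
      exact Fintype.linearIndependent_iff.1 b.linearIndependent _ h2 j
    intro j
    have h4 := hz j
    rw [map_eq_zero_iff _ (IsLocalization.injective (Loc k)
      (powers_le_nonZeroDivisors_of_noZeroDivisors PowerSeries.X_ne_zero))] at h4
    exact (mul_eq_zero.1 h4).resolve_right (pow_ne_zero _ PowerSeries.X_ne_zero)
  simpa [homDim] using hli.fintype_card_le_finrank

/-- If the dimension of the space of morphisms from `X` does not jump up in the special fibre, then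
all morphisms from `X` to the special fibre lift to the family. -/
theorem IsDegeneration.exists_lift [Module.Finite R X]
    (h : IsDegeneration R ℳ 𝒩 𝒬 π ι) (h𝒬 : DirectSum.IsInternal 𝒬) (hℳ : DirectSum.IsInternal ℳ)
    [Module.Finite k⟦X⟧ (familyHom R 𝒳 𝒬)] [Module.Finite k (gradedHom (R := R) 𝒳 ℳ)]
    [Module.Finite k (gradedHom (R := R) 𝒳 𝒩)]
    (hdim : homDim R 𝒳 𝒩 ≤ homDim R 𝒳 ℳ) {φ : X →ₗ[R] N} (hφ : IsHomogeneousMap 𝒳 𝒩 φ) :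
    ∃ f ∈ familyHom R 𝒳 𝒬, ∀ x, π (f x) = φ x := by
  have htf : Module.IsTorsionFree k⟦X⟧ Q :=
    h.generic_injective.moduleIsTorsionFree ι (fun v q => map_smul ι v q)
  have : Module.IsTorsionFree k⟦X⟧ (X →+ Q) :=
    Function.Injective.moduleIsTorsionFree (fun (f : X →+ Q) (x : X) => f x)
      DFunLike.coe_injective (fun v q => rfl)
  -- A basis exists because `familyHom` is finite and torsion-free over a principal ideal domain.
  let b := Module.finBasis k⟦X⟧ (familyHom R 𝒳 𝒬)
  let φ' : Fin _ → gradedHom (R := R) 𝒳 𝒩 := fun j =>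
    ⟨{ toFun := fun x => π ((b j : X →+ Q) x)
       map_add' := fun x y => by rw [map_add, map_add]
       map_smul' := fun r x => by rw [(b j).2.1, h.special_act, RingHom.id_apply] },
      fun n x hx => h.special_graded n _ ((b j).2.2 n x hx)⟩
  have hφ' : ∀ j x, (φ' j : X →ₗ[R] N) x = π ((b j : X →+ Q) x) := fun j x => rfl
  have hcomb : ∀ (c : Fin _ → k) x, π (((∑ j, (PowerSeries.C (c j) : k⟦X⟧) • b j :
      familyHom R 𝒳 𝒬) : X →+ Q) x) = ((∑ j, c j • φ' j : gradedHom (R := R) 𝒳 𝒩) : X →ₗ[R] N) x := by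
    intro c x
    simp only [Submodule.coe_sum, AddMonoidHom.finsetSum_apply, map_sum, Submodule.coe_smul,
      AddMonoidHom.smul_apply, h.special_smul, LinearMap.sum_apply, LinearMap.smul_apply, hφ',
      PowerSeries.constantCoeff_C]
  have hli : LinearIndependent k φ' := by
    rw [Fintype.linearIndependent_iff]
    intro c hc j
    -- A combination that reduces to zero is `X` times another member, so its coordinates `c j` have
    -- zero constant term.
    obtain ⟨g, hg, e⟩ := h.exists_eq_X_smul h𝒬
      (∑ j, (PowerSeries.C (c j) : k⟦X⟧) • b j : familyHom R 𝒳 𝒬).2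
      (fun x => by rw [hcomb, hc]; rfl)
    have e' : ∑ j, (PowerSeries.C (c j) : k⟦X⟧) • b j =
        (PowerSeries.X : k⟦X⟧) • (⟨g, hg⟩ : familyHom R 𝒳 𝒬) := Subtype.ext e
    have e2 := congrArg (fun z => b.repr z j) e'
    simp only [Module.Basis.repr_sum_self, map_smul, Finsupp.smul_apply, smul_eq_mul] at e2
    simpa using congrArg PowerSeries.constantCoeff e2
  -- The number of reductions is the rank, at least the dimension at the generic fibre and thus at
  -- the special one; being independent, they span.
  have hspan := hli.span_eq_top_of_card_eq_finrank' (le_antisymm hli.fintype_card_le_finrank (by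
    rw [Fintype.card_fin]
    exact hdim.trans (h.homDim_le_finrank h𝒬 hℳ)))
  obtain ⟨c, hc⟩ := (Submodule.mem_span_range_iff_exists_fun k).1
    (hspan ▸ Submodule.mem_top : (⟨φ, hφ⟩ : gradedHom (R := R) 𝒳 𝒩) ∈ _)
  refine ⟨_, (∑ j, (PowerSeries.C (c j) : k⟦X⟧) • b j : familyHom R 𝒳 𝒬).2, fun x => ?_⟩
  rw [hcomb, hc]

theorem finite_piece [IsNoetherianRing R] [GradedAlgebra 𝒜]
    (h₀ : ∀ a ∈ 𝒜 0, ∃ c : k, algebraMap k R c = a) [Module.Finite R M]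
    (hℳ : IsGradedModule 𝒜 ℳ) (n : ℤ) : Module.Finite k (ℳ n) :=
  have := hℳ.isNoetherian_piece h₀ n
  inferInstance

omit [Module R M] [IsScalarTower k R M] [Module R N] [IsScalarTower k R N] in
theorem finite_prodGrading (h1 : ∀ n, Module.Finite k (ℳ n)) (h2 : ∀ n, Module.Finite k (𝒩 n))
    (n : ℤ) : Module.Finite k (prodGrading ℳ 𝒩 n) :=
  Module.Finite.iff_fg.2
    ((Module.Finite.iff_fg.1 (h1 n)).prod (Module.Finite.iff_fg.1 (h2 n)))

/-- Adding `[X, X]` to both sides of the hypothesis compares the two fibres `M ⊕ X` and `N ⊕ X`, so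
the inclusion of `X` lifts. -/
theorem Degenerates.cancel [Infinite k] [IsNoetherianRing R] [GradedAlgebra 𝒜]
    (h₀ : ∀ a ∈ 𝒜 0, ∃ c : k, algebraMap k R c = a) [Module.Finite R M] [Module.Finite R N]
    [Module.Finite R X] (hℳ : IsGradedModule 𝒜 ℳ) (h𝒩 : IsGradedModule 𝒜 𝒩)
    (h𝒳 : IsGradedModule 𝒜 𝒳) (hdim : homDim R 𝒳 ℳ = homDim R 𝒳 𝒩)
    (h : Degenerates 𝒜 (prodGrading ℳ 𝒳) (prodGrading 𝒩 𝒳)) : Degenerates 𝒜 ℳ 𝒩 := by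
  have fM := finite_piece h₀ hℳ
  have fN := finite_piece h₀ h𝒩
  have fX := finite_piece h₀ h𝒳
  obtain ⟨Q, _, _, _, _, 𝒬, π, ι, h𝒬, _, h⟩ := h.exists_isDegeneration
  have := isNoetherianRing_powerSeries_tensor 𝒜 h₀
  have fQ := h𝒬.isNoetherian_piece (exists_algebraMap_of_mem_baseChange 𝒜 h₀)
  have := finite_familyHom (R := R) h𝒳 fQ
  have := finite_gradedHom (M := M × X) h𝒳 (finite_prodGrading fM fX)
  have := finite_gradedHom (M := N × X) h𝒳 (finite_prodGrading fN fX)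
  have hMX := prodGrading_isInternal hℳ.isInternal h𝒳.isInternal
  obtain ⟨f, hf, hf'⟩ := h.exists_lift (φ := LinearMap.inr R N X) h𝒬.isInternal hMX
    (by rw [homDim_prod h𝒳 fN fX, homDim_prod h𝒳 fM fX, hdim])
    (fun n x hx => ⟨zero_mem _, hx⟩)
  exact h.cancel (i := LinearMap.inr R M X) (p := LinearMap.snd R M X) (c := LinearMap.fst R M X)
    h𝒬 hMX h𝒩.isInternal h𝒳 hℳ.isInternal fX (fun n x hx => ⟨zero_mem _, hx⟩)
    (fun n x hx => hx.2) (fun n x hx => hx.1) rfl LinearMap.fst_surjective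
    Function.Exact.inr_fst hf hf'

end HomDimension

/-! ### Local rings of finite injective dimension. -/

section InjectiveDimension

open CategoryTheory CategoryTheory.Abelian IsLocalRing RingTheory.Sequence

variable {B : Type u} [CommRing B]

theorem subsingleton_ext_of_shortExact {S : ShortComplex (ModuleCat.{u} B)} (hS : S.ShortExact)
    (Y : ModuleCat.{u} B) (n : ℕ) [h₁ : Subsingleton (Ext S.X₁ Y n)]
    [h₃ : Subsingleton (Ext S.X₃ Y n)] : Subsingleton (Ext S.X₂ Y n) := by
  refine subsingleton_of_forall_eq 0 fun e => ?_
  obtain ⟨e', rfl⟩ := Ext.contravariant_sequence_exact₂ hS Y e (Subsingleton.elim _ _)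
  rw [Subsingleton.elim e' 0, Ext.comp_zero]

theorem subsingleton_ext_left_of_shortExact {S : ShortComplex (ModuleCat.{u} B)}
    (hS : S.ShortExact) (Y : ModuleCat.{u} B) (n : ℕ) [h₂ : Subsingleton (Ext S.X₂ Y n)]
    [h₃ : Subsingleton (Ext S.X₃ Y (n + 1))] : Subsingleton (Ext S.X₁ Y n) := by
  refine subsingleton_of_forall_eq 0 fun e => ?_
  obtain ⟨e', rfl⟩ := Ext.contravariant_sequence_exact₁ hS Y e (add_comm 1 n)
    (Subsingleton.elim _ _)
  rw [Subsingleton.elim e' 0, Ext.comp_zero]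

theorem subsingleton_ext_congr {T T' : Type u} [AddCommGroup T] [Module B T] [AddCommGroup T']
    [Module B T'] (e : T ≃ₗ[B] T') (Y : ModuleCat.{u} B) (n : ℕ)
    [h : Subsingleton (Ext (ModuleCat.of B T) Y n)] :
    Subsingleton (Ext (ModuleCat.of B T') Y n) := by
  refine subsingleton_of_forall_eq 0 fun x => ?_
  have h1 : (Ext.mk₀ e.symm.toModuleIso.hom).comp ((Ext.mk₀ e.toModuleIso.hom).comp x
      (zero_add n)) (zero_add n) = x := by
    rw [← Ext.comp_assoc_of_second_deg_zero, Ext.mk₀_comp_mk₀]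
    have : e.symm.toModuleIso.hom ≫ e.toModuleIso.hom = 𝟙 (ModuleCat.of B T') := by
      ext y
      simp
    rw [this, Ext.mk₀_id_comp]
  rw [← h1, Subsingleton.elim ((Ext.mk₀ e.toModuleIso.hom).comp x (zero_add n)) 0, Ext.comp_zero]

variable [IsNoetherianRing B] [IsLocalRing B]

omit [IsNoetherianRing B] in
theorem subsingleton_of_forall_eq_smul {E : Type*} [AddCommGroup E] [Module B E]
    [Module.Finite B E] {x : B} (mem : x ∈ maximalIdeal B) (h : ∀ y : E, ∃ z, y = x • z) :
    Subsingleton E := by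
  have : (⊤ : Submodule B E) = ⊥ := by
    refine Submodule.eq_bot_of_le_smul_of_le_jacobson_bot (maximalIdeal B) _
      Module.Finite.fg_top ?_ (maximalIdeal_le_jacobson _)
    rintro y -
    obtain ⟨z, rfl⟩ := h y
    exact Submodule.smul_mem_smul mem trivial
  exact (Submodule.subsingleton_iff B).1 (subsingleton_of_bot_eq_top this.symm)

/-- In the long exact sequence of multiplication by `x` on `T`, the vanishing term makes `x` act
surjectively on `Ext(T, Y)` in degree `n`; this module is finite, so Nakayama's lemma kills it. -/
theorem subsingleton_ext_of_isSMulRegular {T Y : ModuleCat.{u} B} [Module.Finite B T]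
    [Module.Finite B Y] {x : B} (reg : IsSMulRegular T x) (mem : x ∈ maximalIdeal B) {n : ℕ}
    (h : Subsingleton (Ext (ModuleCat.of B (QuotSMulTop x T)) Y (n + 1))) :
    Subsingleton (Ext T Y n) := by
  have hS := reg.smulShortComplex_shortExact
  refine subsingleton_of_forall_eq_smul mem fun y => ?_
  obtain ⟨z, hz⟩ := Ext.contravariant_sequence_exact₁ hS Y y (add_comm 1 n)
    (h.elim _ _)
  have h1 : ∀ z : Ext T Y n, (Ext.mk₀ (x • 𝟙 T)).comp z (zero_add n) = x • z := fun z => by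
    rw [Ext.mk₀_smul, Ext.smul_comp, Ext.mk₀_id_comp]
  exact ⟨z, hz.symm.trans (h1 z)⟩

/-- A regular sequence on `T` pushes down the degrees where `Ext(T, Y)` may be nonzero. -/
theorem subsingleton_ext_of_isWeaklyRegular {Y : ModuleCat.{u} B} [Module.Finite B Y] {n : ℕ}
    (h : ∀ (W : Type u) [AddCommGroup W] [Module B W] [Module.Finite B W] (i : ℕ), n < i →
      Subsingleton (Ext (ModuleCat.of B W) Y i))
    (rs : List B) (mem : ∀ r ∈ rs, r ∈ maximalIdeal B)
    (T : Type u) [AddCommGroup T] [Module B T] [Module.Finite B T] (reg : IsWeaklyRegular T rs)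
    (i : ℕ) (hi : n < i + rs.length) : Subsingleton (Ext (ModuleCat.of B T) Y i) := by
  induction rs generalizing T i with
  | nil => exact h T i hi
  | cons x rs ih =>
    rw [isWeaklyRegular_cons_iff] at reg
    refine subsingleton_ext_of_isSMulRegular (T := ModuleCat.of B T) reg.1
      (mem x List.mem_cons_self) (ih (fun r hr => mem r (List.mem_cons_of_mem _ hr))
        (QuotSMulTop x T) reg.2 (i + 1) ?_)
    rw [List.length_cons] at hi
    omega

/-- If `Ext` into `Y` vanishes above degree `n` and `Ext^n(k, Y) = 0`, then it vanishes in degree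
`n`. -/
theorem subsingleton_ext_of_residueField {Y : ModuleCat.{u} B} [Module.Finite B Y] {n : ℕ}
    (h : ∀ (W : Type u) [AddCommGroup W] [Module B W] [Module.Finite B W],
      Subsingleton (Ext (ModuleCat.of B W) Y (n + 1)))
    (hk : Subsingleton (Ext (ModuleCat.of B (B ⧸ maximalIdeal B)) Y n))
    (W : Type u) [AddCommGroup W] [Module B W] [hW : Module.Finite B W] :
    Subsingleton (Ext (ModuleCat.of B W) Y n) := by
  -- A prime filtration reduces to quotients by primes `p`. If `p` is not maximal, an element of the
  -- maximal ideal outside `p` is regular on the quotient, and vanishing in degree `n + 1` descends.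
  induction hW using IsNoetherianRing.induction_on_isQuotientEquivQuotientPrime B with
  | subsingleton N =>
    have : Limits.IsZero (ModuleCat.of B N) := ModuleCat.isZero_of_subsingleton _
    exact subsingleton_of_forall_eq 0 fun e => by
      rw [← Ext.mk₀_id_comp e, this.eq_zero_of_src (𝟙 _), Ext.mk₀_zero, Ext.zero_comp]
  | quotient N p f =>
    have := p.2
    suffices hp : Subsingleton (Ext (ModuleCat.of B (B ⧸ p.1)) Y n) from
      subsingleton_ext_congr f.symm Y n
    by_cases hpm : p.1 = maximalIdeal B
    · rw [hpm]
      exact hk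
    · obtain ⟨x, hx, hxp⟩ := SetLike.exists_of_lt
        (lt_of_le_of_ne (le_maximalIdeal p.2.ne_top) hpm)
      refine subsingleton_ext_of_isSMulRegular (T := ModuleCat.of B (B ⧸ p.1)) (x := x) ?_ hx
        (h _)
      rw [isSMulRegular_iff_right_eq_zero_of_smul]
      intro y hy
      obtain ⟨y, rfl⟩ := Ideal.Quotient.mk_surjective y
      have hy' : Ideal.Quotient.mk p.1 (x * y) = 0 := hy
      rw [Ideal.Quotient.eq_zero_iff_mem] at hy' ⊢
      exact (p.2.mem_or_mem hy').resolve_left hxp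
  | exact N₁ N₂ N₃ f g hf hg hfg h₁ h₃ =>
    exact subsingleton_ext_of_shortExact (ModuleCat.shortComplex_shortExact
      (ModuleCat.shortComplexOfCompEqZero f g hfg.linearMap_comp_eq_zero) hfg hf hg) Y n

/-- The residue field embeds into the quotient by a regular sequence of maximal length. -/
theorem exists_residueField_injective {rs : List B} (mem : ∀ r ∈ rs, r ∈ maximalIdeal B)
    (reg : IsWeaklyRegular B rs)
    (hmax : ∀ rs' : List B, (∀ r ∈ rs', r ∈ maximalIdeal B) → IsWeaklyRegular B rs' →
      rs'.length ≤ rs.length) :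
    ∃ f : (B ⧸ maximalIdeal B) →ₗ[B] (B ⧸ Ideal.ofList rs • (⊤ : Submodule B B)),
      Function.Injective f := by
  have h1 : ¬ Subsingleton ((B ⧸ maximalIdeal B) →ₗ[B]
      (B ⧸ Ideal.ofList rs • (⊤ : Submodule B B))) := by
    rw [IsSMulRegular.subsingleton_linearMap_iff]
    -- If there were no nonzero map, some `x` in the maximal ideal would be regular on the quotient
    -- and would prolong the sequence.
    rintro ⟨x, hx, hreg⟩
    rw [Ideal.annihilator_quotient] at hx
    have := hmax (rs ++ [x]) (by simpa [or_imp, forall_and] using ⟨mem, hx⟩) (by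
      rw [isWeaklyRegular_append_iff]
      exact ⟨reg, (isWeaklyRegular_singleton_iff _ _).2 hreg⟩)
    simp at this
  rw [not_subsingleton_iff_nontrivial] at h1
  obtain ⟨f, hf⟩ := exists_ne (0 : (B ⧸ maximalIdeal B) →ₗ[B]
      (B ⧸ Ideal.ofList rs • (⊤ : Submodule B B)))
  have : IsSimpleModule B (B ⧸ maximalIdeal B) :=
    isSimpleModule_iff_isCoatom.2 (maximalIdeal.isMaximal B).out
  exact ⟨f, (LinearMap.injective_or_eq_zero f).resolve_right hf⟩

/-- The lengths are bounded by the Krull dimension, which is finite for a Noetherian local ring. -/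
theorem exists_maximal_isWeaklyRegular : ∃ rs : List B, (∀ r ∈ rs, r ∈ maximalIdeal B) ∧
    IsWeaklyRegular B rs ∧ (rs.length : WithBot ℕ∞) ≤ ringKrullDim B ∧
    ∀ rs' : List B, (∀ r ∈ rs', r ∈ maximalIdeal B) → IsWeaklyRegular B rs' →
      rs'.length ≤ rs.length := by
  have hdim : ∀ rs : List B, (∀ r ∈ rs, r ∈ maximalIdeal B) → IsWeaklyRegular B rs →
      (rs.length : WithBot ℕ∞) ≤ ringKrullDim B := by
    intro rs mem reg
    have hle : Ideal.ofList rs ≤ maximalIdeal B := Ideal.span_le.2 mem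
    have : Nontrivial (B ⧸ Ideal.ofList rs) :=
      Ideal.Quotient.nontrivial_iff.2 fun h => (maximalIdeal.isMaximal B).ne_top
        (top_le_iff.1 (h ▸ hle))
    rw [← ringKrullDim_add_length_eq_ringKrullDim_of_isRegular rs ⟨reg, ?_⟩]
    · exact le_add_of_nonneg_left ringKrullDim_nonneg_of_nontrivial
    · intro h
      refine (maximalIdeal.isMaximal B).ne_top (top_le_iff.1 (le_trans (le_of_eq h) ?_))
      rw [smul_eq_mul, Ideal.mul_top]
      exact hle
  obtain ⟨d, hd⟩ : ∃ d : ℕ, ringKrullDim B = d := by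
    have h1 := ringKrullDim_lt_top (R := B)
    have h2 := ringKrullDim_nonneg_of_nontrivial (R := B)
    generalize ringKrullDim B = e at h1 h2
    induction e with
    | bot => simp at h2
    | coe e =>
      induction e with
      | top => simp at h1
      | coe n => exact ⟨n, rfl⟩
  classical
  let P : ℕ → Prop := fun n => ∃ rs : List B, (∀ r ∈ rs, r ∈ maximalIdeal B) ∧
    IsWeaklyRegular B rs ∧ rs.length = n
  have hP : P (Nat.findGreatest P d) := Nat.findGreatest_spec (Nat.zero_le d)
    ⟨[], by simp, IsWeaklyRegular.nil B B, rfl⟩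
  obtain ⟨rs, mem, reg, hlen⟩ := hP
  refine ⟨rs, mem, reg, hdim rs mem reg, fun rs' mem' reg' => ?_⟩
  rw [hlen]
  refine Nat.le_findGreatest ?_ ⟨rs', mem', reg', rfl⟩
  have := hdim rs' mem' reg'
  rw [hd] at this
  exact_mod_cast this

/-- A Noetherian local ring of finite injective dimension has injective dimension at most its
depth; in particular, at most its dimension. -/
theorem exists_forall_subsingleton_ext {n : ℕ}
    (hn : HasInjectiveDimensionLE (ModuleCat.of B B) n) :
    ∃ a : ℕ, (a : WithBot ℕ∞) ≤ ringKrullDim B ∧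
      ∀ (W : Type u) [AddCommGroup W] [Module B W] [Module.Finite B W] (i : ℕ), a < i →
        Subsingleton (Ext (ModuleCat.of B W) (ModuleCat.of B B) i) := by
  obtain ⟨rs, mem, reg, hdim, hmax⟩ := exists_maximal_isWeaklyRegular (B := B)
  refine ⟨rs.length, hdim, ?_⟩
  obtain ⟨f, hf⟩ := exists_residueField_injective mem reg hmax
  have hpd := ModuleCat.projectiveDimension_quotient_eq_add_length_of_isWeaklyRegular
    (ModuleCat.of B B) rs reg mem
  have hpd₀ : projectiveDimension (ModuleCat.of B B) = 0 :=
    ModuleCat.projectiveDimension_eq_zero_of_projective _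
  rw [hpd₀, zero_add] at hpd
  have hpd' := ((projectiveDimension_le_iff _ _).1 hpd.le)
  -- The quotient by `rs` has projective dimension `rs.length` and contains the residue field.
  -- Beyond that degree its `Ext` vanishes, so `Ext` of the residue field in degree `m` embeds into
  -- `Ext` of the cokernel in degree `m + 1`.
  have hk : ∀ m, rs.length < m →
      (∀ (W : Type u) [AddCommGroup W] [Module B W] [Module.Finite B W],
        Subsingleton (Ext (ModuleCat.of B W) (ModuleCat.of B B) (m + 1))) →
      Subsingleton (Ext (ModuleCat.of B (B ⧸ maximalIdeal B)) (ModuleCat.of B B) m) := by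
    intro m hm h
    let S := ModuleCat.shortComplexOfCompEqZero f (LinearMap.range f).mkQ
      (LinearMap.range_mkQ_comp f)
    have hS : S.ShortExact := ModuleCat.shortComplex_shortExact S
      (LinearMap.exact_map_mkQ_range f) hf (Submodule.mkQ_surjective _)
    have : Subsingleton (Ext S.X₂ (ModuleCat.of B B) m) :=
      HasProjectiveDimensionLT.subsingleton _ (rs.length + 1) m hm _
    have : Subsingleton (Ext S.X₃ (ModuleCat.of B B) (m + 1)) := h _
    exact subsingleton_ext_left_of_shortExact hS _ m
  -- Descending induction on `i`, started by finite injective dimension at degrees from `n + 1` on;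
  -- `j` bounds the distance still to go.
  have key : ∀ j : ℕ, ∀ (W : Type u) [AddCommGroup W] [Module B W] [Module.Finite B W] (i : ℕ),
      rs.length < i → n + 1 ≤ i + j → Subsingleton (Ext (ModuleCat.of B W) (ModuleCat.of B B) i) := by
    intro j
    induction j with
    | zero =>
      intro W _ _ _ i _ hi
      exact HasInjectiveDimensionLT.subsingleton _ (n + 1) i hi _
    | succ j ih =>
      intro W _ _ _ i hi hij
      exact subsingleton_ext_of_residueField (fun W _ _ _ => ih W (i + 1) (by omega) (by omega))
        (hk i hi fun W _ _ _ => ih W (i + 1) (by omega) (by omega)) W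
  exact fun W _ _ _ i hi => key (n + 1) W i hi (by omega)

end InjectiveDimension

/-! ### Deforming functionals along a regular element. -/

section LiftFunctionals

theorem exists_smul_eq_zero_of_subsingleton {S C : Type*} [CommRing S] [AddCommGroup C]
    [Module S C] [Module.Finite S C] (q : Ideal S) [q.IsPrime]
    (h : Subsingleton (LocalizedModule q.primeCompl C)) : ∃ w ∉ q, ∀ c : C, w • c = 0 := by
  obtain ⟨s, hs⟩ := Module.Finite.exists_smul_of_comp_eq_of_isLocalizedModule q.primeCompl
    (LocalizedModule.mkLinearMap q.primeCompl C) LinearMap.id 0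
    (LinearMap.ext fun _ => Subsingleton.elim _ _)
  exact ⟨s, s.2, fun c => by simpa [Submonoid.smul_def] using LinearMap.congr_fun hs c⟩

/-- A local form of Nakayama's lemma. -/
theorem exists_smul_eq_zero_of_forall_exists {S C : Type*} [CommRing S] [AddCommGroup C]
    [Module S C] [Module.Finite S C] (q : Ideal S) [q.IsPrime] {x : S} (hx : x ∈ q)
    (h : ∀ c : C, ∃ u ∉ q, ∃ c', u • c = x • c') : ∃ w ∉ q, ∀ c : C, w • c = 0 := by
  refine exists_smul_eq_zero_of_subsingleton q ?_
  refine subsingleton_of_forall_eq_smul (B := Localization.AtPrime q)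
    (x := algebraMap S (Localization.AtPrime q) x)
    ((IsLocalization.AtPrime.to_map_mem_maximal_iff _ q x).2 hx) fun y => ?_
  obtain ⟨⟨c, s⟩, rfl⟩ := IsLocalizedModule.mk'_surjective q.primeCompl
    (LocalizedModule.mkLinearMap q.primeCompl C) y
  obtain ⟨u, hu, c', hc⟩ := h c
  refine ⟨IsLocalizedModule.mk' (LocalizedModule.mkLinearMap q.primeCompl C) c'
    (⟨u, hu⟩ * s), ?_⟩
  rw [algebraMap_smul, ← IsLocalizedModule.mk'_smul, ← hc]
  exact (IsLocalizedModule.mk'_cancel_left (LocalizedModule.mkLinearMap q.primeCompl C) c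
    (⟨u, hu⟩ : q.primeCompl) s).symm

variable {S R : Type*} [CommRing S] [CommRing R] [Algebra S R]

/-- Deformation of functionals: let `x` be regular on `S` and on `Q`, with `R = S/xS` and
`N = Q/xQ`. If, locally at `p`, functionals on syzygies of `N` extend, then functionals on `N`
lift to `Q` locally at `p`. -/
theorem exists_functional_lift [IsNoetherianRing S] (hsurj : Function.Surjective (algebraMap S R))
    {x : S} (hx₀ : algebraMap S R x = 0) (hx : ∀ s, algebraMap S R s = 0 → ∃ s', s = x * s')
    (hxS : ∀ s, x * s = 0 → s = 0)
    {Q N : Type*} [AddCommGroup Q] [Module S Q] [Module.Finite S Q] [AddCommGroup N] [Module R N]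
    [Module S N] [IsScalarTower S R N] (hxQ : ∀ q : Q, x • q = 0 → q = 0)
    {π : Q →ₗ[S] N} (hπ : Function.Surjective π) (hker : ∀ q, π q = 0 → ∃ q', q = x • q')
    (p : Ideal R) [p.IsPrime]
    (hext : ∀ (m : ℕ) (g : (Fin m → R) →ₗ[R] N), Function.Surjective g →
      ∀ φ : LinearMap.ker g →ₗ[R] R, ∃ u ∉ p, ∃ ψ : (Fin m → R) →ₗ[R] R,
        ∀ z : LinearMap.ker g, ψ z = u * φ z)
    (f : N →ₗ[R] R) :
    ∃ (h : Q →ₗ[S] S) (w : S), algebraMap S R w ∉ p ∧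
      ∀ q, algebraMap S R (h q) = algebraMap S R w * f (π q) := by
  obtain ⟨m, G, hG⟩ := Module.Finite.exists_fin' S Q
  let red : (Fin m → S) →ₗ[S] (Fin m → R) := (Algebra.linearMap S R).compLeft (Fin m)
  have hred : ∀ z j, red z j = algebraMap S R (z j) := fun z j => rfl
  have hred_surj : Function.Surjective red := fun y => by
    choose z hz using fun j => hsurj (y j)
    exact ⟨z, funext hz⟩
  have hred_ker : ∀ z, red z = 0 → ∃ z', z = x • z' := fun z hz => by
    choose z' hz' using fun j => hx (z j) (congrFun hz j)
    exact ⟨z', funext hz'⟩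
  let g : (Fin m → R) →ₗ[R] N := Fintype.linearCombination R fun j => π (G (Pi.single j 1))
  have hg : ∀ z, g (red z) = π (G z) := by
    intro z
    rw [Fintype.linearCombination_apply, LinearMap.pi_apply_eq_sum_univ G z, map_sum]
    refine Finset.sum_congr rfl fun j _ => ?_
    rw [hred, algebraMap_smul, map_smul]
    congr 3
    ext i
    simp [Pi.single_apply, eq_comm]
  have hg_surj : Function.Surjective g := fun y => by
    obtain ⟨q, rfl⟩ := hπ y
    obtain ⟨z, rfl⟩ := hG q
    exact ⟨red z, hg z⟩
  have lift : ∀ ψ : (Fin m → R) →ₗ[R] R, ∃ ψ' : (Fin m → S) →ₗ[S] S,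
      ∀ z, algebraMap S R (ψ' z) = ψ (red z) := by
    intro ψ
    choose s hs using fun j => hsurj (ψ (Pi.single j 1))
    refine ⟨Fintype.linearCombination S s, fun z => ?_⟩
    rw [Fintype.linearCombination_apply, map_sum, LinearMap.pi_apply_eq_sum_univ ψ]
    refine Finset.sum_congr rfl fun j _ => ?_
    rw [smul_eq_mul, smul_eq_mul, map_mul, hs, hred]
    congr 2
    ext i
    simp [Pi.single_apply, eq_comm]
  have div : ∀ δ : LinearMap.ker G →ₗ[S] S, (∀ z, algebraMap S R (δ z) = 0) →
      ∃ δ' : LinearMap.ker G →ₗ[S] S, δ = x • δ' := by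
    intro δ hδ
    choose d hd using fun z => hx _ (hδ z)
    have hc : ∀ a b : S, x * a = x * b → a = b := fun a b hab =>
      sub_eq_zero.1 (hxS _ (by rw [mul_sub, hab, sub_self]))
    refine ⟨{ toFun := d
              map_add' := fun a b => hc _ _ ?_
              map_smul' := fun a b => hc _ _ ?_ }, LinearMap.ext hd⟩
    · rw [mul_add, ← hd, ← hd, ← hd, map_add]
    · rw [RingHom.id_apply, smul_eq_mul, mul_left_comm, ← hd, ← hd, map_smul, smul_eq_mul]
  -- Up to a factor outside `p`, every functional on the syzygies extends modulo `x`: reduce it to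
  -- `ker g`, extend there by `hext`, lift the extension, and divide the error by `x`.
  have key : ∀ φ : LinearMap.ker G →ₗ[S] S, ∃ u : S, algebraMap S R u ∉ p ∧
      ∃ (ψ : (Fin m → S) →ₗ[S] S) (φ' : LinearMap.ker G →ₗ[S] S),
        u • φ = ψ ∘ₗ (LinearMap.ker G).subtype + x • φ' := by
    intro φ
    have h1 : ∀ y : LinearMap.ker g, ∃ z : LinearMap.ker G, red z = y := by
      rintro ⟨y, hy⟩
      obtain ⟨z, rfl⟩ := hred_surj y
      rw [LinearMap.mem_ker, hg] at hy
      obtain ⟨q, hq⟩ := hker _ hy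
      obtain ⟨z', rfl⟩ := hG q
      refine ⟨⟨z - x • z', by rw [LinearMap.mem_ker, map_sub, map_smul, hq, sub_self]⟩, ?_⟩
      ext j
      simp [hred, hx₀]
    -- Regularity of `x` on `Q` keeps the difference quotient `y` inside `ker G`; hence `φ` descends
    -- to `ker g`.
    have h2 : ∀ z z' : LinearMap.ker G, red z = red z' →
        algebraMap S R (φ z) = algebraMap S R (φ z') := by
      intro z z' hzz'
      obtain ⟨y, hy⟩ := hred_ker ((z : Fin m → S) - z') (by rw [map_sub, hzz', sub_self])
      have hy' : G y = 0 := hxQ _ (by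
        rw [← map_smul, ← hy, map_sub, z.2, z'.2, sub_self])
      have h3 : z - z' = x • (⟨y, hy'⟩ : LinearMap.ker G) := Subtype.ext hy
      rw [← sub_eq_zero, ← map_sub, ← map_sub, h3, map_smul, smul_eq_mul, map_mul, hx₀, zero_mul]
    choose ρ hρ using h1
    let φ₀ : LinearMap.ker g →ₗ[R] R :=
      { toFun := fun y => algebraMap S R (φ (ρ y))
        map_add' := fun y y' => by
          rw [← map_add, ← map_add]
          refine h2 _ _ ?_
          rw [hρ, Submodule.coe_add, Submodule.coe_add, map_add, hρ, hρ]
        map_smul' := fun a y => by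
          obtain ⟨s, rfl⟩ := hsurj a
          rw [RingHom.id_apply, smul_eq_mul, ← map_mul, ← smul_eq_mul s, ← map_smul]
          refine h2 _ _ ?_
          rw [hρ, Submodule.coe_smul, Submodule.coe_smul, map_smul, hρ, algebraMap_smul] }
    have hφ₀ : ∀ (z : LinearMap.ker G) (hz : red z ∈ LinearMap.ker g),
        φ₀ ⟨red z, hz⟩ = algebraMap S R (φ z) := fun z hz => h2 _ _ (hρ _)
    obtain ⟨u, hu, ψ, hψ⟩ := hext m g hg_surj φ₀
    obtain ⟨u, rfl⟩ := hsurj u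
    obtain ⟨ψ', hψ'⟩ := lift ψ
    obtain ⟨φ', hφ'⟩ := div (u • φ - ψ' ∘ₗ (LinearMap.ker G).subtype) (fun z => by
      have hz : red z ∈ LinearMap.ker g := by rw [LinearMap.mem_ker, hg, z.2, map_zero]
      rw [LinearMap.sub_apply, map_sub, LinearMap.smul_apply, LinearMap.comp_apply, hψ',
        smul_eq_mul, map_mul, ← hφ₀ z hz, Submodule.subtype_apply]
      exact sub_eq_zero.2 (hψ ⟨red z, hz⟩).symm)
    exact ⟨u, hu, ψ', φ', by rw [← hφ', add_sub_cancel]⟩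
  let res : ((Fin m → S) →ₗ[S] S) →ₗ[S] (LinearMap.ker G →ₗ[S] S) :=
    LinearMap.lcomp S S (LinearMap.ker G).subtype
  -- The cokernel of `res` is `Ext¹(Q, S)`. By `key` it equals `x` times itself locally, so some `w`
  -- outside the preimage of `p` annihilates it.
  obtain ⟨w, hw, hw'⟩ := exists_smul_eq_zero_of_forall_exists
    (C := (LinearMap.ker G →ₗ[S] S) ⧸ LinearMap.range res) (p.comap (algebraMap S R)) (x := x)
    (by rw [Ideal.mem_comap, hx₀]; exact zero_mem _) (fun c => by
      obtain ⟨φ, rfl⟩ := Submodule.mkQ_surjective _ c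
      obtain ⟨u, hu, ψ, φ', e⟩ := key φ
      refine ⟨u, hu, (LinearMap.range res).mkQ φ', ?_⟩
      rw [← map_smul, ← map_smul, e, map_add, add_eq_right]
      exact (Submodule.Quotient.mk_eq_zero _).2 ⟨ψ, rfl⟩)
  obtain ⟨ψ, hψ⟩ := lift (f ∘ₗ g)
  obtain ⟨φ', hφ'⟩ := div (ψ ∘ₗ (LinearMap.ker G).subtype) (fun z => by
    rw [LinearMap.comp_apply, hψ, LinearMap.comp_apply, hg, Submodule.subtype_apply, z.2,
      map_zero, map_zero])
  obtain ⟨ψ', hψ'⟩ := (Submodule.Quotient.mk_eq_zero _).1 (hw' ((LinearMap.range res).mkQ φ'))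
  -- On `ker G` the lift `ψ` of `f ∘ g` is `x • φ'`, and `ψ'` extends `w • φ'`. So `H` vanishes
  -- there and descends to `Q`, while modulo `x` it is still `w` times `f`.
  let H : (Fin m → S) →ₗ[S] S := w • ψ - x • ψ'
  have hH : LinearMap.ker G ≤ LinearMap.ker H := by
    intro z hz
    have h1 := LinearMap.congr_fun hφ' ⟨z, hz⟩
    have h2 := LinearMap.congr_fun hψ' ⟨z, hz⟩
    change ψ z = x * φ' ⟨z, hz⟩ at h1
    change ψ' z = w * φ' ⟨z, hz⟩ at h2
    change w * ψ z - x * ψ' z = 0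
    rw [h1, h2]
    ring
  refine ⟨(LinearMap.ker G).liftQ H hH ∘ₗ (G.quotKerEquivOfSurjective hG).symm.toLinearMap, w, hw,
    fun q => ?_⟩
  obtain ⟨z, rfl⟩ := hG q
  have h3 : (G.quotKerEquivOfSurjective hG).symm (G z) = (LinearMap.ker G).mkQ z := by
    rw [LinearEquiv.symm_apply_eq]
    rfl
  rw [LinearMap.comp_apply, LinearEquiv.coe_coe, h3, Submodule.mkQ_apply, Submodule.liftQ_apply]
  change algebraMap S R (w * ψ z - x * ψ' z) = _
  rw [map_sub, map_mul, map_mul, hx₀, zero_mul, sub_zero, hψ, LinearMap.comp_apply, hg]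

end LiftFunctionals

/-! ### Vanishing of `Ext¹` at a prime and extension of functionals. -/

section ExtendFunctionals

open CategoryTheory CategoryTheory.Abelian IsLocalRing RingTheory.Sequence

theorem exists_extension_of_subsingleton_ext {B : Type u} [CommRing B]
    {S : ShortComplex (ModuleCat.{u} B)} (hS : S.ShortExact) (Y : ModuleCat.{u} B)
    (h : Subsingleton (Ext S.X₃ Y 1)) (φ : S.X₁ ⟶ Y) : ∃ ψ : S.X₂ ⟶ Y, S.f ≫ ψ = φ := by
  obtain ⟨e, he⟩ := Ext.contravariant_sequence_exact₁ hS Y (Ext.mk₀ φ) (add_zero 1)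
    (h.elim _ _)
  obtain ⟨ψ, rfl⟩ := (Ext.mk₀_bijective S.X₂ Y).2 e
  refine ⟨ψ, (Ext.mk₀_bijective S.X₁ Y).1 ?_⟩
  rw [← he, Ext.mk₀_comp_mk₀]

variable {R : Type u} [CommRing R] [IsNoetherianRing R]

/-- If `Ext¹(N_p, R_p) = 0`, functionals on syzygies of `N` extend locally at `p`. -/
theorem exists_extension_of_localized (p : Ideal R) [p.IsPrime] {N : Type u} [AddCommGroup N]
    [Module R N]
    (h : Subsingleton (Ext (ModuleCat.of (Localization.AtPrime p)
      (LocalizedModule p.primeCompl N))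
      (ModuleCat.of (Localization.AtPrime p) (Localization.AtPrime p)) 1))
    {P : Type u} [AddCommGroup P] [Module R P] [Module.Finite R P] {g : P →ₗ[R] N}
    (hg : Function.Surjective g) (φ : LinearMap.ker g →ₗ[R] R) [Module.Projective R P] :
    ∃ u ∉ p, ∃ ψ : P →ₗ[R] R, ∀ z : LinearMap.ker g, ψ z = u * φ z := by
  let B := Localization.AtPrime p
  let j := LocalizedModule.map p.primeCompl (LinearMap.ker g).subtype
  let g' := LocalizedModule.map p.primeCompl g
  have hex : Function.Exact j g' := LocalizedModule.map_exact p.primeCompl _ _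
    (LinearMap.exact_subtype_ker_map g)
  let C := ModuleCat.shortComplexOfCompEqZero j g' hex.linearMap_comp_eq_zero
  have hC : C.ShortExact := ModuleCat.shortComplex_shortExact C hex
    (LocalizedModule.map_injective _ _ (Submodule.injective_subtype _))
    (LocalizedModule.map_surjective _ _ hg)
  let φ' : LocalizedModule p.primeCompl (LinearMap.ker g) →ₗ[B] B :=
    (IsLocalizedModule.map p.primeCompl (LocalizedModule.mkLinearMap p.primeCompl _)
      (Algebra.linearMap R B) φ).extendScalarsOfIsLocalization p.primeCompl B
  have hφ' : ∀ z, φ' (LocalizedModule.mkLinearMap p.primeCompl _ z) = algebraMap R B (φ z) :=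
    fun z => IsLocalizedModule.map_apply _ _ _ _ _
  obtain ⟨ψ', hψ'⟩ := exists_extension_of_subsingleton_ext hC (ModuleCat.of B B) h
    (ModuleCat.ofHom φ')
  have h1 : ∀ z : LinearMap.ker g, ψ'.hom (LocalizedModule.mkLinearMap p.primeCompl P z) =
      algebraMap R B (φ z) := by
    intro z
    rw [← hφ']
    have := congrArg (fun a => a.hom (LocalizedModule.mkLinearMap p.primeCompl _ z)) hψ'
    simp only [ModuleCat.hom_comp, ModuleCat.hom_ofHom, LinearMap.comp_apply] at this
    rw [← this]
    congr 1
    exact (IsLocalizedModule.map_apply p.primeCompl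
      (LocalizedModule.mkLinearMap p.primeCompl (LinearMap.ker g))
      (LocalizedModule.mkLinearMap p.primeCompl P) (LinearMap.ker g).subtype z).symm
  have := Module.finitePresentation_of_finite R P
  -- Finite presentation of `P` clears the denominator `s` of the local extension; finiteness of the
  -- kernel then gives one `t` after which the identity holds before localization.
  obtain ⟨ψ, s, hs⟩ := Module.FinitePresentation.exists_lift_of_isLocalizedModule p.primeCompl
    (Algebra.linearMap R B)
    ((ψ'.hom.restrictScalars R) ∘ₗ LocalizedModule.mkLinearMap p.primeCompl P)
  obtain ⟨t, ht⟩ := Module.Finite.exists_smul_of_comp_eq_of_isLocalizedModule p.primeCompl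
    (Algebra.linearMap R B) (ψ ∘ₗ (LinearMap.ker g).subtype) ((s : R) • φ) (by
      ext z
      have h2 := LinearMap.congr_fun hs (z : P)
      rw [LinearMap.comp_apply] at h2
      rw [LinearMap.comp_apply, LinearMap.comp_apply, Submodule.subtype_apply, h2]
      change (s : R) • ψ'.hom _ = algebraMap R B ((s : R) * φ z)
      rw [h1, map_mul, Algebra.smul_def])
  refine ⟨t * s, (t * s).2, (t : R) • ψ, fun z => ?_⟩
  have h3 := LinearMap.congr_fun ht z
  change (t : R) * ψ z = (t : R) * ((s : R) * φ z) at h3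
  rw [mul_assoc, ← h3]
  rfl

/-- Localization keeps `F` projective, so in the long exact sequence of `N → N × F → F` both outer
terms vanish. -/
theorem subsingleton_ext_prod_projective {N F : Type u} [AddCommGroup N] [Module R N]
    [AddCommGroup F] [Module R F] [Module.Projective R F] (p : Ideal R) [p.IsPrime]
    (Y : ModuleCat.{u} (Localization.AtPrime p))
    (h : Subsingleton (Ext (ModuleCat.of (Localization.AtPrime p)
      (LocalizedModule p.primeCompl N)) Y 1)) :
    Subsingleton (Ext (ModuleCat.of (Localization.AtPrime p)
      (LocalizedModule p.primeCompl (N × F))) Y 1) := by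
  let j := LocalizedModule.map p.primeCompl (LinearMap.inl R N F)
  let g := LocalizedModule.map p.primeCompl (LinearMap.snd R N F)
  have hex : Function.Exact j g := LocalizedModule.map_exact p.primeCompl _ _
    Function.Exact.inl_snd
  let C := ModuleCat.shortComplexOfCompEqZero j g hex.linearMap_comp_eq_zero
  have hC : C.ShortExact := ModuleCat.shortComplex_shortExact C hex
    (LocalizedModule.map_injective _ _ LinearMap.inl_injective)
    (LocalizedModule.map_surjective _ _ LinearMap.snd_surjective)
  have h3 : Subsingleton (Ext C.X₃ Y 1) :=
    Ext.subsingleton_of_projective (ModuleCat.of _ (LocalizedModule p.primeCompl F)) Y 0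
  have h1 : Subsingleton (Ext C.X₁ Y 1) := h
  exact subsingleton_ext_of_shortExact hC Y 1

/-- Over a ring that is Gorenstein at the maximal ideal `p`, a module `N` of depth `dim R` at `p`
satisfies `Ext¹(N_p, R_p) = 0`. -/
theorem subsingleton_ext_localized_of_depth (p : Ideal R) [p.IsPrime] {n : ℕ}
    (hn : HasInjectiveDimensionLE
      (ModuleCat.of (Localization.AtPrime p) (Localization.AtPrime p)) n)
    {N : Type u} [AddCommGroup N] [Module R N] [Module.Finite R N]
    (hN : ∀ i : ℕ, (i : WithBot ℕ∞) < ringKrullDim R →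
      Subsingleton (Ext (ModuleCat.of R (R ⧸ p)) (ModuleCat.of R N) i)) :
    Subsingleton (Ext (ModuleCat.of (Localization.AtPrime p)
      (LocalizedModule p.primeCompl N))
      (ModuleCat.of (Localization.AtPrime p) (Localization.AtPrime p)) 1) := by
  obtain ⟨a, ha, hext⟩ := exists_forall_subsingleton_ext hn
  have ha' : (a : WithBot ℕ∞) ≤ ringKrullDim R := by
    refine ha.trans ?_
    rw [IsLocalization.AtPrime.ringKrullDim_eq_height p]
    exact Ideal.height_le_ringKrullDim_of_ne_top Ideal.IsPrime.ne_top'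
  -- The depth criterion needs `p N ≠ N`; otherwise the localization of `N` is zero by Nakayama's
  -- lemma.
  by_cases htop : p • (⊤ : Submodule R N) = ⊤
  · obtain ⟨r, hr, hr'⟩ := Submodule.exists_sub_one_mem_and_smul_eq_zero_of_fg_of_le_smul p ⊤
      (Module.Finite.fg_top (R := R) (M := N)) htop.ge
    have hrp : r ∉ p := fun hrp => (inferInstance : p.IsPrime).ne_top
      ((Ideal.eq_top_iff_one p).2 (by simpa using sub_mem hrp hr))
    have : Subsingleton (LocalizedModule p.primeCompl N) :=
      LocalizedModule.subsingleton_iff.2 fun m => ⟨r, hrp, hr' m trivial⟩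
    have : Limits.IsZero (ModuleCat.of (Localization.AtPrime p)
      (LocalizedModule p.primeCompl N)) := ModuleCat.isZero_of_subsingleton _
    exact subsingleton_of_forall_eq 0 fun e => by
      rw [← Ext.mk₀_id_comp e, this.eq_zero_of_src (𝟙 _), Ext.mk₀_zero, Ext.zero_comp]
  -- A regular sequence of length `a` on `N` inside `p` lowers the vanishing range from degrees
  -- above `a` to degrees above `0`.
  · obtain ⟨rs, hlen, hmem, hreg⟩ := ModuleCat.exists_isRegular_of_exists_subsingleton_ext p a
      (ModuleCat.of R N) (Ne.lt_top htop) (ModuleCat.of R (R ⧸ p))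
      (by rw [Module.support_eq_zeroLocus, Ideal.annihilator_quotient])
      (fun i hi => hN i (lt_of_lt_of_le (by exact_mod_cast hi) ha'))
    refine subsingleton_ext_of_isWeaklyRegular hext
      (rs.map (algebraMap R (Localization.AtPrime p))) ?_ _
      (IsWeaklyRegular.of_isLocalizedModule (Localization.AtPrime p) p.primeCompl
        (LocalizedModule.mkLinearMap p.primeCompl N) hreg.1) 1 ?_
    · simp only [List.mem_map, forall_exists_index, and_imp, forall_apply_eq_imp_iff₂]
      exact fun r hr => (IsLocalization.AtPrime.to_map_mem_maximal_iff _ p r).2 (hmem r hr)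
    · rw [List.length_map, hlen]
      omega

end ExtendFunctionals

/-! ### Reduction modulo the uniformizer. -/

section Augmentation

variable {k R : Type u} [Field k] [CommRing R] [Algebra k R]

variable (k R) in
/-- The augmentation `k⟦X⟧ ⊗ R → R` that sends `X` to `0`. -/
noncomputable def augmentation : (k⟦X⟧ ⊗[k] R) →ₐ[k] R :=
  Algebra.TensorProduct.lift
    ((Algebra.ofId k R).comp (AlgHom.mk' (PowerSeries.constantCoeff (R := k)) fun c v => by simp))
    (AlgHom.id k R) fun _ _ => Commute.all _ _

theorem augmentation_tmul (v : k⟦X⟧) (r : R) :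
    augmentation k R (v ⊗ₜ r) = PowerSeries.constantCoeff v • r := by
  rw [augmentation, Algebra.TensorProduct.lift_tmul, Algebra.smul_def]
  rfl

theorem augmentation_surjective : Function.Surjective (augmentation k R) := fun r =>
  ⟨1 ⊗ₜ r, by rw [augmentation_tmul, map_one, one_smul]⟩

variable {F : Type u} [AddCommGroup F] [Module k F]

variable (k F) in
/-- Reduction modulo `X` from `k⟦X⟧ ⊗ F` to `F`. -/
noncomputable def reduction : (k⟦X⟧ ⊗[k] F) →ₗ[k] F :=
  TensorProduct.lid k F ∘ₗ (PowerSeries.coeff (R := k) 0).rTensor F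

theorem reduction_tmul (v : k⟦X⟧) (y : F) :
    reduction k F (v ⊗ₜ y) = PowerSeries.constantCoeff v • y := by
  simp [reduction]

theorem reduction_smul (v : k⟦X⟧) (z : k⟦X⟧ ⊗[k] F) :
    reduction k F (v • z) = PowerSeries.constantCoeff v • reduction k F z := by
  induction z with
  | zero => simp
  | add x y hx hy => simp only [smul_add, map_add, hx, hy]
  | tmul w y =>
    rw [TensorProduct.smul_tmul', smul_eq_mul, reduction_tmul, reduction_tmul, map_mul, mul_smul]

/-- Every tensor is `1 ⊗ₜ` its reduction plus a multiple of the uniformizer, as one sees on pure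
tensors from the constant term. -/
theorem exists_eq_X_smul_of_reduction_eq_zero {z : k⟦X⟧ ⊗[k] F} (hz : reduction k F z = 0) :
    ∃ z', z = (PowerSeries.X : k⟦X⟧) • z' := by
  have key : ∀ z : k⟦X⟧ ⊗[k] F, ∃ z', z = 1 ⊗ₜ reduction k F z + (PowerSeries.X : k⟦X⟧) • z' := by
    intro z
    induction z with
    | zero => exact ⟨0, by simp⟩
    | add x y hx hy =>
      obtain ⟨a, ha⟩ := hx
      obtain ⟨b, hb⟩ := hy
      refine ⟨a + b, ?_⟩
      rw [map_add, TensorProduct.tmul_add, smul_add]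
      nth_rw 1 [ha, hb]
      abel
    | tmul v y =>
      obtain ⟨w, hw⟩ : (PowerSeries.X : k⟦X⟧) ∣
          v - PowerSeries.C (PowerSeries.constantCoeff v) := by
        rw [PowerSeries.X_dvd_iff]
        simp
      refine ⟨w ⊗ₜ y, ?_⟩
      rw [reduction_tmul, TensorProduct.tmul_smul, TensorProduct.smul_tmul',
        TensorProduct.smul_tmul', smul_eq_mul, ← hw, ← TensorProduct.add_tmul,
        PowerSeries.smul_eq_C_mul, mul_one, add_sub_cancel]
  obtain ⟨z', e⟩ := key z
  exact ⟨z', by rw [e, hz, TensorProduct.tmul_zero, zero_add]⟩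

theorem X_smul_eq_zero {T : Type*} [AddCommGroup T] [Module k⟦X⟧ T] [Module.Flat k⟦X⟧ T] {z : T}
    (hz : (PowerSeries.X : k⟦X⟧) • z = 0) : z = 0 := by
  have hreg : IsSMulRegular T (PowerSeries.X : k⟦X⟧) :=
    Module.Flat.isSMulRegular_of_nonZeroDivisors
      (mem_nonZeroDivisors_of_ne_zero PowerSeries.X_ne_zero)
  exact hreg (by simpa using hz)

theorem augmentation_eq_reduction (s : k⟦X⟧ ⊗[k] R) : augmentation k R s = reduction k R s := by
  induction s with
  | zero => simp
  | add x y hx hy => simp only [map_add, hx, hy]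
  | tmul v r => rw [augmentation_tmul, reduction_tmul]

end Augmentation

/-! ### Functionals on a family. -/

section LiftFunctional

variable {k R : Type u} [Field k] [CommRing R] [Algebra k R]
  {M N Q : Type u} [AddCommGroup M] [Module k M] [Module R M] [IsScalarTower k R M]
  [AddCommGroup N] [Module k N] [Module R N] [IsScalarTower k R N]
  [AddCommGroup Q] [Module k⟦X⟧ Q] [Module (k⟦X⟧ ⊗[k] R) Q]
  [IsScalarTower k⟦X⟧ (k⟦X⟧ ⊗[k] R) Q]
  {ℳ : ℤ → Submodule k M} {𝒩 : ℤ → Submodule k N} {𝒬 : ℤ → Submodule k⟦X⟧ Q}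
  {π : Q →+ N} {ι : Q →ₗ[k⟦X⟧] (Loc k ⊗[k] M)}

theorem IsDegeneration.special_tensor_smul (h : IsDegeneration R ℳ 𝒩 𝒬 π ι)
    (s : k⟦X⟧ ⊗[k] R) (q : Q) : π (s • q) = augmentation k R s • π q := by
  induction s with
  | zero => rw [map_zero, zero_smul]; exact (congrArg π (zero_smul (k⟦X⟧ ⊗[k] R) q)).trans (map_zero π)
  | add x y hx hy => rw [add_smul, map_add, hx, hy, map_add, add_smul]
  | tmul v r =>
    rw [tmul_smul_eq, h.special_smul, h.special_act, augmentation_tmul, smul_assoc]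

/-- The deformation statement for `S = k⟦X⟧ ⊗ R` and the regular element `X ⊗ 1`, with `R` and `N`
made into `S`-modules through the augmentation. -/
theorem IsDegeneration.exists_functional_lift [IsNoetherianRing (k⟦X⟧ ⊗[k] R)]
    [Module.Finite (k⟦X⟧ ⊗[k] R) Q]
    (h : IsDegeneration R ℳ 𝒩 𝒬 π ι) (p : Ideal R) [p.IsPrime]
    (hext : ∀ (m : ℕ) (g : (Fin m → R) →ₗ[R] N), Function.Surjective g →
      ∀ φ : LinearMap.ker g →ₗ[R] R, ∃ u ∉ p, ∃ ψ : (Fin m → R) →ₗ[R] R,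
        ∀ z : LinearMap.ker g, ψ z = u * φ z)
    (f : N →ₗ[R] R) :
    ∃ (H : Q →ₗ[k⟦X⟧ ⊗[k] R] (k⟦X⟧ ⊗[k] R)) (w : k⟦X⟧ ⊗[k] R), augmentation k R w ∉ p ∧
      ∀ q, augmentation k R (H q) = augmentation k R w * f (π q) := by
  let : Algebra (k⟦X⟧ ⊗[k] R) R := (augmentation k R).toRingHom.toAlgebra
  let : Module (k⟦X⟧ ⊗[k] R) N := Module.compHom N (augmentation k R).toRingHom
  have : IsScalarTower (k⟦X⟧ ⊗[k] R) R N := ⟨fun s r n => mul_smul _ r n⟩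
  have hXS : ∀ s : k⟦X⟧ ⊗[k] R, ((PowerSeries.X : k⟦X⟧) ⊗ₜ[k] (1 : R)) * s =
      (PowerSeries.X : k⟦X⟧) • s := fun s => by
    induction s with
    | zero => simp
    | add x y hx hy => rw [mul_add, hx, hy, smul_add]
    | tmul v r => rw [Algebra.TensorProduct.tmul_mul_tmul, one_mul, TensorProduct.smul_tmul',
        smul_eq_mul]
  have hXQ : ∀ q : Q, ((PowerSeries.X : k⟦X⟧) ⊗ₜ[k] (1 : R)) • q = (PowerSeries.X : k⟦X⟧) • q :=
    fun q => algebraMap_smul (k⟦X⟧ ⊗[k] R) (PowerSeries.X : k⟦X⟧) q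
  let π' : Q →ₗ[k⟦X⟧ ⊗[k] R] N := { π with map_smul' := h.special_tensor_smul }
  exact GradedDegeneration.exists_functional_lift (S := k⟦X⟧ ⊗[k] R) (R := R)
    (x := (PowerSeries.X : k⟦X⟧) ⊗ₜ 1) (π := π') augmentation_surjective
    (by change augmentation k R _ = 0; rw [augmentation_tmul]; simp)
    (fun s hs => by
      obtain ⟨s', hs'⟩ := exists_eq_X_smul_of_reduction_eq_zero
        ((augmentation_eq_reduction s).symm.trans hs)
      exact ⟨s', by rw [hs', hXS]⟩)
    (fun s hs => X_smul_eq_zero (k := k) (by rwa [hXS] at hs))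
    (fun q hq => by
      rw [hXQ] at hq
      exact X_smul_injective_of_injective h.generic_injective 1 (by simpa using hq))
    h.special_surjective
    (fun q hq => by
      obtain ⟨q', hq'⟩ := h.special_ker q hq
      exact ⟨q', by rw [hXQ, hq']⟩) p hext f

end LiftFunctional

/-! ### Criteria for compatibility with degrees. -/

section GradedMaps

variable {S S' M T : Type*} [CommRing S] [CommRing S'] [AddCommGroup M] [Module S M]
  [AddCommGroup T] [Module S' T] {ℳ : ℤ → Submodule S M} {𝒯 : ℤ → Submodule S' T}

/-- An additive map is graded if it respects the degree on an additive generating set of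
homogeneous elements. -/
theorem graded_of_closure (hℳ : DirectSum.IsInternal ℳ) (h𝒯 : DirectSum.IsInternal 𝒯)
    (f : M →+ T) (h : AddSubmonoid.closure {m | ∃ n, m ∈ ℳ n ∧ f m ∈ 𝒯 n} = ⊤) (n : ℤ) (m : M)
    (hm : m ∈ ℳ n) : f m ∈ 𝒯 n := by
  have key : ∀ m, proj h𝒯 n (f m) = f (proj hℳ n m) := by
    intro m
    refine AddSubmonoid.closure_induction
      (motive := fun m _ => proj h𝒯 n (f m) = f (proj hℳ n m)) ?_ (by simp) ?_
      (h ▸ AddSubmonoid.mem_top m)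
    · rintro x ⟨i, hx, hfx⟩
      by_cases hi : i = n
      · subst hi
        rw [proj_of_mem _ hx, proj_of_mem _ hfx]
      · rw [proj_of_mem_ne _ hi hx, proj_of_mem_ne _ hi hfx, map_zero]
    · intro x y _ _ hx hy
      simp only [map_add, hx, hy]
  rw [← proj_of_mem hℳ hm, ← key]
  exact proj_mem _ _ _

theorem proj_add_of_shift (hℳ : DirectSum.IsInternal ℳ) (ρ : M →+ M) (i : ℤ)
    (hρ : ∀ n, ∀ m ∈ ℳ n, ρ m ∈ ℳ (i + n)) (n : ℤ) (m : M) :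
    proj hℳ (i + n) (ρ m) = ρ (proj hℳ n m) := by
  refine homogeneous_induction (P := fun m => proj hℳ (i + n) (ρ m) = ρ (proj hℳ n m))
    hℳ.submodule_iSup_eq_top (fun j x hx => ?_) (by simp)
    (fun x y hx hy => by simp only [map_add, hx, hy]) m
  by_cases hj : j = n
  · subst hj
    rw [proj_of_mem _ hx, proj_of_mem _ (hρ _ _ hx)]
  · rw [proj_of_mem_ne _ hj hx, proj_of_mem_ne _ (by omega) (hρ _ _ hx), map_zero]

end GradedMaps

/-! ### Lifting the projection onto, and the inclusion of, a free summand. -/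

section LiftProjection

variable {k R : Type u} [Field k] [CommRing R] [Algebra k R]
  {F : Type u} [AddCommGroup F] [Module k F] [Module R F] [IsScalarTower k R F]

/-- The action of `r : R` on `k⟦X⟧ ⊗ F` through the right-hand factor. -/
noncomputable abbrev famAct (F : Type u) [AddCommGroup F]
    [Module k F] [Module R F] [IsScalarTower k R F] (r : R) :
    (k⟦X⟧ ⊗[k] F) →ₗ[k⟦X⟧] (k⟦X⟧ ⊗[k] F) :=
  (Algebra.lsmul k k F r).baseChange k⟦X⟧

/-- The base change of `R → F`, `r ↦ r • y`. -/
noncomputable abbrev famSpan (y : F) : (k⟦X⟧ ⊗[k] R) →ₗ[k⟦X⟧] (k⟦X⟧ ⊗[k] F) :=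
  ((LinearMap.toSpanSingleton R F y).restrictScalars k).baseChange k⟦X⟧

theorem famSpan_mul (y : F) (r : R) (s : k⟦X⟧ ⊗[k] R) :
    famSpan y (((1 : k⟦X⟧) ⊗ₜ r) * s) = famAct F r (famSpan y s) := by
  induction s with
  | zero => simp
  | add a b ha hb => rw [mul_add, map_add, ha, hb, map_add, map_add]
  | tmul v a =>
    rw [Algebra.TensorProduct.tmul_mul_tmul, one_mul, LinearMap.baseChange_tmul,
      LinearMap.baseChange_tmul, LinearMap.baseChange_tmul]
    congr 1
    exact mul_smul r a y

theorem reduction_famSpan (y : F) (s : k⟦X⟧ ⊗[k] R) :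
    reduction k F (famSpan y s) = augmentation k R s • y := by
  induction s with
  | zero => simp
  | add a b ha hb => rw [map_add, map_add, ha, hb, map_add, add_smul]
  | tmul v a =>
    rw [LinearMap.baseChange_tmul, reduction_tmul, augmentation_tmul, smul_assoc]
    rfl

variable {M N Q : Type u} [AddCommGroup M] [Module k M] [Module R M] [IsScalarTower k R M]
  [AddCommGroup N] [Module k N] [Module R N] [IsScalarTower k R N]
  [AddCommGroup Q] [Module k⟦X⟧ Q] [Module (k⟦X⟧ ⊗[k] R) Q]
  [IsScalarTower k⟦X⟧ (k⟦X⟧ ⊗[k] R) Q]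
  {𝒜 : ℕ → Submodule k R} {ℱ : ℤ → Submodule k F}
  {ℳ : ℤ → Submodule k M} {𝒩 : ℤ → Submodule k N} {𝒬 : ℤ → Submodule k⟦X⟧ Q}
  {π : Q →+ N × F} {ι : Q →ₗ[k⟦X⟧] (Loc k ⊗[k] M)}

/-- Each coordinate functional lifts up to its own factor `w j`. Multiplying by the product `W j` of
the other factors gives a common factor, whose reduction is outside the prime `p`. -/
theorem IsDegeneration.exists_projection_lift [IsNoetherianRing (k⟦X⟧ ⊗[k] R)]
    [Module.Finite (k⟦X⟧ ⊗[k] R) Q]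
    (h : IsDegeneration R ℳ (prodGrading 𝒩 ℱ) 𝒬 π ι) (p : Ideal R) [p.IsPrime]
    (hext : ∀ (m : ℕ) (g : (Fin m → R) →ₗ[R] N × F), Function.Surjective g →
      ∀ φ : LinearMap.ker g →ₗ[R] R, ∃ u ∉ p, ∃ ψ : (Fin m → R) →ₗ[R] R,
        ∀ z : LinearMap.ker g, ψ z = u * φ z)
    {κ : Type*} [Finite κ] (b : Module.Basis κ R F) :
    ∃ (H : Q →ₗ[k⟦X⟧] (k⟦X⟧ ⊗[k] F)) (a : R), a ∉ p ∧
      (∀ (r : R) q, H (((1 : k⟦X⟧) ⊗ₜ[k] r) • q) = famAct F r (H q)) ∧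
      ∀ q, reduction k F (H q) = a • (π q).2 := by
  classical
  have := Fintype.ofFinite κ
  choose H w hw hH using fun j =>
    h.exists_functional_lift p hext (b.coord j ∘ₗ LinearMap.snd R N F)
  let W : κ → k⟦X⟧ ⊗[k] R := fun j => ∏ i ∈ Finset.univ.erase j, w i
  refine ⟨∑ j, famSpan (b j) ∘ₗ LinearMap.mulLeft k⟦X⟧ (W j) ∘ₗ (H j).restrictScalars k⟦X⟧,
    ∏ i, augmentation k R (w i), ?_, fun r q => ?_, fun q => ?_⟩
  · rw [Ideal.IsPrime.prod_mem_iff]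
    simpa using hw
  · rw [LinearMap.sum_apply, LinearMap.sum_apply, map_sum]
    refine Finset.sum_congr rfl fun j _ => ?_
    change famSpan (b j) (W j * H j (((1 : k⟦X⟧) ⊗ₜ[k] r) • q)) =
      famAct F r (famSpan (b j) (W j * H j q))
    rw [← famSpan_mul, map_smul, smul_eq_mul, mul_left_comm]
  · rw [LinearMap.sum_apply, map_sum]
    conv_rhs => rw [← b.sum_repr (π q).2, Finset.smul_sum]
    refine Finset.sum_congr rfl fun j _ => ?_
    change reduction k F (famSpan (b j) (W j * H j q)) = _
    rw [reduction_famSpan, map_mul, hH, ← mul_assoc, mul_smul, ← map_mul,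
      Finset.prod_erase_mul _ _ (Finset.mem_univ j), map_prod]
    rfl

/-- A component of `a` of positive degree moves `y` out of degree `n`. -/
theorem proj_smul_of_mem [GradedAlgebra 𝒜] (hℱ : IsGradedModule 𝒜 ℱ) (a : R) {n : ℤ} {y : F}
    (hy : y ∈ ℱ n) :
    proj hℱ.isInternal n (a • y) = (DirectSum.decompose 𝒜 a 0 : R) • y := by
  induction a using DirectSum.Decomposition.inductionOn 𝒜 with
  | zero => simp
  | @homogeneous i a =>
    by_cases hi : i = 0
    · subst hi
      rw [DirectSum.decompose_coe, DirectSum.of_eq_same]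
      exact proj_of_mem _ (by simpa using hℱ.smul_mem a.2 hy)
    · rw [DirectSum.decompose_coe, DirectSum.of_eq_of_ne _ _ _ (Ne.symm hi),
        Submodule.coe_zero, zero_smul]
      exact proj_of_mem_ne _ (by omega) (hℱ.smul_mem a.2 hy)
  | add a b ha hb =>
    rw [add_smul, map_add, ha, hb, DirectSum.decompose_add, DirectSum.add_apply,
      Submodule.coe_add, add_smul]

theorem famAct_mem (hℱ : IsGradedModule 𝒜 ℱ) {i : ℕ} {r : R} (hr : r ∈ 𝒜 i) (n : ℤ)
    (z : k⟦X⟧ ⊗[k] F) (hz : z ∈ (ℱ n).baseChange k⟦X⟧) :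
    famAct F r z ∈ (ℱ (i + n)).baseChange k⟦X⟧ := by
  rw [Submodule.baseChange_eq_span] at hz
  refine Submodule.span_induction ?_ (by simp) ?_ ?_ hz
  · rintro _ ⟨q, hq, rfl⟩
    rw [TensorProduct.mk_apply, LinearMap.baseChange_tmul]
    exact Submodule.tmul_mem_baseChange_of_mem _ (hℱ.smul_mem hr hq)
  · intro a b _ _ ha hb
    rw [map_add]
    exact add_mem ha hb
  · intro c a _ ha
    rw [map_smul]
    exact Submodule.smul_mem _ _ ha

omit [Module R F] [IsScalarTower k R F] in
theorem reduction_mem (n : ℤ) (z : k⟦X⟧ ⊗[k] F) (hz : z ∈ (ℱ n).baseChange k⟦X⟧) :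
    reduction k F z ∈ ℱ n := by
  rw [Submodule.baseChange_eq_span] at hz
  refine Submodule.span_induction ?_ (by simp) ?_ ?_ hz
  · rintro _ ⟨q, hq, rfl⟩
    rw [TensorProduct.mk_apply, reduction_tmul, map_one, one_smul]
    exact hq
  · intro a b _ _ ha hb
    rw [map_add]
    exact add_mem ha hb
  · intro c a _ ha
    rw [reduction_smul]
    exact Submodule.smul_mem _ _ ha

/-- The projection of the special fibre onto a free summand lifts to a morphism of graded
modules from the family. -/
theorem IsDegeneration.exists_graded_projection_lift [IsNoetherianRing (k⟦X⟧ ⊗[k] R)]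
    [Module.Finite (k⟦X⟧ ⊗[k] R) Q] [GradedAlgebra 𝒜]
    (h₀ : ∀ a ∈ 𝒜 0, ∃ c : k, algebraMap k R c = a)
    (h : IsDegeneration R ℳ (prodGrading 𝒩 ℱ) 𝒬 π ι)
    (h𝒬 : IsGradedModule (fun i => (𝒜 i).baseChange k⟦X⟧) 𝒬) (hℱ : IsGradedModule 𝒜 ℱ)
    [(HomogeneousIdeal.irrelevant 𝒜).toIdeal.IsPrime]
    (hext : ∀ (m : ℕ) (g : (Fin m → R) →ₗ[R] N × F), Function.Surjective g →
      ∀ φ : LinearMap.ker g →ₗ[R] R, ∃ u ∉ (HomogeneousIdeal.irrelevant 𝒜).toIdeal,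
        ∃ ψ : (Fin m → R) →ₗ[R] R, ∀ z : LinearMap.ker g, ψ z = u * φ z)
    {κ : Type*} [Finite κ] (b : Module.Basis κ R F) :
    ∃ H : Q →ₗ[k⟦X⟧] (k⟦X⟧ ⊗[k] F),
      (∀ (r : R) q, H (((1 : k⟦X⟧) ⊗ₜ[k] r) • q) = famAct F r (H q)) ∧
      (∀ n, ∀ q ∈ 𝒬 n, H q ∈ (ℱ n).baseChange k⟦X⟧) ∧
      ∀ q, reduction k F (H q) = (π q).2 := by
  obtain ⟨H, a, ha, hH, hH'⟩ := h.exists_projection_lift _ hext b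
  -- Since `a` is outside the irrelevant ideal, its degree zero part is a nonzero scalar `c`. The
  -- degree zero part of `H` reduces to `c` times the projection, so dividing by `c` finishes.
  obtain ⟨c, hc⟩ := h₀ (DirectSum.decompose 𝒜 a 0) (SetLike.coe_mem _)
  have hc0 : c ≠ 0 := by
    rintro rfl
    rw [map_zero] at hc
    exact ha ((HomogeneousIdeal.mem_irrelevant_iff 𝒜 a).2 hc.symm)
  have hFV : DirectSum.IsInternal fun n => (ℱ n).baseChange k⟦X⟧ :=
    hℱ.isInternal.baseChange (S := k⟦X⟧)
  let H₀ := degreeZeroPart h𝒬.isInternal hFV H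
  have hH₀ : ∀ n, ∀ q ∈ 𝒬 n, H₀ q = proj hFV n (H q) := fun n q hq =>
    degreeZeroPart_apply _ _ H hq
  refine ⟨(PowerSeries.C c⁻¹ : k⟦X⟧) • H₀, fun r q => ?_, fun n q hq => ?_, fun q => ?_⟩
  · suffices key : H₀ (((1 : k⟦X⟧) ⊗ₜ[k] r) • q) = famAct F r (H₀ q) by
      rw [LinearMap.smul_apply, LinearMap.smul_apply, key]
      exact ((famAct F r).map_smul _ _).symm
    refine homogeneous_induction h𝒬.isInternal.submodule_iSup_eq_top
      (P := fun q => H₀ (((1 : k⟦X⟧) ⊗ₜ[k] r) • q) = famAct F r (H₀ q)) (fun n q hq => ?_)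
      (by rw [smul_zero, map_zero, map_zero])
      (fun x y hx hy => by rw [smul_add, map_add, hx, hy, map_add, map_add]) q
    induction r using DirectSum.Decomposition.inductionOn 𝒜 with
    | zero =>
      rw [TensorProduct.tmul_zero]
      refine (congrArg H₀ (zero_smul (k⟦X⟧ ⊗[k] R) q)).trans ?_
      rw [map_zero, famAct, map_zero, LinearMap.baseChange_zero, LinearMap.zero_apply]
    | @homogeneous i r =>
      have hr : ((1 : k⟦X⟧) ⊗ₜ[k] (r : R)) • q ∈ 𝒬 (i + n) :=
        h𝒬.smul_mem (Submodule.tmul_mem_baseChange_of_mem _ r.2) hq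
      rw [hH₀ _ _ hr, hH₀ _ _ hq, hH]
      have hshift : ∀ m, ∀ z ∈ (ℱ m).baseChange k⟦X⟧,
          famAct F (r : R) z ∈ (ℱ (i + m)).baseChange k⟦X⟧ := famAct_mem hℱ r.2
      exact proj_add_of_shift hFV (famAct F (r : R)).toAddMonoidHom i hshift n (H q)
    | add r s hr hs =>
      rw [TensorProduct.tmul_add, add_smul, map_add, hr, hs, famAct, famAct, famAct, map_add,
        LinearMap.baseChange_add, LinearMap.add_apply]
  · rw [LinearMap.smul_apply, hH₀ n q hq]
    exact Submodule.smul_mem _ _ (proj_mem hFV n _)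
  · rw [LinearMap.smul_apply, reduction_smul, PowerSeries.constantCoeff_C]
    refine homogeneous_induction h𝒬.isInternal.submodule_iSup_eq_top
      (P := fun q => c⁻¹ • reduction k F (H₀ q) = (π q).2) (fun n q hq => ?_) (by simp)
      (fun x y hx hy => by rw [map_add, map_add, smul_add, hx, hy, map_add, Prod.snd_add]) q
    rw [hH₀ n q hq]
    have e1 := proj_comp_of_graded (f := (reduction k F).toAddMonoidHom) hFV hℱ.isInternal
      reduction_mem n (H q)
    change _ = reduction k F _ at e1
    rw [← e1]
    change c⁻¹ • proj hℱ.isInternal n (reduction k F (H q)) = _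
    rw [hH', proj_smul_of_mem hℱ a (h.special_graded n q hq).2, ← hc, algebraMap_smul,
      inv_smul_smul₀ hc0]

/-- The inclusion of a graded free summand of the special fibre lifts to the family. -/
theorem IsDegeneration.exists_inclusion_lift [GradedAlgebra 𝒜]
    (h : IsDegeneration R ℳ (prodGrading 𝒩 ℱ) 𝒬 π ι)
    (h𝒬 : IsGradedModule (fun i => (𝒜 i).baseChange k⟦X⟧) 𝒬) (h𝒩 : DirectSum.IsInternal 𝒩)
    (hℱ : IsGradedModule 𝒜 ℱ) {κ : Type*} [Finite κ] (b : Module.Basis κ R F) {d : κ → ℤ}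
    (hb : ∀ j, b j ∈ ℱ (d j)) :
    ∃ f ∈ familyHom R ℱ 𝒬, ∀ y, π (f y) = (0, y) := by
  have hNF : DirectSum.IsInternal (prodGrading 𝒩 ℱ) := prodGrading_isInternal h𝒩 hℱ.isInternal
  have hlift : ∀ j, ∃ q ∈ 𝒬 (d j), π q = (0, b j) := by
    intro j
    obtain ⟨q, hq⟩ := h.special_surjective (0, b j)
    -- As `π` is graded, the component of degree `d j` of any preimage is again a preimage.
    refine ⟨proj h𝒬.isInternal (d j) q, proj_mem _ _ _, ?_⟩
    have e := proj_comp_of_graded h𝒬.isInternal hNF h.special_graded (d j) q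
    rw [hq] at e
    exact e.symm.trans (proj_of_mem _ (Submodule.mem_prod.2 ⟨zero_mem (𝒩 (d j)), hb j⟩))
  choose q hq hπq using hlift
  obtain ⟨f₀, hf₀, hf₀b⟩ : ∃ f₀ : F →+ Q,
      (∀ (r : R) y, f₀ (r • y) = ((1 : k⟦X⟧) ⊗ₜ[k] r) • f₀ y) ∧ ∀ j, f₀ (b j) = q j := by
    let : Module R Q := Module.compHom Q
      (Algebra.TensorProduct.includeRight : R →ₐ[k] k⟦X⟧ ⊗[k] R).toRingHom
    exact ⟨(b.constr ℕ q).toAddMonoidHom, (b.constr ℕ q).map_smul, b.constr_basis ℕ q⟩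
  have hsum : ∀ y, y ∈ AddSubmonoid.closure {y : F | ∃ (i : ℕ) (r : R) (j : κ), r ∈ 𝒜 i ∧
      y = r • b j} := by
    intro y
    have := Fintype.ofFinite κ
    rw [← b.sum_repr y]
    refine sum_mem fun j _ => ?_
    induction b.repr y j using DirectSum.Decomposition.inductionOn 𝒜 with
    | zero => rw [zero_smul]; exact zero_mem _
    | @homogeneous i r => exact AddSubmonoid.subset_closure ⟨i, r, j, r.2, rfl⟩
    | add r s hr hs => rw [add_smul]; exact add_mem hr hs
  refine ⟨f₀, ⟨hf₀, graded_of_closure hℱ.isInternal h𝒬.isInternal f₀ ?_⟩, fun y => ?_⟩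
  · refine top_le_iff.1 (le_trans (fun y _ => hsum y) (AddSubmonoid.closure_mono ?_))
    rintro _ ⟨i, r, j, hr, rfl⟩
    refine ⟨i + d j, hℱ.smul_mem hr (hb j), ?_⟩
    rw [hf₀, hf₀b]
    exact h𝒬.smul_mem (Submodule.tmul_mem_baseChange_of_mem _ hr) (hq j)
  · refine AddSubmonoid.closure_induction (motive := fun y _ => π (f₀ y) = (0, y)) ?_ ?_ ?_ (hsum y)
    · rintro _ ⟨i, r, j, -, rfl⟩
      rw [hf₀, h.special_act, hf₀b, hπq, Prod.smul_mk, smul_zero]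
    · rw [map_zero, map_zero]
      rfl
    · intro x y _ _ hx hy
      rw [map_add, map_add, hx, hy, Prod.mk_add_mk, add_zero]

end LiftProjection

/-! ### Specializing coefficients from an extension to an infinite field. -/

section Specialization

open MvPolynomial in
-- The determinant is one polynomial over `k` in the coefficients, which allows nonvanishing over
-- `L` to be transferred to `k`.
theorem aeval_det_sum {k A J Λ n : Type*} [CommRing k] [CommRing A] [Algebra k A] [Fintype J]
    [Fintype Λ] [Fintype n] [DecidableEq n] (t : J → Λ → Matrix n n k) (x : J → A) (y : Λ → A) :
    aeval (Sum.elim x y) (∑ j, ∑ l, (X (Sum.inl j) * X (Sum.inr l) : MvPolynomial (J ⊕ Λ) k) •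
      (C : k →+* MvPolynomial (J ⊕ Λ) k).mapMatrix (t j l)).det =
      (∑ j, ∑ l, (x j * y l) • (algebraMap k A).mapMatrix (t j l)).det := by
  rw [AlgHom.map_det]
  congr 1
  ext i i'
  simp [Matrix.sum_apply]

/-- If a bilinear combination of endomorphisms is injective over an extension of an infinite
field, then it is bijective for some values of the coefficients in the field. -/
theorem exists_bijective_sum {k L W J Λ : Type*} [Field k] [Infinite k] [CommRing L]
    [IsDomain L] [Algebra k L] [AddCommGroup W] [Module k W] [Module.Finite k W] [Fintype J]
    [Fintype Λ] (T : J → Λ → Module.End k W) (x : J → L) (y : Λ → L)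
    (hinj : Function.Injective (∑ j, ∑ l, (x j * y l) • (T j l).baseChange L :
      Module.End L (L ⊗[k] W))) :
    ∃ (x' : J → k) (y' : Λ → k),
      Function.Bijective (∑ j, ∑ l, (x' j * y' l) • T j l : Module.End k W) := by
  classical
  let b := Module.finBasis k W
  let t : J → Λ → Matrix _ _ k := fun j l => LinearMap.toMatrix b b (T j l)
  have h1 : (∑ j, ∑ l, (x j * y l) • (algebraMap k L).mapMatrix (t j l)).det ≠ 0 := by
    have h2 : ∑ j, ∑ l, (x j * y l) • (algebraMap k L).mapMatrix (t j l) =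
        LinearMap.toMatrix (Algebra.TensorProduct.basis L b) (Algebra.TensorProduct.basis L b)
          (∑ j, ∑ l, (x j * y l) • (T j l).baseChange L) := by
      simp only [map_sum, map_smul, LinearMap.toMatrix_baseChange]
      rfl
    rw [h2, LinearMap.det_toMatrix]
    intro h3
    exact (LinearMap.bot_lt_ker_of_det_eq_zero h3).ne' (LinearMap.ker_eq_bot.2 hinj)
  rw [← aeval_det_sum] at h1
  -- A polynomial vanishing at all points over an infinite field is zero, so it would also vanish
  -- over `L`.
  obtain ⟨z, hz⟩ : ∃ z, MvPolynomial.eval z (∑ j, ∑ l, (MvPolynomial.X (Sum.inl j) *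
      MvPolynomial.X (Sum.inr l) : MvPolynomial (J ⊕ Λ) k) •
      (MvPolynomial.C : k →+* MvPolynomial (J ⊕ Λ) k).mapMatrix (t j l)).det ≠ 0 := by
    by_contra! hcon
    exact h1 ((congrArg _ (MvPolynomial.funext (q := 0) fun z =>
      (hcon z).trans (map_zero _).symm)).trans (map_zero _))
  refine ⟨z ∘ Sum.inl, z ∘ Sum.inr, ?_⟩
  have h4 := aeval_det_sum t (z ∘ Sum.inl) (z ∘ Sum.inr)
  rw [Sum.elim_comp_inl_inr] at h4
  change MvPolynomial.eval z _ = _ at h4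
  rw [← Module.End.isUnit_iff, LinearMap.isUnit_iff_isUnit_det, ← LinearMap.det_toMatrix b,
    isUnit_iff_ne_zero]
  rw [h4] at hz
  convert hz using 2
  simp [t]

end Specialization

/-! ### Generic morphisms in terms of morphisms over `k`. -/

section Expansion

variable {k R : Type u} [Field k] [CommRing R] [Algebra k R]
  {M Y : Type u} [AddCommGroup M] [Module k M] [Module R M] [IsScalarTower k R M]
  [AddCommGroup Y] [Module k Y] [Module R Y] [IsScalarTower k R Y]
  {ℳ : ℤ → Submodule k M} {𝒴 : ℤ → Submodule k Y}

/-- A graded equivariant map to `K ⊗ M` is a finite combination of morphisms of graded modules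
with coefficients in `K`. -/
theorem exists_expansion [Module.Finite R Y] (φ : Y →ₗ[k] (Loc k ⊗[k] M))
    (hφ : ∀ (r : R) y, φ (r • y) = locAct M r (φ y))
    (hφ' : ∀ n, ∀ y ∈ 𝒴 n, φ y ∈ (ℳ n).baseChange (Loc k)) :
    ∃ (J : Type u) (_ : Fintype J) (x : J → Loc k) (α : J → (Y →ₗ[R] M)),
      (∀ j, IsHomogeneousMap 𝒴 ℳ (α j)) ∧ ∀ y, φ y = ∑ j, x j ⊗ₜ[k] α j y := by
  classical
  -- The coordinates of `φ` along a `k`-basis of `K` are graded `R`-linear maps, and finite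
  -- generation of `Y` leaves only finitely many nonzero.
  let e := Module.Basis.ofVectorSpace k (Loc k)
  let E := TensorProduct.equivFinsuppOfBasisLeft (N := M) e
  have hE : ∀ a m s, E (a ⊗ₜ m) s = e.repr a s • m := fun a m s =>
    TensorProduct.equivFinsuppOfBasisLeft_apply_tmul_apply e a m s
  have hEact : ∀ (r : R) z s, E (locAct M r z) s = r • E z s := by
    intro r z s
    induction z with
    | zero => simp
    | add a b ha hb => simp only [map_add, Finsupp.add_apply, ha, hb, smul_add]
    | tmul a m =>
      rw [LinearMap.baseChange_tmul, hE, hE]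
      exact (smul_comm _ _ _)
  have hEgr : ∀ n, ∀ z ∈ (ℳ n).baseChange (Loc k), ∀ s, E z s ∈ ℳ n := by
    intro n z hz s
    obtain ⟨w, hw⟩ := (Submodule.toBaseChange_surjective (A := Loc k) (ℳ n)) ⟨z, hz⟩
    have hw' : ((Submodule.toBaseChange (Loc k) (ℳ n)) w : Loc k ⊗[k] M) = z :=
      congrArg Subtype.val hw
    rw [← hw']
    clear hw hw'
    induction w with
    | zero => simp
    | add a b ha hb =>
      rw [map_add, Submodule.coe_add, map_add, Finsupp.add_apply]
      exact add_mem ha hb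
    | tmul a m =>
      rw [Submodule.coe_toBaseChange_tmul, hE]
      exact Submodule.smul_mem _ _ m.2
  let α : _ → (Y →ₗ[R] M) := fun s =>
    { toFun := fun y => E (φ y) s
      map_add' := fun y y' => by rw [map_add, map_add, Finsupp.add_apply]
      map_smul' := fun r y => by rw [hφ, hEact, RingHom.id_apply] }
  obtain ⟨t, ht⟩ := (Module.Finite.fg_top : (⊤ : Submodule R Y).FG)
  let J := t.biUnion fun y => (E (φ y)).support
  have hJ : ∀ s ∉ J, α s = 0 := by
    intro s hs
    refine LinearMap.ext_on ht fun y hy => ?_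
    by_contra hne
    exact hs (Finset.mem_biUnion.2 ⟨y, hy, Finsupp.mem_support_iff.2 hne⟩)
  refine ⟨J, inferInstance, fun s => e s, fun s => α s, fun s n y hy => hEgr n _ (hφ' n y hy) s,
    fun y => ?_⟩
  rw [Finset.sum_coe_sort J fun s => e s ⊗ₜ[k] α s y]
  have h1 := E.symm_apply_apply (φ y)
  rw [TensorProduct.equivFinsuppOfBasisLeft_symm_apply] at h1
  rw [← h1]
  refine Finsupp.sum_of_support_subset _ (fun s hs => ?_) _ (by simp)
  by_contra hs'
  exact Finsupp.mem_support_iff.1 hs (LinearMap.congr_fun (hJ s hs') y)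

end Expansion

/-! ### From the identity modulo the uniformizer to generic injectivity. -/

section Injectivity

variable {k F : Type u} [Field k] [AddCommGroup F] [Module k F]

variable (k F) in
/-- The localization map `k⟦X⟧ ⊗ F → K ⊗ F`. -/
noncomputable def famLoc : (k⟦X⟧ ⊗[k] F) →ₗ[k⟦X⟧] (Loc k ⊗[k] F) :=
  TensorProduct.AlgebraTensorModule.map (Algebra.linearMap k⟦X⟧ (Loc k)) LinearMap.id

theorem famLoc_tmul (v : k⟦X⟧) (y : F) :
    famLoc k F (v ⊗ₜ y) = algebraMap k⟦X⟧ (Loc k) v ⊗ₜ y := rfl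

theorem famLoc_injective : Function.Injective (famLoc k F) := by
  have h1 : Function.Injective ((Algebra.linearMap k⟦X⟧ (Loc k)).restrictScalars k) :=
    IsLocalization.injective (Loc k)
      (powers_le_nonZeroDivisors_of_noZeroDivisors PowerSeries.X_ne_zero)
  have h2 := Module.Flat.rTensor_preserves_injective_linearMap (M := F) _ h1
  have h3 : ∀ z, famLoc k F z =
      ((Algebra.linearMap k⟦X⟧ (Loc k)).restrictScalars k).rTensor F z := by
    intro z
    induction z with
    | zero => rw [map_zero, map_zero]
    | add x y hx hy => rw [map_add, map_add, hx, hy]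
    | tmul v y => rfl
  intro z w hzw
  rw [h3, h3] at hzw
  exact h2 hzw

theorem exists_famLoc_eq (z : Loc k ⊗[k] F) :
    ∃ (n : ℕ) (w : k⟦X⟧ ⊗[k] F), famLoc k F w = (PowerSeries.X : k⟦X⟧) ^ n • z := by
  induction z with
  | zero => exact ⟨0, 0, by simp⟩
  | add x y hx hy =>
    obtain ⟨n, a, hn⟩ := hx
    obtain ⟨m, b, hm⟩ := hy
    refine ⟨n + m, (PowerSeries.X : k⟦X⟧) ^ m • a + (PowerSeries.X : k⟦X⟧) ^ n • b, ?_⟩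
    rw [map_add, map_smul, map_smul, hn, hm, smul_add, smul_smul, smul_smul, ← pow_add,
      ← pow_add, add_comm m n]
  | tmul a y =>
    obtain ⟨n, v, hv⟩ := exists_X_pow_smul_loc a
    exact ⟨n, v ⊗ₜ y, by rw [famLoc_tmul, ← hv, TensorProduct.smul_tmul']⟩

/-- The module is free over `k⟦X⟧`, so separatedness can be read off from power series coefficients.
-/
theorem eq_zero_of_forall_X_pow_dvd {z : k⟦X⟧ ⊗[k] F}
    (hz : ∀ n : ℕ, ∃ w, z = (PowerSeries.X : k⟦X⟧) ^ n • w) : z = 0 := by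
  let b := Module.Free.chooseBasis k⟦X⟧ (k⟦X⟧ ⊗[k] F)
  rw [← map_eq_zero_iff b.repr b.repr.injective]
  ext j m
  obtain ⟨w, hw⟩ := hz (m + 1)
  rw [hw, map_smul, Finsupp.smul_apply, smul_eq_mul, PowerSeries.coeff_X_pow_mul']
  simp

/-- A map that is the identity on the special fibre is injective on the generic fibre. -/
theorem liftBaseChange_injective_of_reduction (θ : F →ₗ[k] (k⟦X⟧ ⊗[k] F))
    (hθ : ∀ y, reduction k F (θ y) = y) :
    Function.Injective (((famLoc k F).restrictScalars k ∘ₗ θ).liftBaseChange (Loc k)) := by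
  let θ' := θ.liftBaseChange k⟦X⟧
  have hred : ∀ z, reduction k F (θ' z) = reduction k F z := by
    intro z
    induction z with
    | zero => simp
    | add x y hx hy => simp only [map_add, hx, hy]
    | tmul v y => rw [LinearMap.liftBaseChange_tmul, reduction_smul, hθ, reduction_tmul]
  have hinj : ∀ z, θ' z = 0 → z = 0 := by
    intro z hz
    refine eq_zero_of_forall_X_pow_dvd fun n => ?_
    -- An element of the kernel reduces to zero, so it is divisible by `X`, and its quotient by `X`
    -- is in the kernel again.
    have key : ∃ w, z = (PowerSeries.X : k⟦X⟧) ^ n • w ∧ θ' w = 0 := by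
      induction n with
      | zero => exact ⟨z, by simp, hz⟩
      | succ n ih =>
        obtain ⟨w, rfl, hw⟩ := ih
        obtain ⟨w', rfl⟩ := exists_eq_X_smul_of_reduction_eq_zero (z := w) (by
          rw [← hred, hw, map_zero])
        refine ⟨w', by rw [smul_smul, ← pow_succ], X_smul_eq_zero (k := k) ?_⟩
        rw [← map_smul, hw]
    exact ⟨_, key.choose_spec.1⟩
  have hcomm : ∀ w, ((famLoc k F).restrictScalars k ∘ₗ θ).liftBaseChange (Loc k)
      (famLoc k F w) = famLoc k F (θ' w) := by
    intro w
    induction w with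
    | zero => simp
    | add x y hx hy => simp only [map_add, hx, hy]
    | tmul v y =>
      rw [famLoc_tmul, LinearMap.liftBaseChange_tmul, LinearMap.liftBaseChange_tmul, map_smul,
        algebraMap_smul]
      rfl
  rw [injective_iff_map_eq_zero]
  intro z hz
  obtain ⟨n, w, hw⟩ := exists_famLoc_eq z
  have h1 : w = 0 := by
    refine hinj w (famLoc_injective ?_)
    rw [← hcomm, hw, ← algebraMap_smul (Loc k), map_smul, hz, smul_zero, map_zero]
  rw [h1, map_zero] at hw
  exact X_pow_smul_injective (k := k) n (by simpa using hw.symm)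

end Injectivity

/-! ### Extending maps from a family to the generic fibres. -/

section GenericExtension

variable {k R : Type u} [Field k] [CommRing R] [Algebra k R]
  {F : Type u} [AddCommGroup F] [Module k F] [Module R F] [IsScalarTower k R F]
  {M N Q : Type u} [AddCommGroup M] [Module k M] [Module R M] [IsScalarTower k R M]
  [AddCommGroup N] [Module k N] [Module R N] [IsScalarTower k R N]
  [AddCommGroup Q] [Module k⟦X⟧ Q] [Module (k⟦X⟧ ⊗[k] R) Q]
  [IsScalarTower k⟦X⟧ (k⟦X⟧ ⊗[k] R) Q]
  {𝒜 : ℕ → Submodule k R} {ℱ : ℤ → Submodule k F}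
  {ℳ : ℤ → Submodule k M} {𝒩 : ℤ → Submodule k N} {𝒬 : ℤ → Submodule k⟦X⟧ Q}
  {ι : Q →ₗ[k⟦X⟧] (Loc k ⊗[k] M)}

theorem famLoc_famAct (r : R) (z : k⟦X⟧ ⊗[k] F) :
    famLoc k F (famAct F r z) = locAct F r (famLoc k F z) := by
  induction z with
  | zero => simp
  | add a b ha hb => simp only [map_add, ha, hb]
  | tmul v y => rfl

omit [Module R F] [IsScalarTower k R F] in
theorem famLoc_mem (n : ℤ) (z : k⟦X⟧ ⊗[k] F) (hz : z ∈ (ℱ n).baseChange k⟦X⟧) :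
    famLoc k F z ∈ (ℱ n).baseChange (Loc k) := by
  rw [Submodule.baseChange_eq_span] at hz
  refine Submodule.span_induction ?_ (by simp) ?_ ?_ hz
  · rintro _ ⟨q, hq, rfl⟩
    rw [TensorProduct.mk_apply, famLoc_tmul]
    exact Submodule.tmul_mem_baseChange_of_mem _ hq
  · intro a b _ _ ha hb
    rw [map_add]
    exact add_mem ha hb
  · intro c a _ ha
    rw [map_smul, ← algebraMap_smul (Loc k)]
    exact Submodule.smul_mem _ _ ha

omit [Module R F] [IsScalarTower k R F] in
theorem X_pow_smul_mem_iff (P : Submodule (Loc k) (Loc k ⊗[k] F)) (n : ℕ) (z : Loc k ⊗[k] F) :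
    (PowerSeries.X : k⟦X⟧) ^ n • z ∈ P ↔ z ∈ P := by
  rw [← algebraMap_smul (Loc k), map_pow]
  exact P.smul_mem_iff_of_isUnit ((isUnit_algebraMap_X (k := k)).pow n)

/-- An equivariant graded map from a family to `k⟦X⟧ ⊗ F` extends to the generic fibres. -/
theorem IsDegeneration.exists_generic_extension {N' : Type u} [AddCommGroup N'] [Module k N']
    [Module R N'] {𝒩' : ℤ → Submodule k N'} {π : Q →+ N'}
    (h : IsDegeneration R ℳ 𝒩' 𝒬 π ι) (h𝒬 : DirectSum.IsInternal 𝒬)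
    (hℳ : DirectSum.IsInternal ℳ) (H : Q →ₗ[k⟦X⟧] (k⟦X⟧ ⊗[k] F))
    (hH : ∀ (r : R) q, H (((1 : k⟦X⟧) ⊗ₜ[k] r) • q) = famAct F r (H q))
    (hH' : ∀ n, ∀ q ∈ 𝒬 n, H q ∈ (ℱ n).baseChange k⟦X⟧) :
    ∃ B : (Loc k ⊗[k] M) →ₗ[Loc k] (Loc k ⊗[k] F),
      (∀ q, B (ι q) = famLoc k F (H q)) ∧
      (∀ (r : R) z, B (locAct M r z) = locAct F r (B z)) ∧
      ∀ n, ∀ z ∈ (ℳ n).baseChange (Loc k), B z ∈ (ℱ n).baseChange (Loc k) := by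
  have := isLocalizedModule_of_injective h.generic_injective h.generic_surj
  have hid : IsLocalizedModule (Submonoid.powers (PowerSeries.X : k⟦X⟧))
      (LinearMap.id : (Loc k ⊗[k] F) →ₗ[k⟦X⟧] (Loc k ⊗[k] F)) :=
    isLocalizedModule_of_injective Function.injective_id fun z => ⟨0, z, by simp⟩
  -- `ι` is a localization at the uniformizer, which acts invertibly on `K ⊗ F`, so the composite
  -- with `H` factors through `ι`.
  let B₀ := IsLocalizedModule.lift (Submonoid.powers (PowerSeries.X : k⟦X⟧)) ι
    (famLoc k F ∘ₗ H) hid.map_units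
  let B := B₀.extendScalarsOfIsLocalization
    (Submonoid.powers (PowerSeries.X : k⟦X⟧)) (Loc k)
  have hB : ∀ q, B (ι q) = famLoc k F (H q) := fun q =>
    LinearMap.congr_fun (IsLocalizedModule.lift_comp _ ι (famLoc k F ∘ₗ H) hid.map_units) q
  have hX : ∀ (n : ℕ) z, B ((PowerSeries.X : k⟦X⟧) ^ n • z) = (PowerSeries.X : k⟦X⟧) ^ n • B z :=
    fun n z => map_smul B₀ _ z
  refine ⟨B, hB, fun r z => ?_, fun n z hz => ?_⟩
  · obtain ⟨n, q, hq⟩ := h.generic_surj z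
    apply X_pow_smul_injective (k := k) n
    dsimp only
    rw [← hX]
    have h1 : (PowerSeries.X : k⟦X⟧) ^ n • locAct M r z =
        ι (((1 : k⟦X⟧) ⊗ₜ[k] r) • q) := by
      rw [h.generic_act, hq, ← algebraMap_smul (Loc k), ← map_smul, algebraMap_smul]
    have h2 : (PowerSeries.X : k⟦X⟧) ^ n • locAct F r (B z) =
        locAct F r (famLoc k F (H q)) := by
      rw [← hB, hq, hX, ← algebraMap_smul (Loc k), ← map_smul, algebraMap_smul]
    rw [h1, h2, hB, hH, famLoc_famAct]
  · obtain ⟨m, q, hq⟩ := h.generic_surj z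
    rw [← X_pow_smul_mem_iff _ m, ← hX, ← hq, hB]
    refine famLoc_mem n _ (hH' n q ?_)
    rw [← mem_iff_of_injective ι h.generic_injective h𝒬.submodule_iSup_eq_top
      (hℳ.baseChange (S := Loc k)) h.generic_graded, hq]
    exact (X_pow_smul_mem_iff _ m z).2 hz

end GenericExtension

/-! ### Descending a generic splitting to `k`. -/

section Splitting

variable {k R : Type u} [Field k] [CommRing R] [Algebra k R]
  {F : Type u} [AddCommGroup F] [Module k F] [Module R F] [IsScalarTower k R F]
  {M : Type u} [AddCommGroup M] [Module k M] [Module R M] [IsScalarTower k R M]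
  {𝒜 : ℕ → Submodule k R} {ℱ : ℤ → Submodule k F} {ℳ : ℤ → Submodule k M}

/-- A surjective graded endomorphism of a finite graded module over a Noetherian ring has a
graded inverse. -/
theorem exists_graded_inverse [IsNoetherianRing R] [Module.Finite R F]
    (hℱ : DirectSum.IsInternal ℱ) (g : F →ₗ[R] F) (hg : IsHomogeneousMap ℱ ℱ g)
    (hs : Function.Surjective g) :
    ∃ g' : F →ₗ[R] F, IsHomogeneousMap ℱ ℱ g' ∧ g' ∘ₗ g = LinearMap.id := by
  have hi : Function.Injective g := OrzechProperty.injective_of_surjective_endomorphism g hs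
  let e := LinearEquiv.ofBijective g ⟨hi, hs⟩
  refine ⟨e.symm, fun n y hy => ?_, LinearMap.ext fun y => e.symm_apply_apply y⟩
  rw [← mem_iff_of_injective g hi hℱ.submodule_iSup_eq_top hℱ hg]
  exact (e.apply_symm_apply y).symm ▸ hy

/-- If `F → M → F` is injective over the generic point, with components defined over `K`, then
`F` is a graded direct summand of `M`. -/
theorem exists_graded_splitting [Infinite k] [IsNoetherianRing R] [Module.Finite R F]
    [Module.Finite R M] (hℱ : IsGradedModule 𝒜 ℱ) (hfin : ∀ n, Module.Finite k (ℱ n))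
    (a : F →ₗ[k] (Loc k ⊗[k] M)) (ha : ∀ (r : R) y, a (r • y) = locAct M r (a y))
    (ha' : ∀ n, ∀ y ∈ ℱ n, a y ∈ (ℳ n).baseChange (Loc k))
    (B : (Loc k ⊗[k] M) →ₗ[Loc k] (Loc k ⊗[k] F))
    (hB : ∀ (r : R) z, B (locAct M r z) = locAct F r (B z))
    (hB' : ∀ n, ∀ z ∈ (ℳ n).baseChange (Loc k), B z ∈ (ℱ n).baseChange (Loc k))
    (hinj : Function.Injective ((B.restrictScalars k ∘ₗ a).liftBaseChange (Loc k))) :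
    ∃ (i : F →ₗ[R] M) (p : M →ₗ[R] F), IsHomogeneousMap ℱ ℳ i ∧ IsHomogeneousMap ℳ ℱ p ∧
      p ∘ₗ i = LinearMap.id := by
  obtain ⟨J, _, x, α, hα, hx⟩ := exists_expansion a ha ha'
  let β₀ : M →ₗ[k] (Loc k ⊗[k] F) := B.restrictScalars k ∘ₗ TensorProduct.mk k (Loc k) M 1
  obtain ⟨Λ, _, y, β, hβ, hy⟩ := exists_expansion (𝒴 := ℳ) (ℳ := ℱ) β₀
    (fun (r : R) m => by
      change B (1 ⊗ₜ (r • m)) = _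
      exact hB r (1 ⊗ₜ m))
    (fun n m hm => hB' n _ (Submodule.tmul_mem_baseChange_of_mem _ hm))
  have hBa : ∀ f, B (a f) = ∑ j, ∑ l, (x j * y l) ⊗ₜ[k] β l (α j f) := by
    intro f
    rw [hx, map_sum]
    refine Finset.sum_congr rfl fun j _ => ?_
    have h1 : x j ⊗ₜ[k] α j f = x j • ((1 : Loc k) ⊗ₜ[k] α j f) := by
      rw [TensorProduct.smul_tmul', smul_eq_mul, mul_one]
    rw [h1, map_smul, show B (1 ⊗ₜ α j f) = _ from hy (α j f), Finset.smul_sum]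
    refine Finset.sum_congr rfl fun l _ => ?_
    rw [TensorProduct.smul_tmul', smul_eq_mul]
  obtain ⟨n, w, d, hw, hspan⟩ := hℱ.exists_homogeneous_generators
  -- A finite-dimensional space that contains generators of `F` and is stable under all graded
  -- endomorphisms, so that determinants make sense.
  let W : Submodule k F := ⨆ j, ℱ (d j)
  have : Module.Finite k W := Module.Finite.iff_fg.2
    (Submodule.fg_iSup _ fun j => Module.Finite.iff_fg.1 (hfin (d j)))
  have hWmap : ∀ j l, ∀ z ∈ W, ((β l ∘ₗ α j).restrictScalars k) z ∈ W := by
    intro j l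
    have : W ≤ W.comap ((β l ∘ₗ α j).restrictScalars k) := iSup_le fun s z hz =>
      Submodule.mem_iSup_of_mem s (hβ l _ _ (hα j _ z hz))
    exact this
  let T : J → Λ → Module.End k W := fun j l =>
    ((β l ∘ₗ α j).restrictScalars k).restrict (hWmap j l)
  have hsub : Function.Injective (W.subtype.lTensor (Loc k)) :=
    Module.Flat.lTensor_preserves_injective_linearMap _ W.injective_subtype
  obtain ⟨x', y', hbij⟩ := exists_bijective_sum (L := Loc k) T x y (by
    refine Function.Injective.of_comp (f := W.subtype.lTensor (Loc k)) ?_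
    convert hinj.comp hsub using 1
    funext z
    dsimp only [Function.comp]
    induction z with
    | zero => simp
    | add z z' hz hz' => simp only [map_add, hz, hz']
    | tmul c z =>
      rw [LinearMap.lTensor_tmul, LinearMap.liftBaseChange_tmul]
      change _ = c • B (a z)
      rw [hBa, LinearMap.sum_apply, map_sum, Finset.smul_sum]
      refine Finset.sum_congr rfl fun j _ => ?_
      rw [LinearMap.sum_apply, map_sum, Finset.smul_sum]
      refine Finset.sum_congr rfl fun l _ => ?_
      rw [LinearMap.smul_apply, LinearMap.baseChange_tmul, TensorProduct.smul_tmul',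
        LinearMap.lTensor_tmul, TensorProduct.smul_tmul', smul_eq_mul, smul_eq_mul, mul_comm]
      rfl)
  let i₀ : F →ₗ[R] M := ∑ j, x' j • α j
  let p₀ : M →ₗ[R] F := ∑ l, y' l • β l
  have hi₀ : IsHomogeneousMap ℱ ℳ i₀ :=
    (gradedHom (R := R) ℱ ℳ).sum_mem fun j _ => Submodule.smul_mem _ _ (hα j)
  have hp₀ : IsHomogeneousMap ℳ ℱ p₀ :=
    (gradedHom (R := R) ℳ ℱ).sum_mem fun l _ => Submodule.smul_mem _ _ (hβ l)
  have hcomp : ∀ z : W, (((∑ j, ∑ l, (x' j * y' l) • T j l : Module.End k W) z : W) : F) =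
      p₀ (i₀ z) := by
    intro z
    have h1 : i₀ z = ∑ j, x' j • α j z := by
      simp only [i₀, LinearMap.sum_apply, LinearMap.smul_apply]
    rw [h1, map_sum, LinearMap.sum_apply, Submodule.coe_sum]
    refine Finset.sum_congr rfl fun j _ => ?_
    rw [LinearMap.sum_apply, Submodule.coe_sum, LinearMap.map_smul_of_tower, LinearMap.sum_apply,
      Finset.smul_sum]
    refine Finset.sum_congr rfl fun l _ => ?_
    rw [LinearMap.smul_apply, LinearMap.smul_apply, smul_smul]
    rfl
  -- Bijectivity on `W` puts the generators into the image; the surjective endomorphism is then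
  -- invertible, and its inverse corrects `p₀`.
  have hsurj : Function.Surjective (p₀ ∘ₗ i₀) := by
    rw [← LinearMap.range_eq_top, eq_top_iff, ← hspan, Submodule.span_le]
    rintro _ ⟨j, rfl⟩
    obtain ⟨z, hz⟩ := hbij.2 ⟨w j, Submodule.mem_iSup_of_mem j (hw j)⟩
    exact ⟨z, (hcomp z).symm.trans (congrArg Subtype.val hz)⟩
  obtain ⟨g, hg, hg'⟩ := exists_graded_inverse hℱ.isInternal (p₀ ∘ₗ i₀)
    (fun n z hz => hp₀ n _ (hi₀ n z hz)) hsurj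
  exact ⟨i₀, g ∘ₗ p₀, hi₀, fun n m hm => hg n _ (hp₀ n m hm), hg'⟩

end Splitting

/-! ### Free summands over Gorenstein rings; part (2). -/

section FreeCancellation

variable {k R : Type u} [Field k] [CommRing R] [Algebra k R]
  {F : Type u} [AddCommGroup F] [Module k F] [Module R F] [IsScalarTower k R F]
  {M N : Type u} [AddCommGroup M] [Module k M] [Module R M] [IsScalarTower k R M]
  [AddCommGroup N] [Module k N] [Module R N] [IsScalarTower k R N]
  {𝒜 : ℕ → Submodule k R} {ℱ : ℤ → Submodule k F}
  {ℳ : ℤ → Submodule k M} {𝒩 : ℤ → Submodule k N}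

/-- The irrelevant ideal is the kernel of the projection onto the degree zero part, where nonzero
elements are invertible scalars. -/
theorem isPrime_irrelevant [Nontrivial R] [GradedAlgebra 𝒜]
    (h₀ : ∀ a ∈ 𝒜 0, ∃ c : k, algebraMap k R c = a) :
    (HomogeneousIdeal.irrelevant 𝒜).toIdeal.IsPrime := by
  have hmem : ∀ a, a ∈ (HomogeneousIdeal.irrelevant 𝒜).toIdeal ↔
      GradedRing.projZeroRingHom 𝒜 a = 0 := fun a => HomogeneousIdeal.mem_irrelevant_iff 𝒜 a
  refine ⟨(Ideal.ne_top_iff_one _).2 ?_, fun {a b} hab => ?_⟩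
  · rw [hmem, map_one]
    exact one_ne_zero
  · rw [hmem, map_mul] at hab
    rw [hmem, hmem]
    obtain ⟨c, hc⟩ := h₀ (GradedRing.projZeroRingHom 𝒜 a) (SetLike.coe_mem _)
    by_cases hc0 : c = 0
    · left
      rw [← hc, hc0, map_zero]
    · right
      rw [← hc] at hab
      have h1 : algebraMap k R c⁻¹ * (algebraMap k R c * GradedRing.projZeroRingHom 𝒜 b) = 0 := by
        rw [hab, mul_zero]
      rwa [← mul_assoc, ← map_mul, inv_mul_cancel₀ hc0, map_one, one_mul] at h1

/-- Over a Gorenstein ring, functionals on the syzygies of `N ⊕ F` extend near the irrelevant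
ideal if `N` is graded Cohen-Macaulay and `F` is free. -/
theorem exists_extension_of_isGorenstein [IsNoetherianRing R] [GradedAlgebra 𝒜]
    [(HomogeneousIdeal.irrelevant 𝒜).toIdeal.IsPrime] (hR : IsGorenstein R)
    [Module.Finite R N] (hN : IsGradedCM 𝒜 N) [Module.Projective R F] (m : ℕ)
    (g : (Fin m → R) →ₗ[R] N × F) (hg : Function.Surjective g) (φ : LinearMap.ker g →ₗ[R] R) :
    ∃ u ∉ (HomogeneousIdeal.irrelevant 𝒜).toIdeal, ∃ ψ : (Fin m → R) →ₗ[R] R,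
      ∀ z : LinearMap.ker g, ψ z = u * φ z := by
  obtain ⟨n, hn⟩ := hR (HomogeneousIdeal.irrelevant 𝒜).toIdeal
  have h1 := subsingleton_ext_localized_of_depth _ hn hN
  have h2 := subsingleton_ext_prod_projective (F := F) _ _ h1
  exact exists_extension_of_localized (HomogeneousIdeal.irrelevant 𝒜).toIdeal h2 hg φ

-- The quotient embeds into `M` as the complement of `i`, by the graded map `m ↦ m - i (p m)`.
omit [IsScalarTower k R N] [Module k N] [Module R N] in
theorem isInternal_quotientGrading (hℳ : DirectSum.IsInternal ℳ) {i : F →ₗ[R] M} {p : M →ₗ[R] F}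
    (hi : IsHomogeneousMap ℱ ℳ i) (hp : IsHomogeneousMap ℳ ℱ p) (hpi : p ∘ₗ i = LinearMap.id) :
    DirectSum.IsInternal (quotientGrading ℳ (LinearMap.range i)) := by
  have hpi' : ∀ y, p (i y) = y := fun y => LinearMap.congr_fun hpi y
  let s : (M ⧸ LinearMap.range i) →ₗ[R] M :=
    (LinearMap.range i).liftQ (LinearMap.id - i ∘ₗ p) (by
      rintro _ ⟨y, rfl⟩
      rw [LinearMap.mem_ker, LinearMap.sub_apply, LinearMap.comp_apply, hpi', LinearMap.id_apply,
        sub_self])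
  have hs : ∀ m, s ((LinearMap.range i).mkQ m) = m - i (p m) := fun m => rfl
  refine isInternal_of_injective s ?_ ?_ hℳ ?_
  · rw [injective_iff_map_eq_zero]
    intro z hz
    obtain ⟨m, rfl⟩ := (LinearMap.range i).mkQ_surjective z
    rw [hs, sub_eq_zero] at hz
    rw [hz, ← LinearMap.mem_ker, Submodule.ker_mkQ]
    exact ⟨_, rfl⟩
  · change ⨆ n, (ℳ n).map ((LinearMap.range i).mkQ.restrictScalars k) = ⊤
    rw [← Submodule.map_iSup, hℳ.submodule_iSup_eq_top, Submodule.map_top, LinearMap.range_eq_top]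
    exact (LinearMap.range i).mkQ_surjective
  · rintro n _ ⟨m, hm, rfl⟩
    exact sub_mem hm (hi n _ (hp n m hm))

/-- Cancellation of a graded free summand of the special fibre. -/
theorem Degenerates.cancel_free [Infinite k] [Nontrivial R] [IsNoetherianRing R] [GradedAlgebra 𝒜]
    (h₀ : ∀ a ∈ 𝒜 0, ∃ c : k, algebraMap k R c = a) [Module.Finite R M] [Module.Finite R N]
    [Module.Finite R F] (hR : IsGorenstein R) (hN : IsGradedCM 𝒜 N)
    (hℳ : IsGradedModule 𝒜 ℳ) (h𝒩 : IsGradedModule 𝒜 𝒩) (hℱ : IsGradedModule 𝒜 ℱ)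
    (hfree : IsGradedFree R ℱ) (h : Degenerates 𝒜 ℳ (prodGrading 𝒩 ℱ)) :
    (∃ (i : F →ₗ[R] M) (p : M →ₗ[R] F), IsHomogeneousMap ℱ ℳ i ∧ IsHomogeneousMap ℳ ℱ p ∧
      p ∘ₗ i = LinearMap.id) ∧
    ∀ (i : F →ₗ[R] M) (p : M →ₗ[R] F), IsHomogeneousMap ℱ ℳ i → IsHomogeneousMap ℳ ℱ p →
      p ∘ₗ i = LinearMap.id → Degenerates 𝒜 (quotientGrading ℳ (LinearMap.range i)) 𝒩 := by
  obtain ⟨κ, b, d, hb⟩ := hfree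
  have : Finite κ := Module.Finite.finite_basis b
  have := Module.Free.of_basis b
  obtain ⟨Q, _, _, _, _, 𝒬, π, ι, h𝒬, _, h⟩ := h.exists_isDegeneration
  have := isNoetherianRing_powerSeries_tensor 𝒜 h₀
  have := isPrime_irrelevant h₀ (𝒜 := 𝒜)
  have hfin := finite_piece h₀ hℱ
  obtain ⟨f, hf, hπf⟩ := h.exists_inclusion_lift h𝒬 h𝒩.isInternal hℱ b hb
  refine ⟨?_, fun i p hi hp hpi => ?_⟩
  · obtain ⟨H, hH, hH', hH''⟩ := h.exists_graded_projection_lift h₀ h𝒬 hℱ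
      (exists_extension_of_isGorenstein hR hN) b
    obtain ⟨B, hBι, hB, hB'⟩ := h.exists_generic_extension h𝒬.isInternal hℳ.isInternal H hH hH'
    -- `θ` is the lifted inclusion followed by the lifted projection: the identity modulo the
    -- uniformizer, hence injective generically.
    let θ : F →ₗ[k] (k⟦X⟧ ⊗[k] F) :=
      { toFun := fun y => H (f y)
        map_add' := fun y y' => by rw [map_add, map_add]
        map_smul' := fun c y => by
          rw [familyHom_map_smul hf, map_smul, RingHom.id_apply]
          exact algebraMap_smul k⟦X⟧ c (H (f y)) }
    have hθ : ∀ y, reduction k F (θ y) = y := fun y => by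
      rw [show θ y = H (f y) from rfl, hH'', hπf]
    refine exists_graded_splitting hℱ hfin (familyHom.toGeneric ι hf) (fun r y => ?_)
      (fun n y hy => ?_) B hB hB' ?_
    · exact (congrArg ι (hf.1 r y)).trans (h.generic_act r (f y))
    · exact h.generic_graded n _ (hf.2 n y hy)
    · convert liftBaseChange_injective_of_reduction θ hθ using 3
      exact LinearMap.ext fun y => hBι (f y)
  -- Any splitting of `M` will do here, since the lift of the inclusion is perturbed to suit the
  -- given `p`.
  · refine h.cancel h𝒬 hℳ.isInternal h𝒩.isInternal hℱ
      (isInternal_quotientGrading hℳ.isInternal hi hp hpi) hfin hi hp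
      (c := (LinearMap.range i).mkQ) ?_ hpi (Submodule.mkQ_surjective _)
      (LinearMap.exact_map_mkQ_range i) hf hπf
    exact fun n m hm => ⟨m, hm, rfl⟩

end FreeCancellation

end GradedDegeneration

theorem lemma3p9 {k R : Type u} [Field k] [CharZero k]
    [CommRing R] [Nontrivial R] [IsNoetherianRing R] [Algebra k R]
    (𝒜 : ℕ → Submodule k R) [GradedAlgebra 𝒜]
    (h𝒜₀ : (𝒜 0 : Set R) = Set.range (algebraMap k R))
    (hCM : GradedDegeneration.IsGradedCM 𝒜 R)
    {M N : Type u}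
    [AddCommGroup M] [Module k M] [Module R M] [IsScalarTower k R M] [Module.Finite R M]
    [AddCommGroup N] [Module k N] [Module R N] [IsScalarTower k R N] [Module.Finite R N]
    (ℳ : ℤ → Submodule k M) (𝒩 : ℤ → Submodule k N)
    (hℳ : GradedDegeneration.IsGradedModule 𝒜 ℳ)
    (h𝒩 : GradedDegeneration.IsGradedModule 𝒜 𝒩) :
    (∀ (X : Type u) [AddCommGroup X] [Module k X] [Module R X] [IsScalarTower k R X]
        [Module.Finite R X] (𝒳 : ℤ → Submodule k X),
      GradedDegeneration.IsGradedModule 𝒜 𝒳 →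
      GradedDegeneration.homDim R 𝒳 ℳ = GradedDegeneration.homDim R 𝒳 𝒩 →
      GradedDegeneration.Degenerates 𝒜
        (GradedDegeneration.prodGrading ℳ 𝒳) (GradedDegeneration.prodGrading 𝒩 𝒳) →
      GradedDegeneration.Degenerates 𝒜 ℳ 𝒩) ∧
    (GradedDegeneration.IsGorenstein R →
      GradedDegeneration.IsGradedCM 𝒜 M → GradedDegeneration.IsGradedCM 𝒜 N →
      ∀ (F : Type u) [AddCommGroup F] [Module k F] [Module R F] [IsScalarTower k R F]
        [Module.Finite R F] (ℱ : ℤ → Submodule k F),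
      GradedDegeneration.IsGradedModule 𝒜 ℱ →
      GradedDegeneration.IsGradedFree R ℱ →
      GradedDegeneration.Degenerates 𝒜 ℳ (GradedDegeneration.prodGrading 𝒩 ℱ) →
      (∃ (i : F →ₗ[R] M) (p : M →ₗ[R] F),
        GradedDegeneration.IsHomogeneousMap ℱ ℳ i ∧
        GradedDegeneration.IsHomogeneousMap ℳ ℱ p ∧ p ∘ₗ i = LinearMap.id) ∧
      (∀ (i : F →ₗ[R] M) (p : M →ₗ[R] F),
        GradedDegeneration.IsHomogeneousMap ℱ ℳ i →
        GradedDegeneration.IsHomogeneousMap ℳ ℱ p → p ∘ₗ i = LinearMap.id →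
        GradedDegeneration.Degenerates 𝒜
          (GradedDegeneration.quotientGrading ℳ (LinearMap.range i)) 𝒩)) := by
  have h₀ : ∀ a ∈ 𝒜 0, ∃ c : k, algebraMap k R c = a := fun a ha => by
    have : a ∈ (𝒜 0 : Set R) := ha
    rwa [h𝒜₀] at this
  refine ⟨fun X _ _ _ _ _ 𝒳 h𝒳 hdim h => h.cancel h₀ hℳ h𝒩 h𝒳 hdim,
    fun hR _ hN F _ _ _ _ _ ℱ hℱ hfree h => h.cancel_free h₀ hR hN hℳ h𝒩 hℱ hfree⟩
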